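/- **Conventions.** $\hat f(\xi)=\int f(x)e^{-2i\pi\langle x,\xi\rangle}dx$. Fix a Littlewood-Paley partition of unity on $\mathbf R$: nonnegative $w_0,w\in C_c^\infty(\mathbf R)$ supported in $[-2,2]$ and $[\frac12,2]$ respectively, such that, with $w_n(x)=w(|x|/2^n)$ for $n\ge1$, one has $\sum_{n\ge0}w_n(x)=1$ for every $x\in\mathbf R$. Let $W_n$ be the Schwartz function with $\widehat{W_n}=w_n$. For $0<\delta<1$, a $\delta$-tube $R$ in $\mathbf R^d$ is the image of $[0,1]\times B_{\mathbf R^{d-1}}(0,\delta)$ (open ball) under an affine isometry of $\mathbf R^d$, and $\overline R$ is the image of $[2,3]\times B_{\mathbf R^{d-1}}(0,\delta)$ under the same isometry. Let $f_d(\delta)$ be the infimum of the $\varepsilon>0$ for which there is a nonempty finite family of $\delta$-tubes $(R_j)$ in $\mathbf R^d$ with the $\overline R_j$ pairwise disjoint and $|\bigcup_jR_j|\le\varepsilon\sum_j|R_j|$. **Theorem.** For every $d\ge1$ there is a constant $C_d$, and there is a constant $C_2'$, depending only on $d$ (respectively on nothing) and on the choice of $w_0,w$, such that the following holds. Let $1<p<\infty$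 and let $m:(0,\infty)\to\mathbf R$ be a bounded measurable function such that $T$, the Fourier multiplier with symbol $\xi\mapsto m(|\xi|)$, is bounded on $L_p(\mathbf R^d)$. Put $\varphi(t)=m(e^t)$, $t\in\mathbf R$. Then for every $n\ge0$ $$\|W_n*\varphi\|_\infty\le C_d\,\|T\|_{L_p\to L_p}\inf_{\delta\in(0,1)}\Big(f_d(\delta)^{|\frac1p-\frac12|}+\frac1{2^n\delta^2}\Big).$$ If $d=2$, then for every $n\ge1$ $$\|W_n*\varphi\|_\infty\le C_2'\,\|T\|_{L_p\to L_p}\,n^{-|\frac1p-\frac12|},$$ and, with $F(t)=\int_0^t\varphi(s)\,ds$, for every $0<h<1$ $$\sup_{t\in\mathbf R}\frac{|F(t+h)+F(t-h)-2F(t)|}{h}\le C_2'\,\|T\|_{L_p\to L_p}\,|\log h|^{-|\frac1p-\frac12|}.$$ -/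

import Mathlib

open MeasureTheory
open scoped FourierTransform SchwartzMap ENNReal ContDiff Convolution

noncomputable section

/-- `ℝ^d` with its Euclidean norm and Lebesgue measure. -/
abbrev Euc (d : ℕ) : Type := EuclideanSpace ℝ (Fin d)

/-- The two functions `w₀`, `w` that generate a Littlewood-Paley partition of unity on `ℝ`:
`w₀(x) + ∑_{n ≥ 1} w(|x| / 2^n) = 1` for every real `x`. -/
structure LittlewoodPaley where
  w₀ : ℝ → ℝ
  w : ℝ → ℝ
  smooth₀ : ContDiff ℝ ∞ w₀
  smooth : ContDiff ℝ ∞ w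
  nonneg₀ : ∀ x, 0 ≤ w₀ x
  nonneg : ∀ x, 0 ≤ w x
  support₀ : tsupport w₀ ⊆ Set.Icc (-2) 2
  support : tsupport w ⊆ Set.Icc (1 / 2) 2
  partition : ∀ x : ℝ, HasSum (fun n : ℕ => w (|x| / 2 ^ (n + 1))) (1 - w₀ x)

namespace LittlewoodPaley

/-- The `n`-th function of the partition of unity: `w₀` for `n = 0`, `x ↦ w(|x| / 2^n)` for
`n ≥ 1`. -/
def wn (P : LittlewoodPaley) (n : ℕ) (x : ℝ) : ℝ :=
  if n = 0 then P.w₀ x else P.w (|x| / 2 ^ n)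

/-- The function `W_n` whose Fourier transform is `w_n`, with the convention
`f̂(ξ) = ∫ f(x) e^{-2iπxξ} dx`. -/
def W (P : LittlewoodPaley) (n : ℕ) : ℝ → ℂ :=
  𝓕⁻ (fun x : ℝ => (P.wn n x : ℂ))

/-- The convolution `W_n ∗ φ` for a real-valued function `φ`. -/
def block (P : LittlewoodPaley) (n : ℕ) (φ : ℝ → ℝ) : ℝ → ℂ :=
  P.W n ⋆[ContinuousLinearMap.mul ℝ ℂ, volume] (fun s : ℝ => (φ s : ℂ))

end LittlewoodPaley

/-- The position of an oriented tube of length one in `ℝ^d`: the centre of its initial face and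
its unit direction. An affine isometry of `ℝ^d = ℝ × ℝ^{d-1}` maps `(s, y)` to
`base + s • dir + z`, where `y ↦ z` is an isometry from `ℝ^{d-1}` onto the orthogonal complement
of `dir`; so the image of `[a, b] × B(0, δ)` depends only on `base` and `dir`. -/
structure Tube (d : ℕ) where
  base : Euc d
  dir : Euc d
  norm_dir : ‖dir‖ = 1

namespace Tube

/-- The image of `[a, b] × B(0, δ)` under an affine isometry that maps `(0, 0)` to `base` and
`(1, 0)` to `base + dir`. -/
def slab {d : ℕ} (R : Tube d) (δ a b : ℝ) : Set (Euc d) :=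
  {x | inner ℝ (x - R.base) R.dir ∈ Set.Icc a b ∧
    ‖(x - R.base) - (inner ℝ (x - R.base) R.dir : ℝ) • R.dir‖ < δ}

/-- The `δ`-tube `R` itself, the image of `[0, 1] × B(0, δ)`. -/
def body {d : ℕ} (R : Tube d) (δ : ℝ) : Set (Euc d) := R.slab δ 0 1

/-- The translate of the `δ`-tube `R` by twice its direction vector, that is, the image of
`[2, 3] × B(0, δ)`. -/
def reach {d : ℕ} (R : Tube d) (δ : ℝ) : Set (Euc d) := R.slab δ 2 3

end Tube

/-- The infimum of the `ε > 0` for which there is a (nonempty) finite family of `δ`-tubes in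
`ℝ^d` whose reaches are pairwise disjoint and such that `|⋃ R_j| / ∑ |R_j| ≤ ε`. -/
def tubeCompression (d : ℕ) (δ : ℝ) : ℝ :=
  sInf {ε : ℝ | 0 < ε ∧ ∃ N : ℕ, 0 < N ∧ ∃ R : Fin N → Tube d,
    (∀ i j, i ≠ j → Disjoint ((R i).reach δ) ((R j).reach δ)) ∧
    volume.real (⋃ j, (R j).body δ) / ∑ j, volume.real ((R j).body δ) ≤ ε}

/-- The restriction of `m` to `(0, ∞)` is measurable and bounded; the values of `m` elsewhere are
irrelevant. -/
def IsBoundedMeasurableOnPos (m : ℝ → ℝ) : Prop :=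
  Measurable (fun r : Set.Ioi (0 : ℝ) => m r) ∧ ∃ M : ℝ, ∀ r : ℝ, 0 < r → |m r| ≤ M

/-- The bounded operator `T` on `L_p(ℝ^d)` is the Fourier multiplier with symbol `ξ ↦ m(|ξ|)`:
on the Schwartz functions (dense in `L_p` for finite `p`) it multiplies the Fourier transform by
the symbol. -/
def IsRadialMultiplier {d : ℕ} {p : ℝ≥0∞} [Fact (1 ≤ p)] (m : ℝ → ℝ)
    (T : Lp ℂ p (volume : Measure (Euc d)) →L[ℂ] Lp ℂ p (volume : Measure (Euc d))) : Prop :=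
  ∀ f : 𝓢(Euc d, ℂ),
    (T (f.toLp p volume) : Euc d → ℂ) =ᵐ[volume]
      𝓕⁻ (fun ξ : Euc d => (m ‖ξ‖ : ℂ) * 𝓕 (f : Euc d → ℂ) ξ)

end

open scoped ComplexConjugate

/-! The symbol is radial, so the form `⟨T f, g⟩` does not change when `f` and `g` are moved by the
same isometry. Put modulated bumps `f` on the model tube `[0,1] × B(0,δ)` and `g` on its reach
`[2,3] × B(0,δ)`, and copy the pair onto `N` tubes with disjoint reaches. Averaging `⟨T ∑ σ_j f_j, ∑
σ_j g_j⟩` over all signs kills the cross terms and leaves `N ⟨T f, g⟩`. For `p ≤ 2` the sum of the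
`g_j` is controlled in `L_q` by disjointness, while Hölder on the small set `⋃ R_j` reduces the
`L_p` norm of the sum of the `f_j` to its `L_2` norm, which orthogonality of the signs controls on
average. Hence `|⟨T f, g⟩| ≤ ‖T‖ ε^(1/p - 1/2) |R|` for every ratio `ε` realised by tubes
(`norm_sum_radialForm_le`, `norm_radialForm_le_of_isTubeCompression`). For `p > 2` the roles of `f`
and `g` are exchanged, the symbol being real.

On the Fourier side the form integrates `m(√(x² + |η|²))` against a kernel in `x` centred at the
modulation frequency and a weight in `η` living at scale `1/δ`. Around `x = l`, the substitution
`√(x² + |η|²) = l exp(u/l - 1)` turns this into a smooth average of `φ` at scale `1/l`, up to an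
error `sup|m| / (l δ²)`; the rough function `m` is never differentiated
(`exists_norm_integral_sub_integral_exp_le`, `exists_norm_kernelForm_sub_le`). Also `sup|m| ≤ K ‖T‖`
almost everywhere (`exists_bounded_representative`). The kernel is the Fourier transform of a
correlation that does not vanish on `(-3,-1)`; superposing modulation frequencies gives every smooth
multiplier supported there, and dilation, reflection and a partition of unity then give the dyadic
shell (`hasTubeBound_of_dyadic`).

In the plane, `2^N` tubes of width `2^(-N)/16` along the lines of a dyadic Kakeya configuration
realise a ratio `C/N` (`exists_isTubeCompression_two`), and `N ≈ n/4` gives the decay in `n`. For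
the second difference of `F`, the `n`-th block contributes about `h n^(-a) min(2^n h, (2^n h)⁻¹)`,
with `a = |1/p - 1/2|`; the sum concentrates where `2^n ≈ 1/h`
(`exists_abs_secondDifference_div_le`). -/

noncomputable section

/-! ### The sesquilinear form of a radial multiplier -/

section RadialForm

variable {V W : Type*} [NormedAddCommGroup V] [InnerProductSpace ℝ V] [FiniteDimensional ℝ V]
  [MeasurableSpace V] [BorelSpace V] [NormedAddCommGroup W] [InnerProductSpace ℝ W]
  [FiniteDimensional ℝ W] [MeasurableSpace W] [BorelSpace W]

/-- The sesquilinear form `⟨T f, g⟩` of the Fourier multiplier with symbol `ξ ↦ m ‖ξ‖`. -/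
def radialForm (m : ℝ → ℝ) (f g : V → ℂ) : ℂ :=
  ∫ ξ : V, (m ‖ξ‖ : ℂ) * 𝓕 f ξ * conj (𝓕 g ξ)

variable (V) in
/-- The form of the radial multiplier is bounded by `A` on `L_p × L_q`. -/
def HasRadialFormBound (m : ℝ → ℝ) (p q : ℝ≥0∞) (A : ℝ) : Prop :=
  ∀ f g : 𝓢(V, ℂ), ‖radialForm m f g‖ ≤
    A * (eLpNorm f p (volume : Measure V)).toReal * (eLpNorm g q (volume : Measure V)).toReal

/-- A real symbol gives a Hermitian form. Through `HasRadialFormBound.symm` this reduces exponents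
above `2` to exponents below `2`. -/
theorem radialForm_conj (m : ℝ → ℝ) (f g : V → ℂ) :
    radialForm m g f = conj (radialForm m f g) := by
  unfold radialForm
  rw [← integral_conj]
  congr 1
  ext ξ
  simp
  ring

theorem HasRadialFormBound.symm {m : ℝ → ℝ} {p q : ℝ≥0∞} {A : ℝ}
    (h : HasRadialFormBound V m p q A) : HasRadialFormBound V m q p A := by
  intro f g
  rw [radialForm_conj, RCLike.norm_conj]
  exact (h g f).trans (le_of_eq (by ring))

theorem fourier_conj_neg (g : V → ℂ) (ξ : V) :
    𝓕 (fun x => conj (g (-x))) ξ = conj (𝓕 g ξ) := by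
  rw [Real.fourier_eq', Real.fourier_eq', ← integral_conj, ← integral_neg_eq_self]
  congr 1
  ext v
  simp [← Complex.exp_conj, Complex.conj_ofNat]

/-- Reflecting and conjugating `g` turns Parseval into the symmetry of the Fourier kernel, which is
Fubini. Integrability of both functions suffices, so a discontinuous symbol is harmless. -/
theorem integral_fourierInv_mul_conj {F g : V → ℂ} (hF : Integrable F) (hg : Integrable g) :
    ∫ x, 𝓕⁻ F x * conj (g x) = ∫ ξ, F ξ * conj (𝓕 g ξ) := by
  have h1 : ∫ x, 𝓕⁻ F x * conj (g x) = ∫ x, 𝓕 F x * conj (g (-x)) := by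
    rw [← integral_neg_eq_self]
    simp [Real.fourierInv_eq_fourier_neg]
  have hg' : Integrable (fun x => conj (g (-x))) := by
    have := hg.comp_neg
    exact (LinearIsometryEquiv.integrable_comp_iff (RCLike.conjLIE (K := ℂ))).2 this
  rw [h1]
  simp_rw [← fourier_conj_neg g]
  have := VectorFourier.integral_fourierIntegral_smul_eq_flip (L := innerₗ V) (μ := volume)
    (ν := volume) Real.continuous_fourierChar continuous_inner hF hg'
  simpa [Real.fourier_eq, VectorFourier.fourierIntegral, real_inner_comm] using this

theorem integrable_radial_mul {m : ℝ → ℝ} (hm : Measurable m) {M : ℝ} (hM : ∀ r, |m r| ≤ M)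
    {F : V → ℂ} (hF : Integrable F) : Integrable (fun ξ : V => (m ‖ξ‖ : ℂ) * F ξ) := by
  refine hF.bdd_mul (c := M) ?_ ?_
  · exact (Complex.measurable_ofReal.comp (hm.comp measurable_norm)).aestronglyMeasurable
  · exact Filter.Eventually.of_forall fun ξ => by simpa using hM ‖ξ‖

theorem norm_integral_mul_conj_le {p q : ℝ≥0∞} [p.HolderConjugate q] {F g : V → ℂ}
    (hF : MemLp F p) (hg : MemLp g q) :
    ‖∫ x, F x * conj (g x)‖ ≤ (eLpNorm F p volume).toReal * (eLpNorm g q volume).toReal := by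
  have hg' : MemLp (fun x => conj (g x)) q := by
    refine hg.congr_norm (by exact (Complex.continuous_conj.comp_aestronglyMeasurable hg.1)) ?_
    exact Filter.Eventually.of_forall fun x => by simp
  have h2 : eLpNorm (fun x => conj (g x)) q volume = eLpNorm g q volume :=
    eLpNorm_congr_norm_ae (Filter.Eventually.of_forall fun x => by simp)
  have h := eLpNorm_smul_le_mul_eLpNorm (p := p) (q := q) (r := 1) hg'.1 hF.1
  rw [h2] at h
  calc ‖∫ x, F x * conj (g x)‖ ≤ (eLpNorm (F • fun x => conj (g x)) 1 volume).toReal := by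
        rw [eLpNorm_one_eq_lintegral_enorm]
        refine (norm_integral_le_lintegral_norm _).trans (le_of_eq ?_)
        congr 2
        ext x
        simp
    _ ≤ _ := by
        rw [← ENNReal.toReal_mul]
        exact ENNReal.toReal_mono (ENNReal.mul_ne_top hF.2.ne hg.2.ne) h

/-- The operator leaves the argument here. The inequality that remains involves only the symbol and
Schwartz functions, and is stable under dilations and null-set changes of the symbol. -/
theorem hasRadialFormBound_of_isRadialMultiplier {d : ℕ} {p q : ℝ≥0∞} [Fact (1 ≤ p)]
    [p.HolderConjugate q] {m : ℝ → ℝ} (hm : Measurable m) {M : ℝ} (hM : ∀ r, |m r| ≤ M)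
    {T : Lp ℂ p (volume : Measure (Euc d)) →L[ℂ] Lp ℂ p (volume : Measure (Euc d))}
    (hT : IsRadialMultiplier m T) : HasRadialFormBound (Euc d) m p q ‖T‖ := by
  intro f g
  have hf : Integrable (fun ξ : Euc d => (m ‖ξ‖ : ℂ) * 𝓕 (f : Euc d → ℂ) ξ) := by
    apply integrable_radial_mul hm hM
    rw [← SchwartzMap.fourier_coe]
    exact (𝓕 f).integrable
  unfold radialForm
  rw [← integral_fourierInv_mul_conj hf g.integrable]
  have h1 : ∫ x, 𝓕⁻ (fun ξ : Euc d => (m ‖ξ‖ : ℂ) * 𝓕 (f : Euc d → ℂ) ξ) x * conj (g x) =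
      ∫ x, (T (f.toLp p volume) : Euc d → ℂ) x * conj (g x) := by
    refine integral_congr_ae ?_
    filter_upwards [hT f] with x hx
    rw [hx]
  rw [h1]
  refine (norm_integral_mul_conj_le (Lp.memLp _) (g.memLp q volume)).trans ?_
  gcongr
  have h2 := T.le_opNorm (f.toLp p volume)
  rw [Lp.norm_def, SchwartzMap.norm_toLp] at h2
  exact h2

end RadialForm

/-! ### Moving functions by isometries -/

section Transport

variable {V W : Type*} [NormedAddCommGroup V] [InnerProductSpace ℝ V] [NormedAddCommGroup W]
  [InnerProductSpace ℝ W]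

/-- The function `f` carried along the affine isometry `v ↦ b + U v`. -/
def transport (U : V ≃ₗᵢ[ℝ] W) (b : W) (f : 𝓢(V, ℂ)) : 𝓢(W, ℂ) :=
  SchwartzMap.compSubConstCLM ℂ b
    (SchwartzMap.compCLMOfContinuousLinearEquiv ℂ U.symm.toContinuousLinearEquiv f)

theorem transport_apply (U : V ≃ₗᵢ[ℝ] W) (b : W) (f : 𝓢(V, ℂ)) (x : W) :
    transport U b f x = f (U.symm (x - b)) := rfl

end Transport

/-! ### Dilation and isometry invariance of the form -/

section Invariance

variable {V W : Type*} [NormedAddCommGroup V] [InnerProductSpace ℝ V] [FiniteDimensional ℝ V]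
  [MeasurableSpace V] [BorelSpace V] [NormedAddCommGroup W] [InnerProductSpace ℝ W]
  [FiniteDimensional ℝ W] [MeasurableSpace W] [BorelSpace W]

theorem fourier_comp_smul (f : V → ℂ) {c : ℝ} (hc : 0 < c) (ξ : V) :
    𝓕 (fun x => f (c • x)) ξ =
      ((c ^ Module.finrank ℝ V)⁻¹ : ℝ) • 𝓕 f (c⁻¹ • ξ) := by
  rw [Real.fourier_eq, Real.fourier_eq]
  have := Measure.integral_comp_smul (volume : Measure V)
    (fun x => Real.fourierChar (-inner ℝ x (c⁻¹ • ξ)) • f x) c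
  rw [abs_of_pos (by positivity)] at this
  rw [← this]
  congr 1
  ext v
  rw [inner_smul_left, inner_smul_right]
  simp [hc.ne']

theorem eLpNorm_comp_smul {p : ℝ≥0∞} (hp : p ≠ ⊤) {f : V → ℂ} (hf : Continuous f) {c : ℝ}
    (hc : 0 < c) : (eLpNorm (fun x => f (c • x)) p (volume : Measure V)).toReal =
      ((c ^ Module.finrank ℝ V)⁻¹) ^ (1 / p.toReal) * (eLpNorm f p (volume : Measure V)).toReal := by
  have h := eLpNorm_map_measure (p := p) (μ := (volume : Measure V)) (f := fun x : V => c • x)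
    (g := f) hf.aestronglyMeasurable (by fun_prop)
  rw [Function.comp_def] at h
  rw [← h, Measure.map_addHaar_smul _ hc.ne', eLpNorm_smul_measure_of_ne_top hp]
  rw [smul_eq_mul, ENNReal.toReal_mul, abs_of_pos (by positivity), one_div, ENNReal.toReal_inv,
    ← ENNReal.toReal_rpow, ENNReal.toReal_ofReal (by positivity), one_div]

/-- The constant `A` is unchanged: since `1/p + 1/q = 1`, the powers of `c` from the two norms
multiply to `c^(-dim)`, which is also the factor produced by the form. -/
theorem HasRadialFormBound.dilate {m : ℝ → ℝ} {p q : ℝ≥0∞} (hp : p ≠ ⊤) (hq : q ≠ ⊤)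
    (hpq : p.HolderConjugate q) {A : ℝ} (h : HasRadialFormBound V m p q A) {c : ℝ} (hc : 0 < c) :
    HasRadialFormBound V (fun r => m (c * r)) p q A := by
  intro f g
  let e : V ≃L[ℝ] V := ContinuousLinearEquiv.smulLeft (Units.mk0 c hc.ne')
  have he : ∀ k : 𝓢(V, ℂ), (SchwartzMap.compCLMOfContinuousLinearEquiv ℂ e k : V → ℂ) =
    fun x => k (c • x) := fun k => rfl
  have h1 := h (SchwartzMap.compCLMOfContinuousLinearEquiv ℂ e f)
    (SchwartzMap.compCLMOfContinuousLinearEquiv ℂ e g)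
  rw [he, he, eLpNorm_comp_smul hp f.continuous hc, eLpNorm_comp_smul hq g.continuous hc] at h1
  set D : ℝ := (c ^ Module.finrank ℝ V)⁻¹ with hD
  have hDpos : 0 < D := by positivity
  have hexp : D ^ (1 / p.toReal) * D ^ (1 / q.toReal) = D := by
    rw [← Real.rpow_add hDpos]
    have := hpq.inv_add_inv_eq_one
    have h2 : (p⁻¹ + q⁻¹).toReal = 1 := by rw [this]; simp
    rw [ENNReal.toReal_add (by simpa using hpq.ne_zero) (by simpa using hpq.symm.ne_zero),
      ENNReal.toReal_inv, ENNReal.toReal_inv] at h2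
    rw [one_div, one_div, h2, Real.rpow_one]
  have hform : radialForm m (fun x => f (c • x)) (fun x => g (c • x)) =
      (D : ℂ) * radialForm (fun r => m (c * r)) (f : V → ℂ) g := by
    unfold radialForm
    have := Measure.integral_comp_smul (volume : Measure V)
      (fun ξ => (m (c * ‖ξ‖) : ℂ) * 𝓕 (f : V → ℂ) ξ * conj (𝓕 (g : V → ℂ) ξ)) c⁻¹
    simp_rw [fourier_comp_smul _ hc]
    rw [abs_of_pos (by positivity)] at this
    have h3 : ∀ ξ : V, (m ‖ξ‖ : ℂ) * D • 𝓕 (f : V → ℂ) (c⁻¹ • ξ) *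
        conj (D • 𝓕 (g : V → ℂ) (c⁻¹ • ξ)) = ((D : ℂ) * D) * ((m (c * ‖c⁻¹ • ξ‖) : ℂ) *
          𝓕 (f : V → ℂ) (c⁻¹ • ξ) * conj (𝓕 (g : V → ℂ) (c⁻¹ • ξ))) := by
      intro ξ
      rw [norm_smul, Real.norm_eq_abs, abs_of_pos (by positivity), mul_inv_cancel_left₀ hc.ne']
      simp
      ring
    rw [← hD]
    simp_rw [h3]
    rw [integral_const_mul, this, inv_pow, ← hD, inv_inv, Complex.real_smul]
    rw [hD]
    push_cast
    field_simp
  rw [hform, norm_mul, Complex.norm_real, Real.norm_of_nonneg hDpos.le] at h1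
  have h4 : A * (D ^ (1 / p.toReal) * (eLpNorm f p (volume : Measure V)).toReal) *
      (D ^ (1 / q.toReal) * (eLpNorm g q (volume : Measure V)).toReal) =
      D * (A * (eLpNorm f p (volume : Measure V)).toReal *
        (eLpNorm g q (volume : Measure V)).toReal) := by
    nth_rw 3 [← hexp]
    ring
  rw [h4] at h1
  exact le_of_mul_le_mul_left h1 hDpos

theorem fourier_transport (U : V ≃ₗᵢ[ℝ] W) (b : W) (f : 𝓢(V, ℂ)) (ξ : W) :
    𝓕 (transport U b f : W → ℂ) ξ =
      Real.fourierChar (-inner ℝ b ξ) • 𝓕 (f : V → ℂ) (U.symm ξ) := by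
  rw [Real.fourier_eq, ← Real.fourier_comp_linearIsometry, Real.fourier_eq, Circle.smul_def,
    ← integral_smul, ← integral_add_right_eq_self _ b]
  congr 1
  ext v
  simp only [transport_apply, add_sub_cancel_right, Function.comp_apply, inner_add_left,
    neg_add_rev, AddChar.map_add_eq_mul, mul_smul, Circle.smul_def]

/-- The translation contributes a unimodular phase that cancels against its conjugate, and the
linear part preserves `‖ξ‖`. -/
theorem radialForm_transport (m : ℝ → ℝ) (U : V ≃ₗᵢ[ℝ] W) (b : W) (f g : 𝓢(V, ℂ)) :
    radialForm m (transport U b f : W → ℂ) (transport U b g) = radialForm m (f : V → ℂ) g := by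
  unfold radialForm
  simp_rw [fourier_transport]
  rw [← U.symm.measurePreserving.integral_comp U.symm.toHomeomorph.measurableEmbedding]
  congr 1
  ext ξ
  rw [LinearIsometryEquiv.norm_map, Circle.smul_def, Circle.smul_def, smul_eq_mul, smul_eq_mul,
    map_mul]
  have : (Real.fourierChar (-inner ℝ b ξ) : ℂ) * conj (Real.fourierChar (-inner ℝ b ξ) : ℂ) = 1 := by
    rw [Complex.mul_conj, Circle.normSq_coe]; simp
  linear_combination ((m ‖ξ‖ : ℂ) * 𝓕 (f : V → ℂ) (U.symm ξ) *
    conj (𝓕 (g : V → ℂ) (U.symm ξ))) * this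

end Invariance

/-! ### The symbol is bounded by the norm of the multiplier -/

section SupBound

open Filter Topology

variable {V : Type*} [NormedAddCommGroup V] [InnerProductSpace ℝ V] [FiniteDimensional ℝ V]
  [MeasurableSpace V] [BorelSpace V]

/-- The `L_p` norms of a Schwartz function are bounded uniformly in `p`. -/
theorem exists_eLpNorm_schwartz_le (F : 𝓢(V, ℂ)) : ∃ B : ℝ, 0 ≤ B ∧ ∀ p : ℝ≥0∞, 1 ≤ p → p ≠ ⊤ →
    (eLpNorm F p (volume : Measure V)).toReal ≤ B := by
  obtain ⟨S, hS⟩ : ∃ S : ℝ, ∀ x, ‖F x‖ ≤ S :=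
    ⟨‖F.toBoundedContinuousFunction‖, fun x => F.toBoundedContinuousFunction.norm_coe_le_norm x⟩
  set S' : ℝ≥0∞ := max 1 (ENNReal.ofReal S)
  set I : ℝ≥0∞ := max 1 (∫⁻ x, ‖F x‖ₑ)
  have hI : I ≠ ⊤ := by
    have := F.integrable (μ := volume)
    have h := this.2
    rw [hasFiniteIntegral_iff_enorm] at h
    simp [I, h.ne]
  have hS' : S' ≠ ⊤ := by simp [S']
  refine ⟨(S' * I).toReal, ENNReal.toReal_nonneg, fun p hp hpt => ?_⟩
  refine ENNReal.toReal_mono (ENNReal.mul_ne_top hS' hI) ?_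
  have hp1 : 1 ≤ p.toReal := by
    simpa using ENNReal.toReal_mono hpt hp
  rw [eLpNorm_eq_lintegral_rpow_enorm_toReal (by positivity) hpt]
  calc (∫⁻ x, ‖F x‖ₑ ^ p.toReal) ^ (1 / p.toReal)
      ≤ ((S' * I) ^ p.toReal) ^ (1 / p.toReal) := by
        gcongr
        calc ∫⁻ x, ‖F x‖ₑ ^ p.toReal ≤ ∫⁻ x, S' ^ (p.toReal - 1) * ‖F x‖ₑ := by
              refine lintegral_mono fun x => ?_
              have h1 : ‖F x‖ₑ ^ p.toReal = ‖F x‖ₑ ^ (p.toReal - 1) * ‖F x‖ₑ := by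
                nth_rw 3 [← ENNReal.rpow_one (‖F x‖ₑ)]
                rw [← ENNReal.rpow_add_of_nonneg _ _ (by linarith) zero_le_one]
                simp
              dsimp only
              rw [h1]
              gcongr
              · refine le_max_of_le_right ?_
                rw [← ofReal_norm]
                exact ENNReal.ofReal_le_ofReal (hS x)
          _ = S' ^ (p.toReal - 1) * ∫⁻ x, ‖F x‖ₑ :=
              lintegral_const_mul' _ _ (ENNReal.rpow_ne_top_of_nonneg (by linarith) hS')
          _ ≤ S' ^ p.toReal * I ^ p.toReal := by
              gcongr
              · exact le_max_left _ _
              · linarith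
              · calc ∫⁻ x, ‖F x‖ₑ ≤ I := le_max_right _ _
                  _ = I ^ (1 : ℝ) := by simp
                  _ ≤ _ := by gcongr; exact le_max_left _ _
          _ = (S' * I) ^ p.toReal := (ENNReal.mul_rpow_of_nonneg _ _ (by linarith)).symm
    _ = S' * I := by
        rw [← ENNReal.rpow_mul, mul_one_div_cancel (by positivity), ENNReal.rpow_one]

theorem norm_fourierInv_compSubConst (G : 𝓢(V, ℂ)) (y x : V) :
    ‖(𝓕⁻ (SchwartzMap.compSubConstCLM ℂ y G)) x‖ = ‖(𝓕⁻ G) x‖ := by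
  rw [SchwartzMap.fourierInv_coe, SchwartzMap.fourierInv_coe, Real.fourierInv_eq,
    Real.fourierInv_eq, ← integral_add_right_eq_self _ y]
  simp only [SchwartzMap.compSubConstCLM_apply, add_sub_cancel_right, inner_add_left,
    AddChar.map_add_eq_mul, mul_smul, Circle.smul_def]
  have : ∀ a : V, ((Real.fourierChar (inner ℝ a x) : ℂ) • (Real.fourierChar (inner ℝ y x) : ℂ) • G a)
    = (Real.fourierChar (inner ℝ y x) : ℂ) • ((Real.fourierChar (inner ℝ a x) : ℂ) • G a) :=
    fun a => smul_comm _ _ _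
  simp_rw [this]
  rw [integral_smul, norm_smul, Circle.norm_coe, one_mul]

variable (V) in
/-- The smooth bump function equal to `1` on `B(0, r)` and supported in `B(0, 2r)`. -/
def doublingBump (r : ℝ) (hr : 0 < r) : ContDiffBump (0 : V) := ⟨r, 2 * r, hr, by linarith⟩

theorem doublingBump_smul {r : ℝ} (hr : 0 < r) (s : V) :
    doublingBump V r hr (r • s) = doublingBump V 1 one_pos s := by
  simp [ContDiffBump.apply, doublingBump, hr.ne']

/-- The ratio of the two radii does not depend on `r`, so all these bumps are dilates of a single
one. -/
theorem doublingBump_normed_smul {r : ℝ} (hr : 0 < r) (s : V) :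
    (doublingBump V 1 one_pos).normed volume s =
      r ^ Module.finrank ℝ V * (doublingBump V r hr).normed volume (r • s) := by
  have hint : ∫ s, doublingBump V 1 one_pos s =
      (r ^ Module.finrank ℝ V)⁻¹ * ∫ s, doublingBump V r hr s := by
    have := Measure.integral_comp_smul (volume : Measure V) (fun s => doublingBump V r hr s) r
    simp_rw [doublingBump_smul] at this
    rw [this, abs_of_pos (by positivity), smul_eq_mul]
  rw [ContDiffBump.normed_def, ContDiffBump.normed_def, doublingBump_smul, hint]
  field_simp

variable (V) in
-- The form is tested on two functions whose Fourier transforms are the normalised bump at `y` and a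
-- wider bump equal to `1` on its support, so that it becomes an average of the symbol near `y`.
-- Moving `y` only modulates the test functions, which keeps their norms; hence `K` depends neither
-- on `y` nor on the exponents.
theorem exists_abs_integral_normed_le_of_hasRadialFormBound : ∃ K : ℝ, 0 ≤ K ∧
    ∀ (p q : ℝ≥0∞), 1 ≤ p → 1 ≤ q → p ≠ ⊤ → q ≠ ⊤ → ∀ (m : ℝ → ℝ) (A : ℝ), 0 ≤ A →
      HasRadialFormBound V m p q A → ∀ y : V,
        |∫ ξ : V, (doublingBump V 1 one_pos).normed volume (y - ξ) * m ‖ξ‖| ≤ K * A := by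
  set φ := doublingBump V 1 one_pos with hφ
  set ψ := doublingBump V 2 two_pos with hψdef
  have hH : HasCompactSupport (fun x => (φ.normed volume x : ℂ)) :=
    φ.hasCompactSupport_normed.comp_left (g := fun t : ℝ => (t : ℂ)) (by simp)
  have hψ : HasCompactSupport (fun x => (ψ x : ℂ)) :=
    ψ.hasCompactSupport.comp_left (g := fun t : ℝ => (t : ℂ)) (by simp)
  have hs1 : ContDiff ℝ ∞ (fun x => (φ.normed volume x : ℂ)) :=
    Complex.ofRealCLM.contDiff.comp φ.contDiff_normed
  have hs2 : ContDiff ℝ ∞ (fun x => (ψ x : ℂ)) := Complex.ofRealCLM.contDiff.comp ψ.contDiff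
  obtain ⟨G1, hG1⟩ : ∃ G : 𝓢(V, ℂ), ∀ x, G x = (φ.normed volume x : ℂ) :=
    ⟨hH.toSchwartzMap hs1, fun _ => rfl⟩
  obtain ⟨G2, hG2⟩ : ∃ G : 𝓢(V, ℂ), ∀ x, G x = (ψ x : ℂ) :=
    ⟨hψ.toSchwartzMap hs2, fun _ => rfl⟩
  obtain ⟨B1, hB1, h1⟩ := exists_eLpNorm_schwartz_le (𝓕⁻ G1)
  obtain ⟨B2, hB2, h2⟩ := exists_eLpNorm_schwartz_le (𝓕⁻ G2)
  refine ⟨B1 * B2, by positivity, fun p q hp hq hpt hqt m A hA h y => ?_⟩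
  have h3 := h (𝓕⁻ (SchwartzMap.compSubConstCLM ℂ y G1)) (𝓕⁻ (SchwartzMap.compSubConstCLM ℂ y G2))
  have hn : ∀ (G : 𝓢(V, ℂ)) (r : ℝ≥0∞),
      eLpNorm (𝓕⁻ (SchwartzMap.compSubConstCLM ℂ y G) : 𝓢(V, ℂ)) r (volume : Measure V) =
      eLpNorm (𝓕⁻ G : 𝓢(V, ℂ)) r (volume : Measure V) := fun G r =>
    eLpNorm_congr_norm_ae (Eventually.of_forall fun x => norm_fourierInv_compSubConst G y x)
  rw [hn, hn] at h3
  have h4 : radialForm m (𝓕⁻ (SchwartzMap.compSubConstCLM ℂ y G1) : 𝓢(V, ℂ))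
      (𝓕⁻ (SchwartzMap.compSubConstCLM ℂ y G2) : 𝓢(V, ℂ)) =
      ((∫ ξ : V, φ.normed volume (y - ξ) * m ‖ξ‖ : ℝ) : ℂ) := by
    unfold radialForm
    rw [← SchwartzMap.fourier_coe, ← SchwartzMap.fourier_coe,
      FourierTransform.fourier_fourierInv_eq, FourierTransform.fourier_fourierInv_eq,
      ← integral_complex_ofReal]
    congr 1
    ext ξ
    have e2 : φ.normed volume (y - ξ) ≠ 0 → ψ (ξ - y) = 1 := by
      intro hne
      refine ψ.one_of_mem_closedBall ?_
      have : y - ξ ∈ Function.support (φ.normed volume) := hne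
      rw [φ.support_normed_eq] at this
      rw [mem_closedBall_zero_iff, norm_sub_rev]
      have h5 := (mem_ball_zero_iff.1 this).le
      simpa [hφ, hψdef, doublingBump] using h5
    rw [SchwartzMap.compSubConstCLM_apply, SchwartzMap.compSubConstCLM_apply, hG1, hG2,
      ← neg_sub y ξ, φ.normed_neg, neg_sub]
    by_cases h0 : φ.normed volume (y - ξ) = 0
    · simp [h0]
    · rw [e2 h0]
      push_cast
      simp [mul_comm]
  rw [h4, Complex.norm_real, Real.norm_eq_abs] at h3
  refine h3.trans ?_
  calc A * (eLpNorm (𝓕⁻ G1 : 𝓢(V, ℂ)) p (volume : Measure V)).toReal *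
        (eLpNorm (𝓕⁻ G2 : 𝓢(V, ℂ)) q (volume : Measure V)).toReal ≤ A * B1 * B2 := by
        gcongr
        · exact h1 p hp hpt
        · exact h2 q hq hqt
    _ = B1 * B2 * A := by ring

/-- An average at scale `r` is an average at scale one of the dilated symbol, which satisfies the
same form bound. -/
theorem convolution_doublingBump_eq (m : ℝ → ℝ) {r : ℝ} (hr : 0 < r) (x : V) :
    ((doublingBump V r hr).normed volume ⋆[ContinuousLinearMap.lsmul ℝ ℝ, volume]
      fun ξ : V => m ‖ξ‖) x =
    ∫ ξ : V, (doublingBump V 1 one_pos).normed volume (r⁻¹ • x - ξ) * m (r * ‖ξ‖) := by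
  rw [← integral_sub_left_eq_self _ _ (r⁻¹ • x)]
  simp only [sub_sub_cancel]
  have h6 := Measure.integral_comp_smul (volume : Measure V)
    (fun t => (doublingBump V r hr).normed volume t * m ‖x - t‖) r
  rw [abs_of_pos (by positivity)] at h6
  have h7 : ∀ s : V, (doublingBump V 1 one_pos).normed volume s * m (r * ‖r⁻¹ • x - s‖) =
      r ^ Module.finrank ℝ V *
      ((doublingBump V r hr).normed volume (r • s) * m ‖x - r • s‖) := by
    intro s
    have : r * ‖r⁻¹ • x - s‖ = ‖x - r • s‖ := by
      rw [← abs_of_pos hr, ← Real.norm_eq_abs, ← norm_smul, Real.norm_eq_abs, abs_of_pos hr,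
        smul_sub, smul_inv_smul₀ hr.ne']
    rw [doublingBump_normed_smul hr, this, mul_assoc]
  simp_rw [h7]
  rw [integral_const_mul, h6, smul_eq_mul, mul_inv_cancel_left₀ (by positivity)]
  simp [convolution_def]

variable (V) in
-- Averages over shrinking balls are bounded by `K * A` at every scale, by dilation invariance, and
-- the Lebesgue differentiation theorem passes to the limit.
theorem exists_ae_abs_le_of_hasRadialFormBound : ∃ K : ℝ, 0 ≤ K ∧
    ∀ (p q : ℝ≥0∞), 1 ≤ p → 1 ≤ q → p ≠ ⊤ → q ≠ ⊤ → p.HolderConjugate q →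
    ∀ (m : ℝ → ℝ) (M A : ℝ), Measurable m → (∀ r, |m r| ≤ M) → 0 ≤ A →
      HasRadialFormBound V m p q A → ∀ᵐ ξ : V, |m ‖ξ‖| ≤ K * A := by
  obtain ⟨K, hK, key⟩ := exists_abs_integral_normed_le_of_hasRadialFormBound V
  refine ⟨K, hK, fun p q hp hq hpt hqt hpq m M A hm hM hA h => ?_⟩
  have hloc : LocallyIntegrable (fun ξ : V => m ‖ξ‖) volume := by
    have h8 : LocallyIntegrable (fun _ : V => M) volume := locallyIntegrable_const M
    refine h8.mono (hm.comp measurable_norm).aestronglyMeasurable ?_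
    exact Eventually.of_forall fun ξ => by
      rw [Real.norm_eq_abs, Real.norm_eq_abs]; exact (hM _).trans (le_abs_self _)
  have hpos : ∀ i : ℕ, 0 < 1 / ((i : ℝ) + 1) := fun i => by positivity
  have hu : Tendsto (fun i : ℕ => (doublingBump V _ (hpos i)).rOut) atTop (𝓝 0) := by
    simpa [doublingBump] using (tendsto_one_div_add_atTop_nhds_zero_nat (𝕜 := ℝ)).const_mul 2
  filter_upwards [ContDiffBump.ae_convolution_tendsto_right_of_locallyIntegrable (K := 2) hu
    (Eventually.of_forall fun i => le_rfl) hloc] with x hx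
  refine le_of_tendsto hx.abs (Eventually.of_forall fun i => ?_)
  rw [convolution_doublingBump_eq]
  exact key p q hp hq hpt hqt _ A hA (h.dilate hpt hqt hpq (hpos i)) _

/-- Polar coordinates: the indicator of the bad radii has integral zero against `r^(dim - 1) dr`, so
it vanishes almost everywhere on the half-line. -/
theorem ae_of_ae_norm [Nontrivial V] {P : ℝ → Prop} (h : ∀ᵐ ξ : V, P ‖ξ‖) : ∀ᵐ r : ℝ, 0 < r → P r := by
  set f : ℝ → ℝ := {r | ¬ P r}.indicator 1 with hf
  have h0 : (fun ξ : V => f ‖ξ‖) =ᵐ[volume] 0 := by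
    filter_upwards [h] with ξ hξ
    simp [hf, hξ]
  have hint : Integrable (fun ξ : V => f ‖ξ‖) := (integrable_zero _ _ _).congr h0.symm
  have h1 := (integrable_fun_norm_addHaar (volume : Measure V) (f := f)).1 hint
  have h2 := integral_fun_norm_addHaar (volume : Measure V) f
  rw [integral_congr_ae h0] at h2
  have h3 : ∫ y in Set.Ioi (0 : ℝ), y ^ (Module.finrank ℝ V - 1) • f y = 0 := by
    have hpos : 0 < Module.finrank ℝ V := Module.finrank_pos
    have hb : 0 < (volume : Measure V).real (Metric.ball 0 1) :=
      ENNReal.toReal_pos (Metric.measure_ball_pos _ _ one_pos).ne' measure_ball_lt_top.ne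
    simp only [Pi.zero_apply, integral_zero, nsmul_eq_mul, smul_eq_mul] at h2
    have := h2.symm
    simp only [mul_eq_zero, Nat.cast_eq_zero, hpos.ne', hb.ne', false_or] at this
    simpa using this
  have hnn : 0 ≤ᵐ[volume.restrict (Set.Ioi (0 : ℝ))]
      fun y => y ^ (Module.finrank ℝ V - 1) • f y := by
    refine (ae_restrict_iff' measurableSet_Ioi).2 (Eventually.of_forall fun y (hy : 0 < y) => ?_)
    have : 0 ≤ f y := Set.indicator_nonneg (fun _ _ => zero_le_one) y
    simp only [Pi.zero_apply, smul_eq_mul]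
    positivity
  have h4 := (integral_eq_zero_iff_of_nonneg_ae hnn h1).1 h3
  have h5 := (ae_restrict_iff' measurableSet_Ioi).1 h4
  filter_upwards [h5] with r hr hr0
  by_contra hn
  have h6 := hr hr0
  simp [hf, hn, hr0.ne'] at h6

end SupBound

/-! ### Orthogonality of random signs -/

section Signs

variable {ι : Type*} [Fintype ι] [DecidableEq ι]

theorem sum_sign_mul_sign (j k : ι) :
    ∑ σ : ι → ℤˣ, (((σ j : ℤ) : ℂ) * ((σ k : ℤ) : ℂ)) =
      if j = k then (Fintype.card (ι → ℤˣ) : ℂ) else 0 := by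
  split_ifs with h
  · subst h
    have : ∀ σ : ι → ℤˣ, (((σ j : ℤ) : ℂ) * ((σ j : ℤ) : ℂ)) = 1 := by
      intro σ
      rcases Int.units_eq_one_or (σ j) with h | h <;> simp [h]
    simp [this]
  -- Flipping the sign at `j` permutes the choices of signs and negates each term, so the sum is its
  -- own opposite.
  · let e : (ι → ℤˣ) ≃ (ι → ℤˣ) := Equiv.mulRight (Pi.mulSingle j (-1))
    have h1 := Equiv.sum_comp e (fun σ : ι → ℤˣ => (((σ j : ℤ) : ℂ) * ((σ k : ℤ) : ℂ)))
    have h2 : ∀ σ : ι → ℤˣ, (((e σ j : ℤ) : ℂ) * ((e σ k : ℤ) : ℂ)) =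
        -(((σ j : ℤ) : ℂ) * ((σ k : ℤ) : ℂ)) := by
      intro σ
      have hk : k ≠ j := fun hh => h hh.symm
      simp [e, hk]
    simp_rw [h2] at h1
    rw [Finset.sum_neg_distrib] at h1
    exact self_eq_neg.1 h1.symm

theorem sum_sign_double_sum (c : ι → ι → ℂ) :
    ∑ σ : ι → ℤˣ, ∑ j, ∑ k, (((σ j : ℤ) : ℂ) * ((σ k : ℤ) : ℂ)) * c j k =
      (Fintype.card (ι → ℤˣ) : ℂ) * ∑ j, c j j := by
  rw [Finset.sum_comm, Finset.mul_sum]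
  refine Finset.sum_congr rfl fun j _ => ?_
  rw [Finset.sum_comm]
  simp_rw [← Finset.sum_mul, sum_sign_mul_sign]
  simp

theorem sum_sign_norm_sq (a : ι → ℂ) :
    ∑ σ : ι → ℤˣ, ‖∑ j, ((σ j : ℤ) : ℂ) * a j‖ ^ 2 =
      (Fintype.card (ι → ℤˣ) : ℝ) * ∑ j, ‖a j‖ ^ 2 := by
  have h := sum_sign_double_sum (fun j k : ι => a j * conj (a k))
  have h1 : ∀ σ : ι → ℤˣ, ∑ j, ∑ k, (((σ j : ℤ) : ℂ) * ((σ k : ℤ) : ℂ)) * (a j * conj (a k)) =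
      ((‖∑ j, ((σ j : ℤ) : ℂ) * a j‖ ^ 2 : ℝ) : ℂ) := by
    intro σ
    rw [Complex.ofReal_pow, ← Complex.mul_conj', map_sum, Finset.sum_mul_sum]
    refine Finset.sum_congr rfl fun j _ => Finset.sum_congr rfl fun k _ => ?_
    simp
    ring
  simp_rw [h1, Complex.mul_conj'] at h
  exact_mod_cast h

end Signs

/-! ### Averaging the form over signs -/

section Averaging

variable {W : Type*} [NormedAddCommGroup W] [InnerProductSpace ℝ W]
  [FiniteDimensional ℝ W] [MeasurableSpace W] [BorelSpace W]
  {ι : Type*} [Fintype ι]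

/-- The combination of Schwartz functions with given signs. -/
def signedSum (σ : ι → ℤˣ) (f : ι → 𝓢(W, ℂ)) : 𝓢(W, ℂ) := ∑ j, ((σ j : ℤ) : ℂ) • f j

theorem fourier_signedSum (σ : ι → ℤˣ) (f : ι → 𝓢(W, ℂ)) (ξ : W) :
    𝓕 (signedSum σ f : W → ℂ) ξ = ∑ j, ((σ j : ℤ) : ℂ) * 𝓕 (f j : W → ℂ) ξ := by
  rw [← SchwartzMap.fourier_coe]
  have h : 𝓕 (signedSum σ f) = ∑ j, ((σ j : ℤ) : ℂ) • 𝓕 (f j) := by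
    simp_rw [← FourierTransform.fourierCLM_apply (R := ℂ), signedSum, map_sum, map_smul]
  rw [h]
  simp [SchwartzMap.fourier_coe]

theorem signedSum_apply (σ : ι → ℤˣ) (f : ι → 𝓢(W, ℂ)) (x : W) :
    signedSum σ f x = ∑ j, ((σ j : ℤ) : ℂ) * f j x := by
  simp [signedSum]

theorem radialForm_signedSum {m : ℝ → ℝ} (hm : Measurable m) {M : ℝ} (hM : ∀ r, |m r| ≤ M)
    (σ : ι → ℤˣ) (f g : ι → 𝓢(W, ℂ)) :
    radialForm m (signedSum σ f : W → ℂ) (signedSum σ g) =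
      ∑ j, ∑ k, (((σ j : ℤ) : ℂ) * ((σ k : ℤ) : ℂ)) * radialForm m (f j : W → ℂ) (g k) := by
  have hint : ∀ j k, Integrable
      (fun ξ : W => (m ‖ξ‖ : ℂ) * 𝓕 (f j : W → ℂ) ξ * conj (𝓕 (g k : W → ℂ) ξ)) := by
    intro j k
    simp_rw [mul_assoc]
    apply integrable_radial_mul hm hM
    have h1 : MemLp (𝓕 (f j : W → ℂ)) 2 := by
      rw [← SchwartzMap.fourier_coe]; exact (𝓕 (f j)).memLp 2 volume
    have h2 : MemLp (fun ξ => conj (𝓕 (g k : W → ℂ) ξ)) 2 := by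
      rw [← SchwartzMap.fourier_coe]
      exact ((𝓕 (g k)).memLp 2 volume).star
    exact h1.integrable_mul h2
  unfold radialForm
  simp_rw [fourier_signedSum]
  calc _ = ∫ ξ : W, ∑ j, ∑ k, (((σ j : ℤ) : ℂ) * ((σ k : ℤ) : ℂ)) *
        ((m ‖ξ‖ : ℂ) * 𝓕 (f j : W → ℂ) ξ * conj (𝓕 (g k : W → ℂ) ξ)) := by
        congr 1
        ext ξ
        rw [map_sum, mul_assoc, Finset.sum_mul_sum, Finset.mul_sum]
        refine Finset.sum_congr rfl fun j _ => ?_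
        rw [Finset.mul_sum]
        refine Finset.sum_congr rfl fun k _ => ?_
        simp
        ring
    _ = _ := by
        rw [integral_finsetSum _ fun j _ => integrable_finsetSum _ fun k _ =>
          (hint j k).const_mul _]
        refine Finset.sum_congr rfl fun j _ => ?_
        rw [integral_finsetSum _ fun k _ => (hint j k).const_mul _]
        refine Finset.sum_congr rfl fun k _ => ?_
        rw [integral_const_mul]

theorem toReal_eLpNorm_two_sq (F : 𝓢(W, ℂ)) :
    (eLpNorm F 2 (volume : Measure W)).toReal ^ 2 = ∫ x, ‖F x‖ ^ 2 := by
  rw [(F.memLp 2 volume).eLpNorm_eq_integral_rpow_norm two_ne_zero ENNReal.ofNat_ne_top,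
    ENNReal.toReal_ofReal (by positivity)]
  have h0 : 0 ≤ ∫ x, ‖F x‖ ^ 2 := by positivity
  simp only [ENNReal.toReal_ofNat, Real.rpow_ofNat]
  rw [← Real.rpow_natCast, ← Real.rpow_mul h0]
  norm_num

theorem integrable_norm_sq (F : 𝓢(W, ℂ)) : Integrable (fun x => ‖F x‖ ^ 2) := by
  have := (F.memLp 2 volume).integrable_norm_pow (by norm_num)
  simpa using this

/-- Orthogonality of the signs is applied at each point `x`, so the sets `E j` may overlap
arbitrarily; this is what allows compressed tubes. -/
theorem sum_eLpNorm_two_signedSum_sq_le [DecidableEq ι] (f : ι → 𝓢(W, ℂ)) (E : ι → Set W)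
    (hE : ∀ j, MeasurableSet (E j)) {v : ℝ} (hv : ∀ j, volume (E j) = ENNReal.ofReal v)
    (hv0 : 0 ≤ v) (hf : ∀ j x, ‖f j x‖ ≤ 1) (hfE : ∀ j, ∀ x ∉ E j, f j x = 0) :
    ∑ σ : ι → ℤˣ, (eLpNorm (signedSum σ f) 2 (volume : Measure W)).toReal ^ 2 ≤
      (Fintype.card (ι → ℤˣ) : ℝ) * (Fintype.card ι * v) := by
  simp_rw [toReal_eLpNorm_two_sq]
  rw [← integral_finsetSum _ fun σ _ => integrable_norm_sq _]
  simp_rw [signedSum_apply, sum_sign_norm_sq]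
  rw [integral_const_mul, integral_finsetSum _ fun j _ => integrable_norm_sq _]
  gcongr
  calc ∑ j, ∫ x, ‖f j x‖ ^ 2 ≤ ∑ _j : ι, v := by
        refine Finset.sum_le_sum fun j _ => ?_
        have h1 : ∫ x, (E j).indicator (fun _ => (1 : ℝ)) x = v := by
          rw [integral_indicator_const _ (hE j), Measure.real, hv, ENNReal.toReal_ofReal hv0]
          simp
        rw [← h1]
        refine integral_mono (integrable_norm_sq _) ?_ fun x => ?_
        · refine (integrable_indicator_iff (hE j)).2 (integrableOn_const ?_)
          rw [hv]; exact ENNReal.ofReal_ne_top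
        · by_cases hx : x ∈ E j
          · simp only [hx, Set.indicator_of_mem]
            exact pow_le_one₀ (norm_nonneg _) (hf j x)
          · simp [hx, hfE j x hx]
    _ = _ := by simp

/-- At each point at most one summand is nonzero, so every signed sum is dominated by the indicator
of the union. -/
theorem eLpNorm_signedSum_le_of_disjoint (g : ι → 𝓢(W, ℂ)) (E : ι → Set W)
    (hE : ∀ j, MeasurableSet (E j)) {v : ℝ} (hv : ∀ j, volume (E j) = ENNReal.ofReal v)
    (hv0 : 0 ≤ v) (hg : ∀ j x, ‖g j x‖ ≤ 1) (hgE : ∀ j, ∀ x ∉ E j, g j x = 0)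
    (hdisj : ∀ i j, i ≠ j → Disjoint (E i) (E j)) (σ : ι → ℤˣ) {q : ℝ≥0∞} (hq0 : q ≠ 0)
    (hq : q ≠ ⊤) :
    (eLpNorm (signedSum σ g) q (volume : Measure W)).toReal ≤
      (Fintype.card ι * v) ^ (1 / q.toReal) := by
  set S : Set W := ⋃ j, E j
  have hS : MeasurableSet S := MeasurableSet.iUnion hE
  have hpt : ∀ x, ‖signedSum σ g x‖ ≤ S.indicator (fun _ => (1 : ℝ)) x := by
    intro x
    rw [signedSum_apply]
    by_cases hx : x ∈ S
    · obtain ⟨j, hj⟩ := Set.mem_iUnion.1 hx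
      rw [Finset.sum_eq_single j]
      · rcases Int.units_eq_one_or (σ j) with h | h <;> simpa [h, hx] using hg j x
      · intro i _ hij
        rw [hgE i x (fun hi => Set.disjoint_left.1 (hdisj i j hij) hi hj), mul_zero]
      · simp
    · have : ∀ j, g j x = 0 := fun j => hgE j x fun hj => hx (Set.mem_iUnion.2 ⟨j, hj⟩)
      simp [this, hx]
  have hmS : volume S ≤ ENNReal.ofReal (Fintype.card ι * v) := by
    refine (measure_iUnion_fintype_le _ _).trans (le_of_eq ?_)
    simp [hv, ENNReal.ofReal_mul]
  calc (eLpNorm (signedSum σ g) q (volume : Measure W)).toReal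
      ≤ (eLpNorm (S.indicator fun _ => (1 : ℝ)) q (volume : Measure W)).toReal := by
        refine ENNReal.toReal_mono ?_ (eLpNorm_mono_real hpt)
        rw [eLpNorm_indicator_const hS hq0 hq]
        refine ENNReal.mul_ne_top (by simp) (ENNReal.rpow_ne_top_of_nonneg (by positivity) ?_)
        exact (hmS.trans_lt ENNReal.ofReal_lt_top).ne
    _ ≤ _ := by
        rw [eLpNorm_indicator_const hS hq0 hq]
        simp only [enorm_one, one_mul]
        rw [← ENNReal.toReal_rpow]
        refine Real.rpow_le_rpow ENNReal.toReal_nonneg ?_ (by positivity)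
        exact ENNReal.toReal_le_of_le_ofReal (by positivity) hmS

/-- Hölder on the support. The small measure of a union of compressed tubes is gained here, and `p ≤
2` makes the exponent nonnegative. -/
theorem eLpNorm_le_measure_rpow_mul_eLpNorm_two (F : 𝓢(W, ℂ)) {S : Set W} {u : ℝ}
    (hu : volume S ≤ ENNReal.ofReal u) (hu0 : 0 ≤ u) (hF : ∀ x ∉ S, F x = 0) {p : ℝ≥0∞}
    (hp1 : 1 ≤ p) (hp : p ≤ 2) :
    (eLpNorm F p (volume : Measure W)).toReal ≤
      u ^ (1 / p.toReal - 1 / 2) * (eLpNorm F 2 (volume : Measure W)).toReal := by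
  have hsupp : Function.support (F : W → ℂ) ⊆ S := fun x hx => by
    by_contra h
    exact hx (hF x h)
  have hpt : p ≠ ⊤ := (hp.trans_lt (by simp)).ne
  have hexp : 0 ≤ 1 / p.toReal - 1 / 2 := by
    have h1 : p.toReal ≤ 2 := by simpa using ENNReal.toReal_mono (by simp) hp
    have h2 : 1 ≤ p.toReal := by simpa using ENNReal.toReal_mono hpt hp1
    rw [sub_nonneg]
    exact one_div_le_one_div_of_le (by linarith) h1
  have h := eLpNorm_le_eLpNorm_mul_rpow_measure_univ (μ := (volume : Measure W).restrict S) hp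
    F.continuous.aestronglyMeasurable
  rw [eLpNorm_restrict_eq_of_support_subset hsupp, eLpNorm_restrict_eq_of_support_subset hsupp,
    Measure.restrict_apply_univ] at h
  have hb : eLpNorm F 2 (volume : Measure W) * volume S ^ (1 / p.toReal - 1 / (2 : ℝ≥0∞).toReal)
      ≤ eLpNorm F 2 (volume : Measure W) * ENNReal.ofReal u ^ (1 / p.toReal - 1 / 2) := by
    simp only [ENNReal.toReal_ofNat]
    gcongr
  have h3 := ENNReal.toReal_mono (ENNReal.mul_ne_top (F.memLp 2 volume).2.ne
    (ENNReal.rpow_ne_top_of_nonneg hexp ENNReal.ofReal_ne_top)) (h.trans hb)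
  rw [ENNReal.toReal_mul, ← ENNReal.toReal_rpow, ENNReal.toReal_ofReal hu0, mul_comm] at h3
  exact h3

/-- Random signs: a bounded form is small on average along a family `f j` of functions with
compressed supports and a family `g j` of functions with disjoint supports. -/
theorem norm_sum_radialForm_le [DecidableEq ι] [Nonempty ι] {m : ℝ → ℝ} (hm : Measurable m)
    {M : ℝ} (hM : ∀ r, |m r| ≤ M) {p q : ℝ≥0∞} (hp1 : 1 ≤ p) (hp : p ≤ 2) (hq : q ≠ ⊤)
    (hpq : p.HolderConjugate q) {A : ℝ} (hA : 0 ≤ A) (h : HasRadialFormBound W m p q A)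
    (f g : ι → 𝓢(W, ℂ)) (E E' : ι → Set W)
    (hE : ∀ j, MeasurableSet (E j)) (hE' : ∀ j, MeasurableSet (E' j)) {v : ℝ} (hv0 : 0 < v)
    (hv : ∀ j, volume (E j) = ENNReal.ofReal v) (hv' : ∀ j, volume (E' j) = ENNReal.ofReal v)
    (hf : ∀ j x, ‖f j x‖ ≤ 1) (hfE : ∀ j, ∀ x ∉ E j, f j x = 0)
    (hg : ∀ j x, ‖g j x‖ ≤ 1) (hgE : ∀ j, ∀ x ∉ E' j, g j x = 0)
    (hdisj : ∀ i j, i ≠ j → Disjoint (E' i) (E' j)) {ε : ℝ} (hε : 0 ≤ ε)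
    (hcompr : volume (⋃ j, E j) ≤ ENNReal.ofReal (ε * (Fintype.card ι * v))) :
    ‖∑ j, radialForm m (f j : W → ℂ) (g j)‖ ≤
      A * ε ^ (1 / p.toReal - 1 / 2) * (Fintype.card ι * v) := by
  set X : ℝ := Fintype.card ι * v with hX
  have hX0 : 0 < X := by positivity
  set D : ℝ := (Fintype.card (ι → ℤˣ) : ℝ) with hD
  have hD0 : 0 < D := by rw [hD]; positivity
  set a : ℝ := 1 / p.toReal - 1 / 2
  have hsum : D * ‖∑ j, radialForm m (f j : W → ℂ) (g j)‖ ≤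
      ∑ σ : ι → ℤˣ, ‖radialForm m (signedSum σ f : W → ℂ) (signedSum σ g)‖ := by
    refine le_trans (le_of_eq ?_) (norm_sum_le _ _)
    simp_rw [radialForm_signedSum hm hM, sum_sign_double_sum]
    rw [norm_mul]
    simp [hD]
  have hterm : ∀ σ : ι → ℤˣ, ‖radialForm m (signedSum σ f : W → ℂ) (signedSum σ g)‖ ≤
      A * (ε * X) ^ a * X ^ (1 / q.toReal) *
        (eLpNorm (signedSum σ f) 2 (volume : Measure W)).toReal := by
    intro σ
    refine (h _ _).trans ?_
    have h1 := eLpNorm_le_measure_rpow_mul_eLpNorm_two (signedSum σ f) hcompr (by positivity)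
      (fun x hx => by
        have : ∀ j, f j x = 0 := fun j => hfE j x fun hj => hx (Set.mem_iUnion.2 ⟨j, hj⟩)
        simp [signedSum_apply, this]) hp1 hp
    have h2 := eLpNorm_signedSum_le_of_disjoint g E' hE' hv' hv0.le hg hgE hdisj σ
      hpq.symm.ne_zero hq
    calc A * (eLpNorm (signedSum σ f) p (volume : Measure W)).toReal *
          (eLpNorm (signedSum σ g) q (volume : Measure W)).toReal
        ≤ A * ((ε * X) ^ a * (eLpNorm (signedSum σ f) 2 (volume : Measure W)).toReal) *
          X ^ (1 / q.toReal) := by gcongr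
      _ = _ := by ring
  -- Cauchy-Schwarz over the choices of signs, followed by the mean square bound.
  have hcs : ∑ σ : ι → ℤˣ, (eLpNorm (signedSum σ f) 2 (volume : Measure W)).toReal ≤
      D * X ^ (1 / 2 : ℝ) := by
    have h1 := sq_sum_le_card_mul_sum_sq (s := Finset.univ)
      (f := fun σ : ι → ℤˣ => (eLpNorm (signedSum σ f) 2 (volume : Measure W)).toReal)
    have h2 := sum_eLpNorm_two_signedSum_sq_le f E hE hv hv0.le hf hfE
    rw [Finset.card_univ, ← hD] at h1
    rw [← hD, ← hX] at h2
    refine (sq_le_sq₀ (Finset.sum_nonneg fun σ _ => ENNReal.toReal_nonneg) (by positivity)).1 ?_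
    calc _ ≤ D * (D * X) := h1.trans (by gcongr)
      _ = (D * X ^ (1 / 2 : ℝ)) ^ 2 := by
        rw [mul_pow, ← Real.rpow_natCast (X ^ (1 / 2 : ℝ)), ← Real.rpow_mul hX0.le]
        norm_num
        ring
  have hfin : D * ‖∑ j, radialForm m (f j : W → ℂ) (g j)‖ ≤
      D * (A * (ε * X) ^ a * X ^ (1 / q.toReal) * X ^ (1 / 2 : ℝ)) := by
    calc _ ≤ _ := hsum
      _ ≤ ∑ σ : ι → ℤˣ, A * (ε * X) ^ a * X ^ (1 / q.toReal) *
        (eLpNorm (signedSum σ f) 2 (volume : Measure W)).toReal :=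
          Finset.sum_le_sum fun σ _ => hterm σ
      _ = A * (ε * X) ^ a * X ^ (1 / q.toReal) *
        ∑ σ : ι → ℤˣ, (eLpNorm (signedSum σ f) 2 (volume : Measure W)).toReal := by
          rw [Finset.mul_sum]
      _ ≤ A * (ε * X) ^ a * X ^ (1 / q.toReal) * (D * X ^ (1 / 2 : ℝ)) := by gcongr
      _ = _ := by ring
  refine (le_of_mul_le_mul_left hfin hD0).trans (le_of_eq ?_)
  -- The three powers of `X` come from Hölder, from the disjoint family and from the mean square;
  -- conjugacy makes them add up to the first power of the total volume.
  have hsumexp : a + 1 / q.toReal + 1 / 2 = 1 := by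
    have h2 : (p⁻¹ + q⁻¹).toReal = 1 := by rw [hpq.inv_add_inv_eq_one]; simp
    rw [ENNReal.toReal_add (by simpa using hpq.ne_zero) (by simpa using hpq.symm.ne_zero),
      ENNReal.toReal_inv, ENNReal.toReal_inv] at h2
    simp only [a, one_div]
    linarith
  rw [Real.mul_rpow hε hX0.le]
  calc A * (ε ^ a * X ^ a) * X ^ (1 / q.toReal) * X ^ (1 / 2 : ℝ)
      = A * ε ^ a * (X ^ a * X ^ (1 / q.toReal) * X ^ (1 / 2 : ℝ)) := by ring
    _ = A * ε ^ a * X := by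
      rw [← Real.rpow_add hX0, ← Real.rpow_add hX0, hsumexp, Real.rpow_one]

end Averaging

/-! ### Tubes as isometric copies of a model -/

section TubeModel

/-- The Euclidean space `ℝ × ℝ^k` in which the tubes of `ℝ^{k+1}` are modelled. -/
abbrev TubeModel (k : ℕ) : Type := WithLp 2 (ℝ × Euc k)

/-- The model `[a, b] × B(0, δ)` of a tube. -/
def modelSlab (k : ℕ) (δ a b : ℝ) : Set (TubeModel k) :=
  {v | v.fst ∈ Set.Icc a b ∧ ‖v.snd‖ < δ}

/-- The volume of a `δ`-tube in `ℝ^{k+1}`. -/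
def tubeVolume (k : ℕ) (δ : ℝ) : ℝ := δ ^ k * (volume : Measure (Euc k)).real (Metric.ball 0 1)

theorem tubeVolume_pos (k : ℕ) {δ : ℝ} (hδ : 0 < δ) : 0 < tubeVolume k δ := by
  have : 0 < (volume : Measure (Euc k)).real (Metric.ball 0 1) :=
    ENNReal.toReal_pos (Metric.measure_ball_pos _ _ one_pos).ne' measure_ball_lt_top.ne
  unfold tubeVolume
  positivity

theorem modelSlab_eq_preimage (k : ℕ) (δ a b : ℝ) :
    modelSlab k δ a b = WithLp.ofLp ⁻¹' (Set.Icc a b ×ˢ Metric.ball (0 : Euc k) δ) := by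
  ext v
  simp [modelSlab]

theorem measurableSet_modelSlab (k : ℕ) (δ a b : ℝ) : MeasurableSet (modelSlab k δ a b) := by
  rw [modelSlab_eq_preimage]
  exact (WithLp.volume_preserving_ofLp ℝ (Euc k)).measurable
    (measurableSet_Icc.prod measurableSet_ball)

theorem volume_modelSlab (k : ℕ) {δ : ℝ} (hδ : 0 < δ) (a : ℝ) :
    volume (modelSlab k δ a (a + 1)) = ENNReal.ofReal (tubeVolume k δ) := by
  rw [modelSlab_eq_preimage, (WithLp.volume_preserving_ofLp ℝ (Euc k)).measure_preimage
    (measurableSet_Icc.prod measurableSet_ball).nullMeasurableSet, Measure.volume_eq_prod,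
    Measure.prod_prod, Real.volume_Icc, Measure.addHaar_ball_of_pos _ _ hδ, tubeVolume,
    ENNReal.ofReal_mul (by positivity), Measure.real,
    ENNReal.ofReal_toReal measure_ball_lt_top.ne]
  simp

/-- An arbitrary isometry is corrected by the reflection that exchanges the image of `e` with `u`,
two vectors of equal norm. -/
theorem exists_linearIsometryEquiv_of_norm_eq_one {V W : Type*} [NormedAddCommGroup V]
    [InnerProductSpace ℝ V] [NormedAddCommGroup W] [InnerProductSpace ℝ W]
    [FiniteDimensional ℝ V] [FiniteDimensional ℝ W]
    (h : Module.finrank ℝ V = Module.finrank ℝ W) {e : V} {u : W} (he : ‖e‖ = 1) (hu : ‖u‖ = 1) :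
    ∃ U : V ≃ₗᵢ[ℝ] W, U e = u := by
  let U₀ : V ≃ₗᵢ[ℝ] W := 
    (stdOrthonormalBasis ℝ V).equiv (stdOrthonormalBasis ℝ W) (finCongr h)
  refine ⟨U₀.trans (Submodule.reflection (Submodule.span ℝ {U₀ e - u})ᗮ), ?_⟩
  rw [LinearIsometryEquiv.trans_apply]
  exact Submodule.reflection_sub (by rw [U₀.norm_map, he, hu])

/-- One isometry serves all `δ`, `a`, `b`: the body and the reach of a tube, and hence the pair of
functions living on them, are moved together. -/
theorem Tube.exists_isometry {k : ℕ} (R : Tube (k + 1)) :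
    ∃ U : TubeModel k ≃ₗᵢ[ℝ] Euc (k + 1), ∀ δ a b : ℝ,
      R.slab δ a b = (fun x => U.symm (x - R.base)) ⁻¹' modelSlab k δ a b := by
  have hfr : Module.finrank ℝ (TubeModel k) = Module.finrank ℝ (Euc (k + 1)) := by
    rw [(WithLp.linearEquiv 2 ℝ (ℝ × Euc k)).finrank_eq]
    simp [add_comm]
  set e : TubeModel k := WithLp.toLp 2 ((1 : ℝ), (0 : Euc k)) with he
  have hen : ‖e‖ = 1 := by
    rw [WithLp.prod_norm_eq_of_L2]
    simp [he]
  obtain ⟨U, hU⟩ := exists_linearIsometryEquiv_of_norm_eq_one hfr hen R.norm_dir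
  refine ⟨U, fun δ a b => ?_⟩
  ext x
  set v := U.symm (x - R.base) with hv
  have hx : x - R.base = U v := by simp [hv]
  have h1 : inner ℝ (x - R.base) R.dir = v.fst := by
    rw [hx, ← hU, U.inner_map_map, WithLp.prod_inner_apply]
    simp [he]
  have h2 : ‖(x - R.base) - (inner ℝ (x - R.base) R.dir : ℝ) • R.dir‖ = ‖v.snd‖ := by
    rw [h1, hx, ← hU, ← U.map_smul, ← U.map_sub, U.norm_map, WithLp.prod_norm_eq_of_L2]
    simp [he]
  rw [h1] at h2
  simp only [Tube.slab, Set.mem_ofPred_eq, h1, h2, Set.mem_preimage, ← hv, modelSlab]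

theorem Tube.measurableSet_slab {k : ℕ} (R : Tube (k + 1)) (δ a b : ℝ) :
    MeasurableSet (R.slab δ a b) := by
  obtain ⟨U, hU⟩ := R.exists_isometry
  rw [hU]
  exact (U.symm.continuous.comp (continuous_sub_right R.base)).measurable
    (measurableSet_modelSlab k δ a b)

theorem Tube.volume_slab {k : ℕ} (R : Tube (k + 1)) {δ : ℝ} (hδ : 0 < δ) (a : ℝ) :
    volume (R.slab δ a (a + 1)) = ENNReal.ofReal (tubeVolume k δ) := by
  obtain ⟨U, hU⟩ := R.exists_isometry
  rw [hU, ← volume_modelSlab k hδ a]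
  exact (U.symm.measurePreserving.comp (measurePreserving_sub_right volume R.base)).measure_preimage
    (measurableSet_modelSlab k δ a (a + 1)).nullMeasurableSet

theorem Tube.volume_body {k : ℕ} (R : Tube (k + 1)) {δ : ℝ} (hδ : 0 < δ) :
    volume (R.body δ) = ENNReal.ofReal (tubeVolume k δ) := by
  have := R.volume_slab hδ 0
  rw [zero_add] at this
  exact this

theorem Tube.volume_reach {k : ℕ} (R : Tube (k + 1)) {δ : ℝ} (hδ : 0 < δ) :
    volume (R.reach δ) = ENNReal.ofReal (tubeVolume k δ) := by
  have := R.volume_slab hδ 2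
  norm_num at this
  exact this

/-- The compression ratio `ε` is attained by a nonempty finite family of `δ`-tubes in `ℝ^d` with
pairwise disjoint reaches. -/
def IsTubeCompression (d : ℕ) (δ ε : ℝ) : Prop :=
  0 < ε ∧ ∃ N : ℕ, 0 < N ∧ ∃ R : Fin N → Tube d,
    (∀ i j, i ≠ j → Disjoint ((R i).reach δ) ((R j).reach δ)) ∧
    volume.real (⋃ j, (R j).body δ) / ∑ j, volume.real ((R j).body δ) ≤ ε

theorem tubeCompression_eq (d : ℕ) (δ : ℝ) :
    tubeCompression d δ = sInf {ε | IsTubeCompression d δ ε} := rfl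

/-- By isometry invariance all copies of the pair have the same form, so the sum over the tubes is
`N` times the form of the model pair, and `N` cancels. -/
theorem norm_radialForm_le_of_isTubeCompression {k : ℕ} {δ ε : ℝ} (hδ : 0 < δ)
    (hε : IsTubeCompression (k + 1) δ ε) {m : ℝ → ℝ} (hm : Measurable m)
    {M : ℝ} (hM : ∀ r, |m r| ≤ M) {p q : ℝ≥0∞} (hp1 : 1 ≤ p) (hp : p ≤ 2) (hq : q ≠ ⊤)
    (hpq : p.HolderConjugate q) {A : ℝ} (hA : 0 ≤ A)
    (h : HasRadialFormBound (Euc (k + 1)) m p q A) (f g : 𝓢(TubeModel k, ℂ))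
    (hf : ∀ x, ‖f x‖ ≤ 1) (hg : ∀ x, ‖g x‖ ≤ 1) (hfE : ∀ x ∉ modelSlab k δ 0 1, f x = 0)
    (hgE : ∀ x ∉ modelSlab k δ 2 3, g x = 0) :
    ‖radialForm m (f : TubeModel k → ℂ) g‖ ≤
      A * ε ^ (1 / p.toReal - 1 / 2) * tubeVolume k δ := by
  obtain ⟨hε0, N, hN, R, hdisj, hR⟩ := hε
  have : Nonempty (Fin N) := ⟨⟨0, hN⟩⟩
  have hv := tubeVolume_pos k hδ
  choose U hU using fun j => (R j).exists_isometry
  have hcompr : volume (⋃ j, (R j).body δ) ≤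
      ENNReal.ofReal (ε * (Fintype.card (Fin N) * tubeVolume k δ)) := by
    have hsum : ∑ j, volume.real ((R j).body δ) = Fintype.card (Fin N) * tubeVolume k δ := by
      simp [Measure.real, Tube.volume_body _ hδ, ENNReal.toReal_ofReal hv.le]
    rw [hsum, div_le_iff₀ (by positivity), Measure.real] at hR
    rw [← ENNReal.ofReal_toReal (a := volume (⋃ j, (R j).body δ))]
    · exact ENNReal.ofReal_le_ofReal hR
    · refine ((measure_iUnion_fintype_le _ _).trans_lt ?_).ne
      simp only [Tube.volume_body _ hδ]
      exact ENNReal.sum_lt_top.2 fun _ _ => ENNReal.ofReal_lt_top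
  have key := norm_sum_radialForm_le hm hM hp1 hp hq hpq hA h
    (fun j => transport (U j) (R j).base f) (fun j => transport (U j) (R j).base g)
    (fun j => (R j).body δ) (fun j => (R j).reach δ)
    (fun j => (R j).measurableSet_slab _ _ _) (fun j => (R j).measurableSet_slab _ _ _) hv
    (fun j => (R j).volume_body hδ) (fun j => (R j).volume_reach hδ)
    (fun j x => hf _) (fun j x hx => hfE _ fun hx' => hx ?_)
    (fun j x => hg _) (fun j x hx => hgE _ fun hx' => hx ?_) hdisj hε0.le hcompr
  · simp_rw [radialForm_transport] at key
    rw [Finset.sum_const, nsmul_eq_mul, norm_mul, Finset.card_univ, Complex.norm_natCast] at key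
    have hc : (0 : ℝ) < Fintype.card (Fin N) := by positivity
    refine le_of_mul_le_mul_left (key.trans (le_of_eq ?_)) hc
    ring
  · change x ∈ (R j).slab δ 0 1
    rw [hU]; exact hx'
  · change x ∈ (R j).slab δ 2 3
    rw [hU]; exact hx'

end TubeModel

/-! ### The substitution relating √(x² + s²) to an exponential -/

section PhaseComparison

open Set

/-- Of the two factors `(1 + y²)⁻¹`, one will pay for quadratic losses and the other will be
integrated. -/
theorem exists_norm_schwartz_le (Q : 𝓢(ℝ, ℂ)) :
    ∃ B : ℝ, 0 ≤ B ∧ ∀ y, ‖Q y‖ ≤ B / (1 + y ^ 2) ^ 2 := by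
  obtain ⟨C0, h0⟩ := Q.decay 0 0
  obtain ⟨C4, h4⟩ := Q.decay 4 0
  simp only [norm_iteratedFDeriv_zero, pow_zero, one_mul] at h0 h4
  refine ⟨2 * (C0 + C4), by nlinarith [h0.1, h4.1], fun y => ?_⟩
  rw [le_div_iff₀ (by positivity)]
  have h1 := h0.2 y
  have h2 := h4.2 y
  have h3 : ‖y‖ ^ 4 = y ^ 4 := by rw [Real.norm_eq_abs, pow_abs, abs_of_nonneg (by positivity)]
  rw [h3] at h2
  have h5 : (1 + y ^ 2) ^ 2 ≤ 2 * (1 + y ^ 4) := by nlinarith [sq_nonneg (y ^ 2 - 1)]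
  calc ‖Q y‖ * (1 + y ^ 2) ^ 2 ≤ ‖Q y‖ * (2 * (1 + y ^ 4)) := by gcongr
    _ ≤ 2 * (C0 + C4) := by nlinarith

/-- If `|y - z| ≥ 1` the decay of `Q` suffices. Otherwise the mean value inequality applies, the
weights at `y` and at intermediate points being comparable. -/
theorem exists_norm_schwartz_sub_le (Q : 𝓢(ℝ, ℂ)) :
    ∃ B : ℝ, 0 ≤ B ∧ ∀ y z, ‖Q y - Q z‖ ≤
      B * |y - z| * (1 / (1 + y ^ 2) ^ 2 + 1 / (1 + z ^ 2) ^ 2) := by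
  obtain ⟨B0, hB0, h0⟩ := exists_norm_schwartz_le Q
  obtain ⟨B1, hB1, h1⟩ := exists_norm_schwartz_le (SchwartzMap.derivCLM ℂ ℂ Q)
  refine ⟨B0 + 9 * B1, by positivity, fun y z => ?_⟩
  have hy : 0 < 1 / (1 + y ^ 2) ^ 2 := by positivity
  have hz : 0 < 1 / (1 + z ^ 2) ^ 2 := by positivity
  rcases le_total 1 |y - z| with h | h
  · calc ‖Q y - Q z‖ ≤ ‖Q y‖ + ‖Q z‖ := norm_sub_le _ _
      _ ≤ B0 / (1 + y ^ 2) ^ 2 + B0 / (1 + z ^ 2) ^ 2 := add_le_add (h0 y) (h0 z)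
      _ = B0 * 1 * (1 / (1 + y ^ 2) ^ 2 + 1 / (1 + z ^ 2) ^ 2) := by ring
      _ ≤ _ := by gcongr; linarith
  · have hder : ∀ w ∈ uIcc z y, ‖deriv Q w‖ ≤ 9 * B1 * (1 / (1 + y ^ 2) ^ 2) := by
      intro w hw
      have hwy : |w - y| ≤ 1 := by
        have : |y - w| ≤ |y - z| := abs_sub_right_of_mem_uIcc hw
        rw [abs_sub_comm y w] at this
        linarith
      have h3 : 1 + y ^ 2 ≤ 3 * (1 + w ^ 2) := by
        nlinarith [sq_abs (w - y), abs_nonneg (w - y), sq_nonneg (2 * w - y)]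
      have h4 := h1 w
      rw [SchwartzMap.derivCLM_apply] at h4
      refine h4.trans ?_
      rw [mul_one_div, div_le_div_iff₀ (by positivity) (by positivity)]
      calc B1 * (1 + y ^ 2) ^ 2 ≤ B1 * (3 * (1 + w ^ 2)) ^ 2 := by gcongr
        _ = _ := by ring
    have := (convex_uIcc z y).norm_image_sub_le_of_norm_deriv_le
      (fun w _ => Q.differentiable.differentiableAt) hder left_mem_uIcc right_mem_uIcc
    rw [Real.norm_eq_abs] at this
    calc _ ≤ _ := this
      _ = (9 * B1) * |y - z| * (1 / (1 + y ^ 2) ^ 2) := by ring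
      _ ≤ _ := by gcongr <;> linarith

/-- The logarithm of the modulus of `(1 + t, r)` equals `t` up to second order, by the elementary
bounds `1 - 1/w ≤ log w ≤ w - 1`. -/
theorem abs_sub_half_log_le {t r : ℝ} (ht : |t| ≤ 1 / 2) :
    |t - 1 / 2 * Real.log ((1 + t) ^ 2 + r ^ 2)| ≤ 8 * (t ^ 2 + r ^ 2) := by
  obtain ⟨h1, h2⟩ := abs_le.1 ht
  have hw : 1 / 4 ≤ (1 + t) ^ 2 + r ^ 2 := by nlinarith
  have hw0 : 0 < (1 + t) ^ 2 + r ^ 2 := by linarith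
  have hu := Real.log_le_sub_one_of_pos hw0
  have hl := Real.one_sub_inv_le_log_of_pos hw0
  rw [abs_le]
  constructor
  · nlinarith
  · have : t - 1 / 2 * (1 - ((1 + t) ^ 2 + r ^ 2)⁻¹) ≤ 8 * (t ^ 2 + r ^ 2) := by
      rw [← sub_nonneg]
      have : 8 * (t ^ 2 + r ^ 2) - (t - 1 / 2 * (1 - ((1 + t) ^ 2 + r ^ 2)⁻¹)) =
          (8 * (t ^ 2 + r ^ 2) * ((1 + t) ^ 2 + r ^ 2) +
            1 / 2 * (-3 * t ^ 2 - 2 * t ^ 3 + r ^ 2 * (1 - 2 * t))) / ((1 + t) ^ 2 + r ^ 2) := by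
        field_simp
        ring
      rw [this]
      refine div_nonneg ?_ hw0.le
      have ht3 : t ^ 3 ≤ 1 / 2 * t ^ 2 := by nlinarith [sq_nonneg t]
      have : 0 ≤ r ^ 2 * (1 - 2 * t) := by apply mul_nonneg (sq_nonneg _); linarith
      nlinarith [sq_nonneg t, sq_nonneg r]
    linarith

/-- A converse to the expansion: `t` is recovered from the logarithm up to `r²`, so that decay in
the new variable can be compared with decay in the old one. -/
theorem abs_le_two_mul_abs_half_log_add {t r : ℝ} (ht : |t| ≤ 1 / 2) :
    |t| ≤ 2 * |1 / 2 * Real.log ((1 + t) ^ 2 + r ^ 2)| + r ^ 2 := by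
  obtain ⟨h1, h2⟩ := abs_le.1 ht
  have hw0 : 0 < (1 + t) ^ 2 + r ^ 2 := by nlinarith
  rcases le_total 0 t with h | h
  · have hl := Real.one_sub_inv_le_log_of_pos (show 0 < 1 + 2 * t by linarith)
    have hm : Real.log (1 + 2 * t) ≤ Real.log ((1 + t) ^ 2 + r ^ 2) :=
      Real.log_le_log (by linarith) (by nlinarith)
    have : t ≤ 1 - (1 + 2 * t)⁻¹ := by
      rw [← sub_nonneg]
      have : 1 - (1 + 2 * t)⁻¹ - t = t * (1 - 2 * t) / (1 + 2 * t) := by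
        field_simp
        ring
      rw [this]
      exact div_nonneg (mul_nonneg h (by linarith)) (by linarith)
    rw [abs_of_nonneg h]
    nlinarith [le_abs_self (1 / 2 * Real.log ((1 + t) ^ 2 + r ^ 2)), sq_nonneg r]
  · have hu := Real.log_le_sub_one_of_pos hw0
    rw [abs_of_nonpos h]
    nlinarith [neg_abs_le (1 / 2 * Real.log ((1 + t) ^ 2 + r ^ 2)), sq_nonneg r]

/-- The change of variables `x ↦ u` such that `√(x² + s²) = l exp (u / l - 1)`. -/
def logPhase (l s x : ℝ) : ℝ := l + l / 2 * Real.log ((x ^ 2 + s ^ 2) / l ^ 2)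

theorem mul_exp_logPhase {l s x : ℝ} (hl : 0 < l) (hx : 0 < x) :
    l * Real.exp (logPhase l s x / l - 1) = √(x ^ 2 + s ^ 2) := by
  have h : logPhase l s x / l - 1 = 1 / 2 * Real.log ((x ^ 2 + s ^ 2) / l ^ 2) := by
    unfold logPhase
    field_simp
    ring
  have hp : 0 < (x ^ 2 + s ^ 2) / l ^ 2 := by positivity
  rw [h, mul_comm (1 / 2 : ℝ), Real.exp_mul, Real.exp_log hp, ← Real.sqrt_eq_rpow,
    Real.sqrt_div (by positivity), Real.sqrt_sq hl.le, mul_div_cancel₀ _ hl.ne']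

theorem hasDerivAt_logPhase {l s x : ℝ} (hl : 0 < l) (hx : 0 < x) :
    HasDerivAt (logPhase l s) (l * x / (x ^ 2 + s ^ 2)) x := by
  have h1 : HasDerivAt (fun x : ℝ => (x ^ 2 + s ^ 2) / l ^ 2) (2 * x / l ^ 2) x := by
    have := (((hasDerivAt_id x).pow 2).add_const (s ^ 2)).div_const (l ^ 2)
    simpa using this
  have h2 := ((h1.log (by positivity)).const_mul (l / 2)).const_add l
  refine h2.congr_deriv ?_
  field_simp

theorem injOn_logPhase {l s : ℝ} (hl : 0 < l) : InjOn (logPhase l s) (Ioi 0) := by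
  intro x hx y hy h
  have h1 := mul_exp_logPhase (s := s) hl hx
  rw [h, mul_exp_logPhase hl hy] at h1
  have h2 := (Real.sqrt_inj (by positivity) (by positivity)).1 h1
  have h3 : y ^ 2 = x ^ 2 := by linarith
  exact ((pow_left_inj₀ (le_of_lt hy) (le_of_lt hx) two_ne_zero).1 h3).symm

/-- The preimage is explicit, `√(l² e^(2τ) - s²)` with `τ = u/l - 1`. Consequently everything
outside the image of the interval lies at distance at least `l/4` from `l`. -/
theorem mem_image_logPhase {l s u : ℝ} (hl : 0 < l) (hs : |s| < l / 4) (hu : |u - l| < l / 4) :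
    u ∈ logPhase l s '' Ioo (l / 2) (3 * l / 2) := by
  set τ := u / l - 1 with hτ
  have hu' : u = l * (1 + τ) := by rw [hτ]; field_simp; ring
  have hτ1 : |τ| < 1 / 4 := by
    have : u - l = l * τ := by rw [hu']; ring
    rw [this, abs_mul, abs_of_pos hl] at hu
    nlinarith
  obtain ⟨h1, h2⟩ := abs_lt.1 hτ1
  have hs2 : s ^ 2 < (l / 4) ^ 2 := by
    rw [← sq_abs]; gcongr
  have he1 : 1 / 2 ≤ Real.exp (2 * τ) := by
    have := Real.add_one_le_exp (2 * τ)
    linarith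
  have he2 : Real.exp (2 * τ) < 9 / 4 := by
    have h3 : Real.exp (2 * τ) ≤ Real.exp (1 / 2) := Real.exp_le_exp.2 (by linarith)
    have h4 : Real.exp (1 / 2) ^ 2 < (9 / 4) ^ 2 := by
      rw [← Real.exp_nat_mul]
      norm_num
      linarith [Real.exp_one_lt_d9]
    have := lt_of_pow_lt_pow_left₀ 2 (by norm_num) h4
    linarith
  have hl2 : 0 < l ^ 2 := by positivity
  have hlow : (l / 2) ^ 2 < l ^ 2 * Real.exp (2 * τ) - s ^ 2 := by nlinarith
  have hup : l ^ 2 * Real.exp (2 * τ) - s ^ 2 < (3 * l / 2) ^ 2 := by nlinarith [sq_nonneg s]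
  refine ⟨√(l ^ 2 * Real.exp (2 * τ) - s ^ 2), ⟨Real.lt_sqrt_of_sq_lt hlow, ?_⟩, ?_⟩
  · exact (Real.sqrt_lt' (by positivity)).2 hup
  · unfold logPhase
    rw [Real.sq_sqrt (by nlinarith), sub_add_cancel, mul_div_cancel_left₀ _ hl2.ne', Real.log_exp,
      hu']
    ring

/-- The bounds satisfied by the change of variables `logPhase` near `x = l`. -/
theorem logPhase_bounds {l s x : ℝ} (hl : 1 ≤ l) (hs : |s| < l / 4)
    (hx : x ∈ Ioo (l / 2) (3 * l / 2)) :
    1 / 2 ≤ l * x / (x ^ 2 + s ^ 2) ∧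
    |1 - l * x / (x ^ 2 + s ^ 2)| ≤ 6 * (1 + (x - l) ^ 2 + s ^ 2) / l ∧
    |(x - l) - (logPhase l s x - l)| ≤ 8 * (1 + (x - l) ^ 2 + s ^ 2) / l ∧
    1 + (x - l) ^ 2 + s ^ 2 ≤ 8 * (1 + s ^ 2) * (1 + (logPhase l s x - l) ^ 2) := by
  have hl0 : 0 < l := by linarith
  obtain ⟨t, ht⟩ : ∃ t, x = l * (1 + t) := ⟨x / l - 1, by field_simp; ring⟩
  obtain ⟨r, hr⟩ : ∃ r, s = l * r := ⟨s / l, by field_simp⟩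
  have ht1 : |t| ≤ 1 / 2 := by
    rw [abs_le]; constructor <;> nlinarith [hx.1, hx.2]
  obtain ⟨hta, htb⟩ := abs_le.1 ht1
  have hr1 : |r| < 1 / 4 := by
    rw [hr, abs_mul, abs_of_pos hl0] at hs
    nlinarith
  have hr2 : r ^ 2 ≤ 1 / 16 := by
    rw [← sq_abs]; nlinarith [abs_nonneg r]
  have hw : 1 / 4 ≤ (1 + t) ^ 2 + r ^ 2 := by nlinarith
  have hw0 : 0 < (1 + t) ^ 2 + r ^ 2 := by linarith
  have hd : l * x / (x ^ 2 + s ^ 2) = (1 + t) / ((1 + t) ^ 2 + r ^ 2) := by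
    rw [ht, hr]
    field_simp
  have hlog : logPhase l s x - l = l * (1 / 2 * Real.log ((1 + t) ^ 2 + r ^ 2)) := by
    have : (x ^ 2 + s ^ 2) / l ^ 2 = (1 + t) ^ 2 + r ^ 2 := by
      rw [ht, hr]; field_simp
    rw [logPhase, this]
    ring
  have hxl : x - l = l * t := by rw [ht]; ring
  refine ⟨?_, ?_, ?_, ?_⟩
  · rw [hd, div_le_div_iff₀ two_pos hw0]
    nlinarith
  · rw [hd, hxl, hr]
    have h1 : 1 - (1 + t) / ((1 + t) ^ 2 + r ^ 2) = (t + t ^ 2 + r ^ 2) / ((1 + t) ^ 2 + r ^ 2) := by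
      field_simp
      ring
    rw [h1, abs_div, abs_of_pos hw0, div_le_div_iff₀ hw0 hl0]
    have h2 : |t + t ^ 2 + r ^ 2| ≤ 3 / 2 * |t| + r ^ 2 := by
      rw [abs_le]
      constructor <;> cases abs_cases t <;> nlinarith [sq_nonneg r]
    have h3 : l * |t| ≤ 1 + (l * t) ^ 2 := by
      have : (l * t) ^ 2 = (l * |t|) ^ 2 := by rw [mul_pow, mul_pow, sq_abs]
      rw [this]
      nlinarith [sq_nonneg (l * |t| - 1)]
    have h4 : l * r ^ 2 ≤ (l * r) ^ 2 := by nlinarith [sq_nonneg r]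
    calc |t + t ^ 2 + r ^ 2| * l ≤ (3 / 2 * |t| + r ^ 2) * l := by gcongr
      _ ≤ 3 / 2 * (1 + (l * t) ^ 2 + (l * r) ^ 2) := by nlinarith [sq_nonneg (l * r)]
      _ = 6 * (1 + (l * t) ^ 2 + (l * r) ^ 2) * (1 / 4) := by ring
      _ ≤ _ := by gcongr
  · rw [hlog, hxl, hr, ← mul_sub, abs_mul, abs_of_pos hl0, le_div_iff₀ hl0]
    have := abs_sub_half_log_le (r := r) ht1
    calc _ ≤ l * (8 * (t ^ 2 + r ^ 2)) * l := by gcongr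
      _ ≤ _ := by nlinarith
  · rw [hlog, hxl, hr]
    set z := 1 / 2 * Real.log ((1 + t) ^ 2 + r ^ 2) with hz
    have h1 := abs_le_two_mul_abs_half_log_add (r := r) ht1
    have h2 : r ^ 2 ≤ |r| := by rw [← sq_abs]; nlinarith [abs_nonneg r]
    have h3 : |t| ≤ 2 * |z| + |r| := by linarith
    have h4 : t ^ 2 ≤ 8 * z ^ 2 + 2 * r ^ 2 := by
      calc t ^ 2 = |t| ^ 2 := (sq_abs t).symm
        _ ≤ (2 * |z| + |r|) ^ 2 := by gcongr
        _ ≤ 8 * |z| ^ 2 + 2 * |r| ^ 2 := by linarith [sq_nonneg (2 * |z| - |r|)]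
        _ = _ := by rw [sq_abs, sq_abs]
    have h5 : (l * t) ^ 2 ≤ 8 * (l * z) ^ 2 + 2 * (l * r) ^ 2 := by
      calc (l * t) ^ 2 = l ^ 2 * t ^ 2 := mul_pow _ _ _
        _ ≤ l ^ 2 * (8 * z ^ 2 + 2 * r ^ 2) := by gcongr
        _ = _ := by ring
    have h6 := mul_nonneg (sq_nonneg (l * r)) (sq_nonneg (l * z))
    have h7 := sq_nonneg (l * r)
    calc 1 + (l * t) ^ 2 + (l * r) ^ 2
        ≤ 1 + (8 * (l * z) ^ 2 + 2 * (l * r) ^ 2) + (l * r) ^ 2 := by gcongr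
      _ ≤ 8 * (1 + (l * r) ^ 2) * (1 + (l * z) ^ 2) := by linarith

end PhaseComparison

/-! ### Comparison of the integrals before and after the substitution -/

section PhaseComparison

open Set

theorem integrable_inv_one_add_sub_sq (l : ℝ) : Integrable (fun x : ℝ => (1 + (x - l) ^ 2)⁻¹) :=
  integrable_inv_one_add_sq.comp_sub_right l

theorem setIntegral_inv_one_add_sub_sq_le (l : ℝ) (S : Set ℝ) :
    ∫ x in S, (1 + (x - l) ^ 2)⁻¹ ≤ Real.pi := by
  calc ∫ x in S, (1 + (x - l) ^ 2)⁻¹ ≤ ∫ x, (1 + (x - l) ^ 2)⁻¹ :=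
        setIntegral_le_integral (integrable_inv_one_add_sub_sq l)
          (Filter.Eventually.of_forall fun x => by positivity)
    _ = Real.pi := by
        rw [integral_sub_right_eq_self (fun x : ℝ => (1 + x ^ 2)⁻¹) l, integral_univ_inv_one_add_sq]

theorem integrable_mul_schwartz_sub {ψ : ℝ → ℝ} (hψ : Measurable ψ) {M : ℝ} (hM : ∀ r, |ψ r| ≤ M)
    (Q : 𝓢(ℝ, ℂ)) (l : ℝ) : Integrable (fun x => (ψ x : ℂ) * Q (x - l)) := by
  refine (Q.integrable.comp_sub_right l).bdd_mul (c := M) ?_ ?_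
  · exact (Complex.measurable_ofReal.comp hψ).aestronglyMeasurable
  · exact Filter.Eventually.of_forall fun x => by simpa using hM x

theorem norm_integral_mul_schwartz_sub_le {ψ : ℝ → ℝ} {M : ℝ}
    (hM : ∀ r, |ψ r| ≤ M) (Q : 𝓢(ℝ, ℂ)) (l : ℝ) :
    ‖∫ x, (ψ x : ℂ) * Q (x - l)‖ ≤ M * ∫ x, ‖Q x‖ := by
  rw [← integral_sub_right_eq_self (fun x => ‖Q x‖) l, ← integral_const_mul]
  refine norm_integral_le_of_norm_le ((Q.integrable.norm.comp_sub_right l).const_mul M) ?_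
  refine Filter.Eventually.of_forall fun x => ?_
  rw [norm_mul, Complex.norm_real, Real.norm_eq_abs]
  gcongr
  exact hM x

/-- Far from `l`, one factor `(1 + (x - l)²)⁻¹` is at most `16 / l` and the other is integrable. -/
theorem norm_setIntegral_tail_le {ψ : ℝ → ℝ} {M : ℝ} (hM : ∀ r, |ψ r| ≤ M) (hM0 : 0 ≤ M)
    {Q : ℝ → ℂ} {B : ℝ} (hB : ∀ y, ‖Q y‖ ≤ B / (1 + y ^ 2) ^ 2) (hB0 : 0 ≤ B) {l : ℝ} (hl : 1 ≤ l)
    {S : Set ℝ} (hS : MeasurableSet S) (hfar : ∀ x ∈ S, l / 4 ≤ |x - l|) :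
    ‖∫ x in S, (ψ x : ℂ) * Q (x - l)‖ ≤ 16 * Real.pi * B * M / l := by
  have h1 : ∀ x ∈ S, ‖(ψ x : ℂ) * Q (x - l)‖ ≤ 16 * B * M / l * (1 + (x - l) ^ 2)⁻¹ := by
    intro x hx
    rw [norm_mul, Complex.norm_real, Real.norm_eq_abs]
    have h2 : l ^ 2 / 16 ≤ (x - l) ^ 2 := by
      rw [← sq_abs (x - l)]
      calc l ^ 2 / 16 = (l / 4) ^ 2 := by ring
        _ ≤ _ := by gcongr; exact hfar x hx
    have h3 : l / 16 ≤ 1 + (x - l) ^ 2 := by nlinarith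
    calc |ψ x| * ‖Q (x - l)‖ ≤ M * (B / (1 + (x - l) ^ 2) ^ 2) := by gcongr; exacts [hM x, hB _]
      _ = M * B * (1 + (x - l) ^ 2)⁻¹ * (1 + (x - l) ^ 2)⁻¹ := by field_simp
      _ ≤ M * B * (l / 16)⁻¹ * (1 + (x - l) ^ 2)⁻¹ := by gcongr
      _ = _ := by field_simp
  calc ‖∫ x in S, (ψ x : ℂ) * Q (x - l)‖ ≤ ∫ x in S, 16 * B * M / l * (1 + (x - l) ^ 2)⁻¹ :=
        norm_integral_le_of_norm_le ((integrable_inv_one_add_sub_sq l).const_mul _).integrableOn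
          ((ae_restrict_iff' hS).2 (Filter.Eventually.of_forall h1))
    _ ≤ 16 * B * M / l * Real.pi := by
        rw [integral_const_mul]
        gcongr
        exact setIntegral_inv_one_add_sub_sq_le l S
    _ = _ := by ring

/-- Two errors occur, one from moving the argument of `Q` and one from a Jacobian different from
`1`; both are `O((1 + y² + s²)/l)`. The quadratic loss is absorbed by one factor of the decay at `y`
or at `z`, at the cost of `1 + s²`. The second term keeps the Jacobian so that it can be integrated
in the new variable. -/
theorem norm_sub_smul_logPhase_le {Q : ℝ → ℂ} {B0 B1 : ℝ}
    (hB0 : 0 ≤ B0) (h0 : ∀ y, ‖Q y‖ ≤ B0 / (1 + y ^ 2) ^ 2) (hB1 : 0 ≤ B1)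
    (h1 : ∀ y z, ‖Q y - Q z‖ ≤ B1 * |y - z| * (1 / (1 + y ^ 2) ^ 2 + 1 / (1 + z ^ 2) ^ 2))
    {l s x : ℝ} (hl : 1 ≤ l) (hs : |s| < l / 4) (hx : x ∈ Ioo (l / 2) (3 * l / 2)) :
    ‖Q (x - l) - (l * x / (x ^ 2 + s ^ 2) : ℝ) * Q (logPhase l s x - l)‖ ≤
      (128 * B1 + 96 * B0) * (1 + s ^ 2) / l * ((1 + (x - l) ^ 2)⁻¹ +
        l * x / (x ^ 2 + s ^ 2) * (1 + (logPhase l s x - l) ^ 2)⁻¹) := by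
  obtain ⟨b1, b2, b3, b4⟩ := logPhase_bounds hl hs hx
  set d := l * x / (x ^ 2 + s ^ 2)
  set z := logPhase l s x - l
  set y := x - l
  have hl0 : 0 < l := by linarith
  have hP1 : 1 + y ^ 2 + s ^ 2 ≤ (1 + s ^ 2) * (1 + y ^ 2) := by
    nlinarith [mul_nonneg (sq_nonneg s) (sq_nonneg y)]
  have e1 : Q y - (d : ℂ) * Q z = (Q y - Q z) + ((1 - d : ℝ) : ℂ) * Q z := by
    push_cast
    ring
  have hy : (1 + y ^ 2 + s ^ 2) * (1 / (1 + y ^ 2) ^ 2) ≤ (1 + s ^ 2) * (1 + y ^ 2)⁻¹ := by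
    calc _ ≤ ((1 + s ^ 2) * (1 + y ^ 2)) * (1 / (1 + y ^ 2) ^ 2) := by gcongr
      _ = _ := by field_simp
  have hz : (1 + y ^ 2 + s ^ 2) * (1 / (1 + z ^ 2) ^ 2) ≤ 8 * (1 + s ^ 2) * (1 + z ^ 2)⁻¹ := by
    calc _ ≤ (8 * (1 + s ^ 2) * (1 + z ^ 2)) * (1 / (1 + z ^ 2) ^ 2) := by gcongr
      _ = _ := by field_simp
  have hzd : (1 + z ^ 2)⁻¹ ≤ 2 * (d * (1 + z ^ 2)⁻¹) := by
    have : 0 < (1 + z ^ 2)⁻¹ := by positivity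
    nlinarith
  rw [e1]
  calc ‖(Q y - Q z) + ((1 - d : ℝ) : ℂ) * Q z‖ ≤ ‖Q y - Q z‖ + |1 - d| * ‖Q z‖ := by
        refine (norm_add_le _ _).trans ?_
        rw [norm_mul, Complex.norm_real, Real.norm_eq_abs]
    _ ≤ B1 * (8 * (1 + y ^ 2 + s ^ 2) / l) * (1 / (1 + y ^ 2) ^ 2 + 1 / (1 + z ^ 2) ^ 2) +
        6 * (1 + y ^ 2 + s ^ 2) / l * (B0 / (1 + z ^ 2) ^ 2) := by
        gcongr
        · refine (h1 y z).trans ?_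
          gcongr
        · exact h0 z
    _ = 8 * B1 / l * ((1 + y ^ 2 + s ^ 2) * (1 / (1 + y ^ 2) ^ 2)) +
        (8 * B1 + 6 * B0) / l * ((1 + y ^ 2 + s ^ 2) * (1 / (1 + z ^ 2) ^ 2)) := by ring
    _ ≤ 8 * B1 / l * ((1 + s ^ 2) * (1 + y ^ 2)⁻¹) +
        (8 * B1 + 6 * B0) / l * (8 * (1 + s ^ 2) * (2 * (d * (1 + z ^ 2)⁻¹))) := by
        refine add_le_add (mul_le_mul_of_nonneg_left hy (by positivity))
          (mul_le_mul_of_nonneg_left (hz.trans ?_) (by positivity))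
        gcongr
    _ = (1 + s ^ 2) / l * (8 * B1 * (1 + y ^ 2)⁻¹) +
        (128 * B1 + 96 * B0) * (1 + s ^ 2) / l * (d * (1 + z ^ 2)⁻¹) := by ring
    _ ≤ (1 + s ^ 2) / l * ((128 * B1 + 96 * B0) * (1 + y ^ 2)⁻¹) +
        (128 * B1 + 96 * B0) * (1 + s ^ 2) / l * (d * (1 + z ^ 2)⁻¹) := by
        gcongr
        linarith
    _ = _ := by ring

/-- After the substitution both integrals evaluate `m` at the same points, so only the smooth
kernels are compared and boundedness of `m` is enough. -/
theorem exists_norm_integral_sub_integral_exp_le (Q : 𝓢(ℝ, ℂ)) : ∃ C : ℝ, 0 ≤ C ∧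
    ∀ (m : ℝ → ℝ) (M l s : ℝ), Measurable m → (∀ r, |m r| ≤ M) → 0 < l →
      ‖(∫ x, (m √(x ^ 2 + s ^ 2) : ℂ) * Q (x - l)) -
        ∫ u, (m (l * Real.exp (u / l - 1)) : ℂ) * Q (u - l)‖ ≤ C * M * (1 + s ^ 2) / l := by
  obtain ⟨B0, hB0, h0⟩ := exists_norm_schwartz_le Q
  obtain ⟨B1, hB1, h1⟩ := exists_norm_schwartz_sub_le Q
  have hQ0 : 0 ≤ ∫ x, ‖Q x‖ := by positivity
  refine ⟨32 * (∫ x, ‖Q x‖) + 32 * Real.pi * B0 + 2 * Real.pi * (128 * B1 + 96 * B0),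
    by positivity, fun m M l s hm hM hl => ?_⟩
  have hM0 : 0 ≤ M := (abs_nonneg _).trans (hM 0)
  -- In this range `(1 + s²)/l` is at least `1/16`, and bounding each integral separately suffices.
  by_cases hcase : l < 1 ∨ l / 4 ≤ |s|
  · have hbig : 1 / 16 ≤ (1 + s ^ 2) / l := by
      rw [div_le_div_iff₀ (by norm_num) hl]
      rcases lt_or_ge l 1 with h | h
      · nlinarith [sq_nonneg s]
      · have hs : l / 4 ≤ |s| := hcase.resolve_left (by linarith)
        have : (l / 4) ^ 2 ≤ s ^ 2 := by rw [← sq_abs s]; gcongr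
        nlinarith
    calc _ ≤ M * (∫ x, ‖Q x‖) + M * ∫ x, ‖Q x‖ :=
          (norm_sub_le _ _).trans (add_le_add
            (norm_integral_mul_schwartz_sub_le (ψ := fun x => m √(x ^ 2 + s ^ 2)) (fun r => hM _) Q l)
            (norm_integral_mul_schwartz_sub_le (ψ := fun u => m (l * Real.exp (u / l - 1)))
              (fun r => hM _) Q l))
      _ = 32 * (∫ x, ‖Q x‖) * M * (1 / 16) := by ring
      _ ≤ (32 * (∫ x, ‖Q x‖) + 32 * Real.pi * B0 + 2 * Real.pi * (128 * B1 + 96 * B0)) * M *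
          ((1 + s ^ 2) / l) := by
          have := Real.pi_pos
          gcongr
          linarith [show 0 ≤ 32 * Real.pi * B0 + 2 * Real.pi * (128 * B1 + 96 * B0) by positivity]
      _ = _ := by ring
  push Not at hcase
  obtain ⟨hl1, hs⟩ := hcase
  set I := Ioo (l / 2) (3 * l / 2)
  have hIpos : I ⊆ Ioi 0 := fun x hx => lt_trans (by positivity) hx.1
  have hinj : InjOn (logPhase l s) I := (injOn_logPhase hl).mono hIpos
  have hderiv : ∀ x ∈ I, HasDerivWithinAt (logPhase l s) (l * x / (x ^ 2 + s ^ 2)) I x :=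
    fun x hx => (hasDerivAt_logPhase hl (hIpos hx)).hasDerivWithinAt
  set J := logPhase l s '' I
  have hJ : MeasurableSet J := measurableSet_Ioo.image_of_continuousOn_injOn
    (fun x hx => (hderiv x hx).continuousWithinAt) hinj
  have hma : Measurable (fun x => m √(x ^ 2 + s ^ 2)) := hm.comp (by fun_prop)
  have hmb : Measurable (fun u => m (l * Real.exp (u / l - 1))) := hm.comp (by fun_prop)
  have ha := integrable_mul_schwartz_sub hma (fun r => hM _) Q l
  have hb := integrable_mul_schwartz_sub hmb (fun r => hM _) Q l
  have hchange := integral_image_eq_integral_abs_deriv_smul measurableSet_Ioo hderiv hinj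
    (fun u => (m (l * Real.exp (u / l - 1)) : ℂ) * Q (u - l))
  have hbI := (integrableOn_image_iff_integrableOn_abs_deriv_smul measurableSet_Ioo hderiv hinj
    (fun u => (m (l * Real.exp (u / l - 1)) : ℂ) * Q (u - l))).1 hb.integrableOn
  have hkchange := integral_image_eq_integral_abs_deriv_smul measurableSet_Ioo hderiv hinj
    (fun u => (1 + (u - l) ^ 2)⁻¹)
  have hkI := (integrableOn_image_iff_integrableOn_abs_deriv_smul measurableSet_Ioo hderiv hinj
    (fun u => (1 + (u - l) ^ 2)⁻¹)).1 (integrable_inv_one_add_sub_sq l).integrableOn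
  have t1 := norm_setIntegral_tail_le (ψ := fun x => m √(x ^ 2 + s ^ 2)) (fun r => hM _) hM0 h0 hB0
    hl1 (S := Iᶜ) measurableSet_Ioo.compl (fun x hx => by
      by_contra hc
      push Not at hc
      obtain ⟨c1, c2⟩ := abs_lt.1 hc
      exact hx ⟨by linarith, by linarith⟩)
  have t2 := norm_setIntegral_tail_le (ψ := fun u => m (l * Real.exp (u / l - 1))) (fun r => hM _)
    hM0 h0 hB0 hl1 (S := Jᶜ) hJ.compl (fun u hu => by
      by_contra hc
      push Not at hc
      exact hu (mem_image_logPhase hl hs hc))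
  -- The main term: both integrals are brought to `I`, where the factor `m √(x² + s²)` comes out of
  -- the difference.
  have t3 : ‖(∫ x in I, (m √(x ^ 2 + s ^ 2) : ℂ) * Q (x - l)) -
      ∫ u in J, (m (l * Real.exp (u / l - 1)) : ℂ) * Q (u - l)‖ ≤
      2 * Real.pi * (128 * B1 + 96 * B0) * M * (1 + s ^ 2) / l := by
    rw [hchange, ← integral_sub ha.integrableOn hbI]
    set K := M * ((128 * B1 + 96 * B0) * (1 + s ^ 2) / l) with hK
    have hK0 : 0 ≤ K := by positivity
    calc _ ≤ ∫ x in I, K * ((1 + (x - l) ^ 2)⁻¹ +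
          |l * x / (x ^ 2 + s ^ 2)| • (1 + (logPhase l s x - l) ^ 2)⁻¹) := by
          refine norm_integral_le_of_norm_le
            (((integrable_inv_one_add_sub_sq l).integrableOn.add hkI).const_mul K)
            ((ae_restrict_iff' measurableSet_Ioo).2 (Filter.Eventually.of_forall fun x hx => ?_))
          have hx0 : 0 < x := hIpos hx
          have hd0 : 0 < l * x / (x ^ 2 + s ^ 2) := by positivity
          rw [abs_of_pos hd0, mul_exp_logPhase hl hx0]
          have e : (m √(x ^ 2 + s ^ 2) : ℂ) * Q (x - l) - (l * x / (x ^ 2 + s ^ 2)) •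
              ((m √(x ^ 2 + s ^ 2) : ℂ) * Q (logPhase l s x - l)) = (m √(x ^ 2 + s ^ 2) : ℂ) *
              (Q (x - l) - (l * x / (x ^ 2 + s ^ 2) : ℝ) * Q (logPhase l s x - l)) := by
            rw [Complex.real_smul]
            ring
          rw [e, norm_mul, Complex.norm_real, Real.norm_eq_abs, hK, mul_assoc M]
          gcongr
          · exact hM _
          · exact norm_sub_smul_logPhase_le hB0 h0 hB1 h1 hl1 hs hx
      _ = K * ((∫ x in I, (1 + (x - l) ^ 2)⁻¹) + ∫ u in J, (1 + (u - l) ^ 2)⁻¹) := by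
          rw [integral_const_mul,
            integral_add (integrable_inv_one_add_sub_sq l).integrableOn hkI, hkchange]
      _ ≤ K * (Real.pi + Real.pi) := by
          gcongr <;> exact setIntegral_inv_one_add_sub_sq_le l _
      _ = _ := by rw [hK]; ring
  rw [← integral_add_compl measurableSet_Ioo ha, ← integral_add_compl hJ hb]
  have hsplit : ∀ a b c d : ℂ, ‖(a + b) - (c + d)‖ ≤ ‖a - c‖ + ‖b‖ + ‖d‖ := by
    intro a b c d
    calc ‖(a + b) - (c + d)‖ = ‖(a - c) + b - d‖ := by congr 1; ring
      _ ≤ _ := (norm_sub_le _ _).trans (by gcongr; exact norm_add_le _ _)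
  refine (hsplit _ _ _ _).trans ?_
  calc _ ≤ 2 * Real.pi * (128 * B1 + 96 * B0) * M * (1 + s ^ 2) / l +
        16 * Real.pi * B0 * M / l + 16 * Real.pi * B0 * M / l := by gcongr
    _ = 2 * Real.pi * (128 * B1 + 96 * B0) * M * (1 + s ^ 2) / l +
        32 * Real.pi * B0 * M * 1 / l := by ring
    _ ≤ 2 * Real.pi * (128 * B1 + 96 * B0) * M * (1 + s ^ 2) / l +
        32 * Real.pi * B0 * M * (1 + s ^ 2) / l + 32 * (∫ x, ‖Q x‖) * M * (1 + s ^ 2) / l := by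
        have : 0 ≤ 32 * (∫ x, ‖Q x‖) * M * (1 + s ^ 2) / l := by positivity
        have h3 : 32 * Real.pi * B0 * M * 1 / l ≤ 32 * Real.pi * B0 * M * (1 + s ^ 2) / l := by
          have := Real.pi_pos
          gcongr
          nlinarith
        linarith
    _ = _ := by ring

end PhaseComparison

/-! ### Wave packets on the model tube -/

section WavePacket

theorem fourier_tensor {E F : Type*} [NormedAddCommGroup E] [InnerProductSpace ℝ E]
    [FiniteDimensional ℝ E] [MeasurableSpace E] [BorelSpace E] [NormedAddCommGroup F]
    [InnerProductSpace ℝ F] [FiniteDimensional ℝ F] [MeasurableSpace F] [BorelSpace F]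
    (f : E → ℂ) (g : F → ℂ) (ξ : WithLp 2 (E × F)) :
    𝓕 (fun v : WithLp 2 (E × F) => f v.fst * g v.snd) ξ = 𝓕 f ξ.fst * 𝓕 g ξ.snd := by
  rw [Real.fourier_eq, Real.fourier_eq, Real.fourier_eq, ← integral_prod_mul,
    ← Measure.volume_eq_prod, ← (WithLp.volume_preserving_toLp E F).integral_comp
      (MeasurableEquiv.toLp 2 (E × F)).measurableEmbedding]
  congr 1
  ext v
  simp only [WithLp.prod_inner_apply, WithLp.toLp_fst, WithLp.toLp_snd, Circle.smul_def,
    smul_eq_mul, neg_add, AddChar.map_add_eq_mul, Circle.coe_mul, WithLp.ofLp_fst,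
    WithLp.ofLp_snd]
  ring

theorem fourier_modulate (f : ℝ → ℂ) (μ x : ℝ) :
    𝓕 (fun t => (Real.fourierChar (μ * t) : ℂ) * f t) x = 𝓕 f (x - μ) := by
  rw [Real.fourier_real_eq, Real.fourier_real_eq]
  congr 1
  ext t
  simp only [Circle.smul_def, smul_eq_mul]
  rw [← mul_assoc, ← Circle.coe_mul, ← AddChar.map_add_eq_mul]
  congr 3
  ring

/-- The bump function that is positive exactly on the unit interval centred at `c`. -/
def unitBump (c : ℝ) : ContDiffBump c := ⟨1 / 4, 1 / 2, by norm_num, by norm_num⟩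

/-- A fixed bump function supported in the unit ball of `ℝ^k`. -/
def ballBump (k : ℕ) : ContDiffBump (0 : Euc k) := ⟨1 / 2, 1, by norm_num, by norm_num⟩

theorem unitBump_ne_zero_iff {c x : ℝ} : unitBump c x ≠ 0 ↔ |x - c| < 1 / 2 := by
  rw [← Function.mem_support, ContDiffBump.support_eq]
  simp [unitBump, Real.dist_eq]

/-- The profile of a wave packet adapted to a tube of width `δ`. -/
def wavePacketFun (k : ℕ) (δ μ c : ℝ) (v : TubeModel k) : ℂ :=
  ((Real.fourierChar (μ * v.fst) : ℂ) * (unitBump c v.fst : ℂ)) * (ballBump k (δ⁻¹ • v.snd) : ℂ)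

theorem contDiff_wavePacketFun (k : ℕ) (δ μ c : ℝ) : ContDiff ℝ ∞ (wavePacketFun k δ μ c) := by
  have h1 : ContDiff ℝ ∞ (fun v : TubeModel k => v.fst) :=
    (ContinuousLinearMap.contDiff (𝕜 := ℝ) (ContinuousLinearMap.fst ℝ ℝ (Euc k))).comp
      (WithLp.prodContinuousLinearEquiv 2 ℝ ℝ (Euc k)).contDiff
  have h2 : ContDiff ℝ ∞ (fun v : TubeModel k => v.snd) :=
    (ContinuousLinearMap.contDiff (𝕜 := ℝ) (ContinuousLinearMap.snd ℝ ℝ (Euc k))).comp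
      (WithLp.prodContinuousLinearEquiv 2 ℝ ℝ (Euc k)).contDiff
  have h3 : ContDiff ℝ ∞ (fun v : TubeModel k => (Real.fourierChar (μ * v.fst) : ℂ)) := by
    simp_rw [Real.fourierChar_apply]
    have : ContDiff ℝ ∞ (fun v : TubeModel k => ((2 * Real.pi * (μ * v.fst) : ℝ) : ℂ)) :=
      Complex.ofRealCLM.contDiff.comp (contDiff_const.mul (contDiff_const.mul h1))
    exact (this.mul contDiff_const).cexp
  have h4 : ContDiff ℝ ∞ (fun v : TubeModel k => (unitBump c v.fst : ℂ)) :=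
    Complex.ofRealCLM.contDiff.comp ((unitBump c).contDiff.comp h1)
  have h5 : ContDiff ℝ ∞ (fun v : TubeModel k => (ballBump k (δ⁻¹ • v.snd) : ℂ)) :=
    Complex.ofRealCLM.contDiff.comp ((ballBump k).contDiff.comp (h2.const_smul δ⁻¹))
  exact (h3.mul h4).mul h5

theorem wavePacketFun_ne_zero {k : ℕ} {δ μ c : ℝ} (hδ : 0 < δ) {v : TubeModel k}
    (hv : wavePacketFun k δ μ c v ≠ 0) : |v.fst - c| < 1 / 2 ∧ ‖v.snd‖ < δ := by
  simp only [wavePacketFun, mul_ne_zero_iff, Complex.ofReal_ne_zero] at hv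
  refine ⟨unitBump_ne_zero_iff.1 hv.1.2, ?_⟩
  have h := hv.2
  rw [← Function.mem_support, ContDiffBump.support_eq] at h
  have h1 : ‖δ⁻¹ • v.snd‖ < 1 := by simpa [ballBump] using h
  rw [norm_smul, norm_inv, Real.norm_of_nonneg hδ.le, inv_mul_lt_iff₀ hδ] at h1
  simpa using h1

theorem hasCompactSupport_wavePacketFun (k : ℕ) {δ : ℝ} (hδ : 0 < δ) (μ c : ℝ) :
    HasCompactSupport (wavePacketFun k δ μ c) := by
  refine HasCompactSupport.intro (isCompact_closedBall 0 (|c| + 1 / 2 + δ)) fun v hv => ?_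
  by_contra h
  obtain ⟨h1, h2⟩ := wavePacketFun_ne_zero hδ h
  refine hv (mem_closedBall_zero_iff.2 ?_)
  rw [WithLp.prod_norm_eq_of_L2]
  have h3 : ‖v.fst‖ ≤ |c| + 1 / 2 := by
    have : v.fst = (v.fst - c) + c := by ring
    rw [Real.norm_eq_abs, this]
    linarith [abs_add_le (v.fst - c) c]
  refine Real.sqrt_le_iff.2 ⟨by positivity, ?_⟩
  nlinarith [norm_nonneg v.fst, norm_nonneg v.snd, abs_nonneg c]

/-- The wave packet `e(μ s) a(s) b(y / δ)`, as a Schwartz function. -/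
def wavePacket (k : ℕ) {δ : ℝ} (hδ : 0 < δ) (μ c : ℝ) : 𝓢(TubeModel k, ℂ) :=
  (hasCompactSupport_wavePacketFun k hδ μ c).toSchwartzMap (contDiff_wavePacketFun k δ μ c)

theorem norm_wavePacket_le (k : ℕ) {δ : ℝ} (hδ : 0 < δ) (μ c : ℝ) (v : TubeModel k) :
    ‖wavePacket k hδ μ c v‖ ≤ 1 := by
  change ‖wavePacketFun k δ μ c v‖ ≤ 1
  rw [wavePacketFun, norm_mul, norm_mul, Circle.norm_coe, one_mul, Complex.norm_real,
    Complex.norm_real, Real.norm_of_nonneg (unitBump c).nonneg,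
    Real.norm_of_nonneg (ballBump k).nonneg]
  exact mul_le_one₀ (unitBump c).le_one (ballBump k).nonneg (ballBump k).le_one

theorem wavePacket_eq_zero (k : ℕ) {δ : ℝ} (hδ : 0 < δ) (μ : ℝ) {a : ℝ} {v : TubeModel k}
    (hv : v ∉ modelSlab k δ a (a + 1)) : wavePacket k hδ μ (a + 1 / 2) v = 0 := by
  by_contra h
  obtain ⟨h1, h2⟩ := wavePacketFun_ne_zero hδ h
  obtain ⟨h3, h4⟩ := abs_lt.1 h1
  exact hv ⟨⟨by linarith, by linarith⟩, h2⟩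

/-- The Fourier transform of the bump function in the direction of a tube. -/
def bumpHat (c : ℝ) : ℝ → ℂ := 𝓕 (fun t : ℝ => (unitBump c t : ℂ))

/-- The squared Fourier transform of the bump function across a tube. -/
def ballWeight (k : ℕ) (η : Euc k) : ℝ := ‖𝓕 (fun y : Euc k => (ballBump k y : ℂ)) η‖ ^ 2

theorem fourier_wavePacket (k : ℕ) {δ : ℝ} (hδ : 0 < δ) (μ c : ℝ) (ξ : TubeModel k) :
    𝓕 (wavePacket k hδ μ c : TubeModel k → ℂ) ξ = bumpHat c (ξ.fst - μ) *
      ((δ ^ k : ℝ) * 𝓕 (fun y : Euc k => (ballBump k y : ℂ)) (δ • ξ.snd)) := by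
  have h := fourier_tensor (fun t : ℝ => (Real.fourierChar (μ * t) : ℂ) * (unitBump c t : ℂ))
    (fun y : Euc k => (ballBump k (δ⁻¹ • y) : ℂ)) ξ
  rw [fourier_modulate (fun t => (unitBump c t : ℂ)), fourier_comp_smul
    (fun y : Euc k => (ballBump k y : ℂ)) (inv_pos.2 hδ)] at h
  rw [inv_inv, inv_pow, inv_inv] at h
  refine Eq.trans ?_ (h.trans ?_)
  · rfl
  · simp [bumpHat]

/-- The form of two wave packets on parallel tubes. -/
theorem radialForm_wavePacket (k : ℕ) {δ : ℝ} (hδ : 0 < δ) (m : ℝ → ℝ) (μ c c' : ℝ) :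
    radialForm m (wavePacket k hδ μ c : TubeModel k → ℂ) (wavePacket k hδ μ c') =
      (δ ^ k : ℝ) * ∫ ξ : TubeModel k, (m ‖ξ‖ : ℂ) *
        (bumpHat c (ξ.fst - μ) * conj (bumpHat c' (ξ.fst - μ))) *
        (δ ^ k * ballWeight k (δ • ξ.snd) : ℝ) := by
  rw [radialForm, ← integral_const_mul]
  congr 1
  ext ξ
  rw [fourier_wavePacket, fourier_wavePacket, ballWeight]
  push_cast
  rw [← Complex.mul_conj', map_mul, map_mul, map_pow, Complex.conj_ofReal]
  ring

end WavePacket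

/-! ### Multipliers as superpositions of wave packet kernels -/

section Superposition

open Set

theorem conj_fourier_conj {V : Type*} [NormedAddCommGroup V] [InnerProductSpace ℝ V]
    [FiniteDimensional ℝ V] [MeasurableSpace V] [BorelSpace V] (g : V → ℂ) (ξ : V) :
    conj (𝓕 (fun x => conj (g x)) ξ) = 𝓕⁻ g ξ := by
  rw [Real.fourier_eq', Real.fourierInv_eq', ← integral_conj]
  congr 1
  ext v
  simp [← Complex.exp_conj, Complex.conj_ofNat]

theorem integral_fourierInv_mul_comm {V : Type*} [NormedAddCommGroup V] [InnerProductSpace ℝ V]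
    [FiniteDimensional ℝ V] [MeasurableSpace V] [BorelSpace V] {F g : V → ℂ}
    (hF : Integrable F) (hg : Integrable g) : ∫ x, 𝓕⁻ F x * g x = ∫ x, F x * 𝓕⁻ g x := by
  have hg' : Integrable (fun x => conj (g x)) :=
    (LinearIsometryEquiv.integrable_comp_iff (RCLike.conjLIE (K := ℂ))).2 hg
  have := integral_fourierInv_mul_conj hF hg'
  simpa [conj_fourier_conj] using this

/-- The Fourier transform of a product, as a superposition of translates. -/
theorem fourier_mul_eq_integral (q h : 𝓢(ℝ, ℂ)) (y : ℝ) :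
    𝓕 (fun x => q x * h x) y = ∫ s, 𝓕 (h : ℝ → ℂ) s * 𝓕 (q : ℝ → ℂ) (y - s) := by
  have hG : Integrable (fun x : ℝ => (Real.fourierChar (-(y * x)) : ℂ) * q x) := by
    refine q.integrable.bdd_mul (c := 1) ?_ (Filter.Eventually.of_forall fun x => ?_)
    swap; · rw [Circle.norm_coe]
    exact Continuous.aestronglyMeasurable (by fun_prop)
  have h1 : ∀ s, 𝓕 (q : ℝ → ℂ) (y - s) =
      𝓕⁻ (fun x : ℝ => (Real.fourierChar (-(y * x)) : ℂ) * q x) s := by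
    intro s
    rw [Real.fourier_real_eq, Real.fourierInv_eq]
    congr 1
    ext x
    simp only [Circle.smul_def, smul_eq_mul]
    rw [← mul_assoc, ← Circle.coe_mul, ← AddChar.map_add_eq_mul]
    congr 3
    simp
    ring
  have hh : Integrable (𝓕 (h : ℝ → ℂ)) := by
    rw [← SchwartzMap.fourier_coe]; exact (𝓕 h).integrable
  simp_rw [h1, mul_comm (𝓕 (h : ℝ → ℂ) _)]
  rw [integral_fourierInv_mul_comm hG hh, Real.fourier_real_eq]
  congr 1
  ext x
  have h2 : 𝓕⁻ (𝓕 (h : ℝ → ℂ)) x = h x := by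
    rw [← SchwartzMap.fourier_coe, ← SchwartzMap.fourierInv_coe]; simp
  rw [h2, Circle.smul_def, smul_eq_mul, mul_comm x y]
  ring

/-- The bump function on a unit interval, as a Schwartz function. -/
def bumpSchwartz (c : ℝ) : 𝓢(ℝ, ℂ) :=
  ((unitBump c).hasCompactSupport.comp_left (g := fun t : ℝ => (t : ℂ)) (by simp)).toSchwartzMap
    (Complex.ofRealCLM.contDiff.comp (unitBump c).contDiff)

theorem bumpSchwartz_apply (c x : ℝ) : bumpSchwartz c x = (unitBump c x : ℂ) := rfl

/-- The correlation of the bumps on `[0, 1]` and `[2, 3]`. -/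
def bumpCorrelation : 𝓢(ℝ, ℂ) :=
  SchwartzMap.convolution (ContinuousLinearMap.mul ℂ ℂ) (bumpSchwartz (1 / 2))
    (SchwartzMap.compCLMOfContinuousLinearEquiv ℂ (ContinuousLinearEquiv.neg ℝ)
      (bumpSchwartz (5 / 2)))

theorem fourier_bumpCorrelation (y : ℝ) :
    𝓕 (bumpCorrelation : ℝ → ℂ) y = bumpHat (1 / 2) y * conj (bumpHat (5 / 2) y) := by
  rw [← SchwartzMap.fourier_coe, bumpCorrelation, SchwartzMap.fourier_convolution_apply,
    Real.fourier_mul_convolution_eq (SchwartzMap.integrable _) (SchwartzMap.integrable _)]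
  congr 1
  have h := fourier_conj_neg (fun t : ℝ => (unitBump (5 / 2) t : ℂ)) y
  rw [bumpHat, ← h]
  refine congrArg (fun φ : ℝ → ℂ => 𝓕 φ y) (funext fun x => ?_)
  simp [bumpSchwartz_apply]

/-- At `x` the correlation integrates a product of nonnegative bumps that are positive on `(0, 1)`
and `(2 + x, 3 + x)`; these intervals meet when `-3 < x < -1`. -/
theorem bumpCorrelation_ne_zero {x : ℝ} (hx : x ∈ Ioo (-3 : ℝ) (-1)) : bumpCorrelation x ≠ 0 := by
  rw [bumpCorrelation, SchwartzMap.convolution_apply, convolution_def]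
  have h1 : ∀ t : ℝ, (ContinuousLinearMap.mul ℂ ℂ) (bumpSchwartz (1 / 2) t)
      (SchwartzMap.compCLMOfContinuousLinearEquiv ℂ (ContinuousLinearEquiv.neg ℝ)
        (bumpSchwartz (5 / 2)) (x - t)) =
      ((unitBump (1 / 2) t * unitBump (5 / 2) (t - x) : ℝ) : ℂ) := by
    intro t
    simp [bumpSchwartz_apply, -one_div]
  simp_rw [h1]
  rw [integral_complex_ofReal, Complex.ofReal_ne_zero]
  refine ne_of_gt ?_
  have hcont : Continuous (fun t => unitBump (1 / 2) t * unitBump (5 / 2) (t - x)) :=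
    (unitBump (1 / 2)).continuous.mul ((unitBump (5 / 2)).continuous.comp (continuous_sub_right x))
  refine hcont.integral_pos_of_hasCompactSupport_nonneg_nonzero
    ((unitBump (1 / 2)).hasCompactSupport.mul_right)
    (fun t => mul_nonneg (unitBump _).nonneg (unitBump _).nonneg)
    -- The midpoint of the overlap of the two intervals.
    (x := (max 0 (2 + x) + min 1 (3 + x)) / 2) ?_
  refine mul_ne_zero ?_ ?_ <;> rw [unitBump_ne_zero_iff, abs_lt] <;> obtain ⟨h1, h2⟩ := hx <;>
    constructor <;> rcases max_cases 0 (2 + x) with h | h <;>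
    rcases min_cases 1 (3 + x) with h' | h' <;> linarith

/-- The quotient `v / q` is smooth where `q ≠ 0`, and it vanishes identically near every point off
the support of `v`. -/
theorem exists_mul_eq_of_ne_zero {v q : ℝ → ℂ} (hv : ContDiff ℝ ∞ v) (hq : ContDiff ℝ ∞ q)
    (hvc : HasCompactSupport v) (hne : ∀ x ∈ tsupport v, q x ≠ 0) :
    ∃ h : 𝓢(ℝ, ℂ), ∀ x, v x = q x * h x := by
  have hsm : ContDiff ℝ ∞ (fun x => v x / q x) := by
    rw [contDiff_iff_contDiffAt]
    intro x
    by_cases hx : x ∈ tsupport v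
    · simp_rw [div_eq_mul_inv]
      exact hv.contDiffAt.mul (hq.contDiffAt.inv (hne x hx))
    · have : (fun x => v x / q x) =ᶠ[nhds x] fun _ => 0 := by
        filter_upwards [(isClosed_tsupport v).isOpen_compl.mem_nhds hx] with y hy
        rw [image_eq_zero_of_notMem_tsupport hy, zero_div]
      exact contDiffAt_const.congr_of_eventuallyEq this
  have hc : HasCompactSupport (fun x => v x / q x) := by
    refine hvc.mono fun x hx => ?_
    rw [Function.mem_support] at hx ⊢
    exact fun h0 => hx (by rw [h0, zero_div])
  refine ⟨hc.toSchwartzMap hsm, fun x => ?_⟩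
  change v x = q x * (v x / q x)
  by_cases hx : x ∈ tsupport v
  · rw [mul_div_cancel₀ _ (hne x hx)]
  · rw [image_eq_zero_of_notMem_tsupport hx]; simp

/-- The Fourier transform of a smooth function supported in `(-3, -1)` is a superposition of
translates of the kernel of a pair of wave packets. -/
theorem exists_fourier_eq_superposition {v : ℝ → ℂ} (hv : ContDiff ℝ ∞ v)
    (hvc : HasCompactSupport v) (hsupp : tsupport v ⊆ Ioo (-3) (-1)) : ∃ H : 𝓢(ℝ, ℂ), ∀ y,
      𝓕 v y = ∫ s, H s * (bumpHat (1 / 2) (y - s) * conj (bumpHat (5 / 2) (y - s))) := by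
  obtain ⟨h, hh⟩ := exists_mul_eq_of_ne_zero hv (bumpCorrelation.smooth ⊤) hvc
    fun x hx => bumpCorrelation_ne_zero (hsupp hx)
  refine ⟨𝓕 h, fun y => ?_⟩
  rw [show v = fun x => bumpCorrelation x * h x from funext hh, fourier_mul_eq_integral]
  simp_rw [fourier_bumpCorrelation, SchwartzMap.fourier_coe]

end Superposition

/-! ### The form of wave packets as an average of the symbol -/

section KernelForm

open Set

variable {k : ℕ}

theorem integrable_tensor {f : ℝ → ℂ} {g : Euc k → ℂ} (hf : Integrable f) (hg : Integrable g) :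
    Integrable (fun v : TubeModel k => f v.fst * g v.snd) := by
  have := (WithLp.volume_preserving_ofLp ℝ (Euc k)).integrable_comp_of_integrable (hf.mul_prod hg)
  exact this

theorem integral_toLp (F : TubeModel k → ℂ) :
    ∫ v, F v = ∫ z : ℝ × Euc k, F (WithLp.toLp 2 z) :=
  ((WithLp.volume_preserving_toLp ℝ (Euc k)).integral_comp
    (MeasurableEquiv.toLp 2 (ℝ × Euc k)).measurableEmbedding F).symm

theorem continuous_ballWeight : Continuous (ballWeight k) := by
  have hc : Continuous (𝓕 (fun y : Euc k => (ballBump k y : ℂ))) := by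
    have hS : HasCompactSupport (fun y : Euc k => (ballBump k y : ℂ)) :=
      (ballBump k).hasCompactSupport.comp_left (g := fun t : ℝ => (t : ℂ)) (by simp)
    have := (𝓕 (hS.toSchwartzMap
      (Complex.ofRealCLM.contDiff.comp (ballBump k).contDiff) : 𝓢(Euc k, ℂ))).continuous
    rw [SchwartzMap.fourier_coe] at this
    exact this
  exact hc.norm.pow 2

theorem integrable_norm_sq_mul_ballWeight (k : ℕ) :
    Integrable (ballWeight k) ∧ Integrable (fun η => ‖η‖ ^ 2 * ballWeight k η) := by
  have hS : HasCompactSupport (fun y : Euc k => (ballBump k y : ℂ)) :=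
    (ballBump k).hasCompactSupport.comp_left (g := fun t : ℝ => (t : ℂ)) (by simp)
  obtain ⟨S, hS⟩ : ∃ S : 𝓢(Euc k, ℂ), ∀ η, ballWeight k η = ‖S η‖ ^ 2 := by
    refine ⟨𝓕 (hS.toSchwartzMap (Complex.ofRealCLM.contDiff.comp (ballBump k).contDiff)),
      fun η => ?_⟩
    rw [SchwartzMap.fourier_coe]
    rfl
  have hw : ballWeight k = fun η => ‖S η‖ ^ 2 := funext hS
  refine ⟨hw ▸ integrable_norm_sq S, ?_⟩
  have h1 := S.integrable_pow_mul (μ := volume) 2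
  have h2 : Integrable (fun η => ‖S η‖ * (‖η‖ ^ 2 * ‖S η‖)) := by
    refine h1.bdd_mul (c := ‖S.toBoundedContinuousFunction‖) S.continuous.norm.aestronglyMeasurable
      (Filter.Eventually.of_forall fun η => ?_)
    rw [norm_norm]
    exact S.toBoundedContinuousFunction.norm_coe_le_norm η
  refine h2.congr (Filter.Eventually.of_forall fun η => ?_)
  simp only [hS]
  ring

/-- At frequency `0` the transform of the bump is its integral, which is positive. This mass will be
divided out. -/
theorem integral_ballWeight_pos (k : ℕ) : 0 < ∫ η, ballWeight k η := by
  have hnn : 0 ≤ ballWeight k := fun η => sq_nonneg _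
  rw [integral_pos_iff_support_of_nonneg hnn (integrable_norm_sq_mul_ballWeight k).1]
  refine continuous_ballWeight.isOpen_support.measure_pos _ ⟨0, ?_⟩
  have h1 : 𝓕 (fun y : Euc k => (ballBump k y : ℂ)) 0 = ((∫ y, ballBump k y : ℝ) : ℂ) := by
    rw [Real.fourier_eq, ← integral_complex_ofReal]
    simp
  rw [Function.mem_support, ballWeight, h1, Complex.norm_real]
  have := (ballBump k).integral_pos (μ := volume)
  exact (pow_pos (norm_pos_iff.2 this.ne') 2).ne'

/-- The weight across a tube of width `δ`, on the Fourier side; its integral does not depend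
on `δ`. -/
def tubeWeight (k : ℕ) (δ : ℝ) (η : Euc k) : ℝ := δ ^ k * ballWeight k (δ • η)

theorem tubeWeight_nonneg {δ : ℝ} (hδ : 0 < δ) (η : Euc k) : 0 ≤ tubeWeight k δ η := by
  unfold tubeWeight ballWeight
  positivity

theorem continuous_tubeWeight (δ : ℝ) : Continuous (tubeWeight k δ) :=
  continuous_const.mul (continuous_ballWeight.comp (continuous_const_smul δ))

theorem integrable_tubeWeight {δ : ℝ} (hδ : 0 < δ) : Integrable (tubeWeight k δ) :=
  ((integrable_norm_sq_mul_ballWeight k).1.comp_smul hδ.ne').const_mul _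

theorem integral_tubeWeight {δ : ℝ} (hδ : 0 < δ) :
    ∫ η, tubeWeight k δ η = ∫ η, ballWeight k η := by
  unfold tubeWeight
  rw [integral_const_mul, Measure.integral_comp_smul, abs_of_pos (by positivity)]
  simp [hδ.ne']

theorem norm_sq_mul_tubeWeight {δ : ℝ} (hδ : 0 < δ) (η : Euc k) :
    ‖η‖ ^ 2 * tubeWeight k δ η =
      (δ ^ k * (δ ^ 2)⁻¹) * (‖δ • η‖ ^ 2 * ballWeight k (δ • η)) := by
  rw [tubeWeight, norm_smul, Real.norm_of_nonneg hδ.le]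
  field_simp

theorem integrable_norm_sq_mul_tubeWeight {δ : ℝ} (hδ : 0 < δ) :
    Integrable (fun η => ‖η‖ ^ 2 * tubeWeight k δ η) := by
  simp_rw [norm_sq_mul_tubeWeight hδ]
  exact ((integrable_norm_sq_mul_ballWeight k).2.comp_smul hδ.ne').const_mul _

theorem integral_norm_sq_mul_tubeWeight {δ : ℝ} (hδ : 0 < δ) :
    ∫ η, ‖η‖ ^ 2 * tubeWeight k δ η = (δ ^ 2)⁻¹ * ∫ η, ‖η‖ ^ 2 * ballWeight k η := by
  simp_rw [norm_sq_mul_tubeWeight hδ]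
  rw [integral_const_mul, Measure.integral_comp_smul (volume : Measure (Euc k))
    (fun η => ‖η‖ ^ 2 * ballWeight k η), abs_of_pos (by positivity)]
  simp
  field_simp

/-- The form of a radial multiplier on parallel wave packets whose kernel in the direction of the
tube is `Q`. -/
def kernelForm (k : ℕ) (m : ℝ → ℝ) (δ : ℝ) (Q : ℝ → ℂ) (l : ℝ) : ℂ :=
  ∫ ξ : TubeModel k, (m ‖ξ‖ : ℂ) * (Q (ξ.fst - l) * (tubeWeight k δ ξ.snd : ℂ))

theorem kernelForm_eq_integral {m : ℝ → ℝ} (hm : Measurable m) {M : ℝ} (hM : ∀ r, |m r| ≤ M)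
    {δ : ℝ} (hδ : 0 < δ) (Q : 𝓢(ℝ, ℂ)) (l : ℝ) :
    kernelForm k m δ Q l = ∫ η : Euc k,
      (tubeWeight k δ η : ℂ) * ∫ x, (m √(x ^ 2 + ‖η‖ ^ 2) : ℂ) * Q (x - l) := by
  have hint : Integrable (fun ξ : TubeModel k =>
      (m ‖ξ‖ : ℂ) * (Q (ξ.fst - l) * (tubeWeight k δ ξ.snd : ℂ))) :=
    integrable_radial_mul hm hM (integrable_tensor (f := fun x => Q (x - l))
      (Q.integrable.comp_sub_right l) (integrable_tubeWeight hδ).ofReal)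
  have hint' := (WithLp.volume_preserving_toLp ℝ (Euc k)).integrable_comp_of_integrable hint
  rw [Function.comp_def] at hint'
  rw [kernelForm, integral_toLp, Measure.volume_eq_prod, integral_prod_symm _ hint']
  congr 1
  ext η
  rw [← integral_const_mul]
  congr 1
  ext x
  rw [WithLp.prod_norm_eq_of_L2]
  simp only [WithLp.toLp_fst, WithLp.toLp_snd, Real.norm_eq_abs, sq_abs]
  ring

/-- The comparison is applied with `s = ‖η‖` and averaged over `η`. The weight has mass independent
of `δ` and second moment proportional to `δ⁻²`, the origin of the error `1 / (l δ²)`. -/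
theorem exists_norm_kernelForm_sub_le (k : ℕ) (Q : 𝓢(ℝ, ℂ)) : ∃ C : ℝ, 0 ≤ C ∧
    ∀ (m : ℝ → ℝ) (M l δ : ℝ), Measurable m → (∀ r, |m r| ≤ M) → 0 < l → 0 < δ → δ < 1 →
      ‖kernelForm k m δ Q l - ((∫ η, ballWeight k η : ℝ) : ℂ) *
        ∫ u, (m (l * Real.exp (u / l - 1)) : ℂ) * Q (u - l)‖ ≤ C * M / (l * δ ^ 2) := by
  obtain ⟨C, hC, hcomp⟩ := exists_norm_integral_sub_integral_exp_le Q
  set β := ∫ η, ballWeight k η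
  set β₂ := ∫ η, ‖η‖ ^ 2 * ballWeight k η
  have hβ : 0 < β := integral_ballWeight_pos k
  have hβ₂ : 0 ≤ β₂ := integral_nonneg fun η => by unfold ballWeight; positivity
  refine ⟨C * (β + β₂), by positivity, fun m M l δ hm hM hl hδ hδ1 => ?_⟩
  have hM0 : 0 ≤ M := (abs_nonneg _).trans (hM 0)
  set E := ∫ u, (m (l * Real.exp (u / l - 1)) : ℂ) * Q (u - l)
  set D : Euc k → ℂ := fun η => ∫ x, (m √(x ^ 2 + ‖η‖ ^ 2) : ℂ) * Q (x - l) with hD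
  have hDm : AEStronglyMeasurable D := by
    refine AEStronglyMeasurable.integral_prod_right' (μ := volume) (ν := volume)
      (f := fun z : Euc k × ℝ => (m √(z.2 ^ 2 + ‖z.1‖ ^ 2) : ℂ) * Q (z.2 - l)) ?_
    refine Measurable.aestronglyMeasurable ?_
    refine (Complex.measurable_ofReal.comp (hm.comp ?_)).mul ?_
    · exact Continuous.measurable (by fun_prop)
    · exact Continuous.measurable (Q.continuous.comp (by fun_prop))
  have hDint : Integrable (fun η => (tubeWeight k δ η : ℂ) * D η) := by
    refine (integrable_tubeWeight hδ).ofReal.mul_bdd (c := M * ∫ x, ‖Q x‖) hDm ?_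
    exact Filter.Eventually.of_forall fun η =>
      norm_integral_mul_schwartz_sub_le (ψ := fun x => m √(x ^ 2 + ‖η‖ ^ 2)) (fun r => hM _) Q l
  have hβE : (β : ℂ) * E = ∫ η, (tubeWeight k δ η : ℂ) * E := by
    rw [integral_mul_const, integral_complex_ofReal, integral_tubeWeight hδ]
  rw [kernelForm_eq_integral hm hM hδ, hβE]
  change ‖(∫ η, (tubeWeight k δ η : ℂ) * D η) - _‖ ≤ _
  have hwc : Integrable (fun η => (tubeWeight k δ η : ℂ)) := (integrable_tubeWeight hδ).ofReal
  rw [← integral_sub hDint (hwc.mul_const _)]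
  have hbound : ∀ η, ‖(tubeWeight k δ η : ℂ) * D η - (tubeWeight k δ η : ℂ) * E‖ ≤
      C * M / l * (tubeWeight k δ η + ‖η‖ ^ 2 * tubeWeight k δ η) := by
    intro η
    rw [← mul_sub, norm_mul, Complex.norm_real, Real.norm_of_nonneg (tubeWeight_nonneg hδ η)]
    calc _ ≤ tubeWeight k δ η * (C * M * (1 + ‖η‖ ^ 2) / l) :=
          mul_le_mul_of_nonneg_left (hcomp m M l ‖η‖ hm hM hl) (tubeWeight_nonneg hδ η)
      _ = _ := by ring
  refine (norm_integral_le_of_norm_le (((integrable_tubeWeight hδ).add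
    (integrable_norm_sq_mul_tubeWeight hδ)).const_mul (C * M / l))
    (Filter.Eventually.of_forall hbound)).trans ?_
  simp only [Pi.add_apply]
  rw [integral_const_mul, integral_add (integrable_tubeWeight hδ)
    (integrable_norm_sq_mul_tubeWeight hδ), integral_tubeWeight hδ,
    integral_norm_sq_mul_tubeWeight hδ]
  -- As `δ < 1`, the mass term is absorbed into the second moment term.
  have h1 : 1 ≤ (δ ^ 2)⁻¹ := (one_le_inv₀ (by positivity)).2 (by nlinarith)
  calc C * M / l * (β + (δ ^ 2)⁻¹ * β₂) ≤ C * M / l * ((δ ^ 2)⁻¹ * β + (δ ^ 2)⁻¹ * β₂) := by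
        gcongr
        nlinarith
    _ = _ := by field_simp

/-- Translating the kernel changes only the modulation frequency, so a bound uniform in the
frequency passes to superpositions. -/
theorem kernelForm_superposition {m : ℝ → ℝ} (hm : Measurable m) {M : ℝ} (hM : ∀ r, |m r| ≤ M)
    {δ : ℝ} (hδ : 0 < δ) (H Q₀ : 𝓢(ℝ, ℂ)) (l : ℝ) :
    kernelForm k m δ (fun y => ∫ s, H s * Q₀ (y - s)) l =
      ∫ s, H s * kernelForm k m δ Q₀ (l + s) := by
  have htens : ∀ s, Integrable (fun ξ : TubeModel k =>
      Q₀ (ξ.fst - (l + s)) * (tubeWeight k δ ξ.snd : ℂ)) := fun s =>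
    integrable_tensor (f := fun x => Q₀ (x - (l + s))) (Q₀.integrable.comp_sub_right _)
      (integrable_tubeWeight hδ).ofReal
  set G : TubeModel k × ℝ → ℂ := fun z =>
    H z.2 * (Q₀ (z.1.fst - (l + z.2)) * (tubeWeight k δ z.1.snd : ℂ)) with hG
  have hfst : Continuous (fun z : TubeModel k × ℝ => z.1.fst) :=
    (continuous_fst.comp (WithLp.prodContinuousLinearEquiv 2 ℝ ℝ (Euc k)).continuous).comp
      continuous_fst
  have hsnd : Continuous (fun z : TubeModel k × ℝ => z.1.snd) :=
    (continuous_snd.comp (WithLp.prodContinuousLinearEquiv 2 ℝ ℝ (Euc k)).continuous).comp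
      continuous_fst
  have hGc : Continuous G := by
    refine (H.continuous.comp continuous_snd).mul ((Q₀.continuous.comp ?_).mul
      (Complex.continuous_ofReal.comp ((continuous_tubeWeight δ).comp hsnd)))
    exact hfst.sub (continuous_const.add continuous_snd)
  have hnorm : ∀ s, ∫ ξ : TubeModel k, ‖G (ξ, s)‖ =
      ‖H s‖ * ‖∫ ξ : TubeModel k, ((‖Q₀ ξ.fst‖ : ℝ) : ℂ) * (tubeWeight k δ ξ.snd : ℂ)‖ := by
    intro s
    have e1 : ∫ ξ : TubeModel k, ((‖Q₀ ξ.fst‖ : ℝ) : ℂ) * (tubeWeight k δ ξ.snd : ℂ) =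
        ∫ ξ : TubeModel k, ((‖Q₀ (ξ.fst - (l + s))‖ : ℝ) : ℂ) * (tubeWeight k δ ξ.snd : ℂ) := by
      rw [integral_toLp, integral_toLp, Measure.volume_eq_prod]
      simp only [WithLp.toLp_fst, WithLp.toLp_snd]
      rw [integral_prod_mul (fun x : ℝ => ((‖Q₀ x‖ : ℝ) : ℂ)) (fun η => (tubeWeight k δ η : ℂ)),
        integral_prod_mul (fun x : ℝ => ((‖Q₀ (x - (l + s))‖ : ℝ) : ℂ))
          (fun η => (tubeWeight k δ η : ℂ)),
        integral_sub_right_eq_self (fun x : ℝ => ((‖Q₀ x‖ : ℝ) : ℂ))]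
    rw [e1]
    have e2 : ∀ ξ : TubeModel k, ((‖Q₀ (ξ.fst - (l + s))‖ : ℝ) : ℂ) * (tubeWeight k δ ξ.snd : ℂ) =
        ((‖Q₀ (ξ.fst - (l + s)) * (tubeWeight k δ ξ.snd : ℂ)‖ : ℝ) : ℂ) := by
      intro ξ
      rw [norm_mul, Complex.norm_real, Real.norm_of_nonneg (tubeWeight_nonneg hδ _)]
      push_cast
      rfl
    simp_rw [e2]
    rw [integral_complex_ofReal, Complex.norm_real,
      Real.norm_of_nonneg (integral_nonneg fun _ => norm_nonneg _), ← integral_const_mul]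
    simp only [hG, norm_mul]
  have hGint : Integrable G (volume.prod volume) := by
    rw [integrable_prod_iff' hGc.aestronglyMeasurable]
    refine ⟨Filter.Eventually.of_forall fun s => (htens s).const_mul (H s), ?_⟩
    simp_rw [hnorm]
    exact H.integrable.norm.mul_const _
  have hmG : Integrable (fun z : TubeModel k × ℝ => (m ‖z.1‖ : ℂ) * G z) (volume.prod volume) := by
    refine hGint.bdd_mul (c := M) ?_ (Filter.Eventually.of_forall fun z => by simpa using hM _)
    exact (Complex.measurable_ofReal.comp
      (hm.comp (measurable_norm.comp measurable_fst))).aestronglyMeasurable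
  calc kernelForm k m δ (fun y => ∫ s, H s * Q₀ (y - s)) l
      = ∫ ξ : TubeModel k, ∫ s, (m ‖ξ‖ : ℂ) * G (ξ, s) := by
        unfold kernelForm
        congr 1
        ext ξ
        rw [integral_const_mul, ← integral_mul_const]
        congr 2
        ext s
        simp only [hG, sub_sub]
        ring
    _ = ∫ s, ∫ ξ : TubeModel k, (m ‖ξ‖ : ℂ) * G (ξ, s) := integral_integral_swap hmG
    _ = _ := by
        congr 1
        ext s
        rw [kernelForm, ← integral_const_mul]
        congr 1
        ext ξ
        simp only [hG]
        ring

/-- The kernel of a pair of wave packets. -/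
def bumpKernel : 𝓢(ℝ, ℂ) := 𝓕 bumpCorrelation

theorem bumpKernel_apply (y : ℝ) :
    bumpKernel y = bumpHat (1 / 2) y * conj (bumpHat (5 / 2) y) := by
  rw [bumpKernel, SchwartzMap.fourier_coe, fourier_bumpCorrelation]

/-- The factor `δ^k` in the volume of the tube cancels the one in the form of the packets, which
leaves a bound uniform in `δ` and in the frequency `μ`. -/
theorem norm_kernelForm_bumpKernel_le {δ ε : ℝ} (hδ : 0 < δ)
    (hε : IsTubeCompression (k + 1) δ ε) {m : ℝ → ℝ} (hm : Measurable m)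
    {M : ℝ} (hM : ∀ r, |m r| ≤ M) {p q : ℝ≥0∞} (hp1 : 1 ≤ p) (hp : p ≤ 2) (hq : q ≠ ⊤)
    (hpq : p.HolderConjugate q) {A : ℝ} (hA : 0 ≤ A)
    (h : HasRadialFormBound (Euc (k + 1)) m p q A) (μ : ℝ) :
    ‖kernelForm k m δ bumpKernel μ‖ ≤ A * ε ^ (1 / p.toReal - 1 / 2) * tubeVolume k 1 := by
  have h1 := norm_radialForm_le_of_isTubeCompression hδ hε hm hM hp1 hp hq hpq hA h
    (wavePacket k hδ μ (1 / 2)) (wavePacket k hδ μ (5 / 2)) (norm_wavePacket_le k hδ μ _)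
    (norm_wavePacket_le k hδ μ _)
    (fun x hx => by
      have := wavePacket_eq_zero k hδ μ (a := 0) (v := x) (by rwa [zero_add])
      rwa [zero_add] at this)
    (fun x hx => by
      have := wavePacket_eq_zero k hδ μ (a := 2) (v := x) (by norm_num; exact hx)
      norm_num at this
      exact this)
  have h2 : radialForm m (wavePacket k hδ μ (1 / 2) : TubeModel k → ℂ)
      (wavePacket k hδ μ (5 / 2)) = (δ ^ k : ℝ) * kernelForm k m δ bumpKernel μ := by
    rw [radialForm_wavePacket, kernelForm]
    congr 2
    ext ξ
    rw [bumpKernel_apply, tubeWeight]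
    ring
  rw [h2, norm_mul, Complex.norm_real, Real.norm_of_nonneg (by positivity)] at h1
  have h3 : tubeVolume k δ = δ ^ k * tubeVolume k 1 := by simp [tubeVolume]
  rw [h3] at h1
  exact le_of_mul_le_mul_left (h1.trans (le_of_eq (by ring))) (by positivity : 0 < δ ^ k)

/-- The form with kernel `𝓕 v` is small by superposition of wave packets, and it is close to `∫
ballWeight` times the average in question. -/
theorem exists_norm_integral_exp_mul_fourier_le (k : ℕ) {v : ℝ → ℂ} (hv : ContDiff ℝ ∞ v)
    (hvc : HasCompactSupport v) (hsupp : tsupport v ⊆ Ioo (-3) (-1)) : ∃ C : ℝ, 0 ≤ C ∧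
    ∀ (δ ε : ℝ), 0 < δ → δ < 1 → IsTubeCompression (k + 1) δ ε →
    ∀ (m : ℝ → ℝ) (M : ℝ), Measurable m → (∀ r, |m r| ≤ M) →
    ∀ (p q : ℝ≥0∞), 1 ≤ p → p ≤ 2 → q ≠ ⊤ → p.HolderConjugate q →
    ∀ A : ℝ, 0 ≤ A → HasRadialFormBound (Euc (k + 1)) m p q A → ∀ l : ℝ, 0 < l →
      ‖∫ u, (m (l * Real.exp (u / l - 1)) : ℂ) * 𝓕 v (u - l)‖ ≤
        C * (A * ε ^ (1 / p.toReal - 1 / 2) + M / (l * δ ^ 2)) := by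
  obtain ⟨Q, hQ⟩ : ∃ Q : 𝓢(ℝ, ℂ), ∀ y, Q y = 𝓕 v y :=
    ⟨𝓕 (hvc.toSchwartzMap hv), fun y => by rw [SchwartzMap.fourier_coe]; rfl⟩
  obtain ⟨H, hH⟩ := exists_fourier_eq_superposition hv hvc hsupp
  obtain ⟨C, hC, hcomp⟩ := exists_norm_kernelForm_sub_le k Q
  set β := ∫ η, ballWeight k η
  have hβ : 0 < β := integral_ballWeight_pos k
  set N := ∫ s, ‖H s‖
  have hN : 0 ≤ N := by positivity
  have hvol := tubeVolume_pos k one_pos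
  refine ⟨β⁻¹ * (C + N * tubeVolume k 1), by positivity,
    fun δ ε hδ hδ1 hε m M hm hM p q hp1 hp hq hpq A hA h l hl => ?_⟩
  have hM0 : 0 ≤ M := (abs_nonneg _).trans (hM 0)
  have hε0 : 0 < ε := hε.1
  simp_rw [← hQ]
  set E := ∫ u, (m (l * Real.exp (u / l - 1)) : ℂ) * Q (u - l)
  set a := 1 / p.toReal - 1 / 2
  have h1 : ‖kernelForm k m δ Q l‖ ≤ N * (A * ε ^ a * tubeVolume k 1) := by
    have e : (Q : ℝ → ℂ) = fun y => ∫ s, H s * bumpKernel (y - s) := by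
      ext y
      rw [hQ, hH]
      simp_rw [bumpKernel_apply]
    rw [e, kernelForm_superposition hm hM hδ, ← integral_mul_const]
    refine norm_integral_le_of_norm_le (H.integrable.norm.mul_const _)
      (Filter.Eventually.of_forall fun s => ?_)
    rw [norm_mul]
    gcongr
    exact norm_kernelForm_bumpKernel_le hδ hε hm hM hp1 hp hq hpq hA h _
  have h2 := hcomp m M l δ hm hM hl hδ hδ1
  have h3 : β * ‖E‖ ≤ N * (A * ε ^ a * tubeVolume k 1) + C * M / (l * δ ^ 2) := by
    calc β * ‖E‖ = ‖(β : ℂ) * E‖ := by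
          rw [norm_mul, Complex.norm_real, Real.norm_of_nonneg hβ.le]
      _ ≤ ‖kernelForm k m δ Q l‖ + ‖kernelForm k m δ Q l - (β : ℂ) * E‖ := norm_le_insert _ _
      _ ≤ _ := add_le_add h1 h2
  rw [mul_assoc, ← div_eq_inv_mul, le_div_iff₀ hβ, mul_comm]
  refine h3.trans ?_
  have h4 : 0 ≤ A * ε ^ a := by positivity
  have h5 : 0 ≤ M / (l * δ ^ 2) := by positivity
  have h6 : C * M / (l * δ ^ 2) = C * (M / (l * δ ^ 2)) := by ring
  rw [h6]
  nlinarith [mul_nonneg hC h4, mul_nonneg (mul_nonneg hN hvol.le) h5]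

end KernelForm

/-! ### From the model interval to the dyadic shell -/

section DilatedAverage

open Set

/-- The average of `φ` around `t` at scale `1 / L` against the kernel with Fourier transform `v`. -/
def dilatedAverage (v : ℝ → ℂ) (φ : ℝ → ℝ) (L t : ℝ) : ℂ :=
  ∫ s, 𝓕⁻ v s * (φ (t - s / L) : ℂ)

/-- The averages of `s ↦ m (exp s)` against the kernel with Fourier transform `v` are controlled by
the norm of the radial multiplier `m` and by the compression of tubes in `ℝ^{k+1}`. -/
def HasTubeBound (k : ℕ) (v : ℝ → ℂ) : Prop :=
  ∃ C : ℝ, 0 ≤ C ∧ ∀ (δ ε : ℝ), 0 < δ → δ < 1 → IsTubeCompression (k + 1) δ ε →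
    ∀ (m : ℝ → ℝ) (M : ℝ), Measurable m → (∀ r, |m r| ≤ M) →
    ∀ (p q : ℝ≥0∞), 1 ≤ p → p ≤ 2 → q ≠ ⊤ → p.HolderConjugate q →
    ∀ A : ℝ, 0 ≤ A → HasRadialFormBound (Euc (k + 1)) m p q A → ∀ L t : ℝ, 0 < L →
      ‖dilatedAverage v (fun s => m (Real.exp s)) L t‖ ≤
        C * (A * ε ^ (1 / p.toReal - 1 / 2) + M / (L * δ ^ 2))

/-- With `s = L - u`, translating `φ` by `t` amounts to dilating `m` by `exp t / L`, and the form
bound is invariant under dilations. -/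
theorem dilatedAverage_eq_integral_exp (v : ℝ → ℂ) (m : ℝ → ℝ) {L : ℝ} (hL : 0 < L) (t : ℝ) :
    dilatedAverage v (fun s => m (Real.exp s)) L t =
      ∫ u, (m (Real.exp t / L * (L * Real.exp (u / L - 1))) : ℂ) * 𝓕 v (u - L) := by
  rw [dilatedAverage, ← integral_sub_left_eq_self _ _ L]
  congr 1
  ext u
  rw [Real.fourierInv_eq_fourier_neg, neg_sub, mul_comm]
  congr 3
  rw [div_mul_eq_mul_div, mul_div_assoc, mul_div_cancel_left₀ _ hL.ne', ← Real.exp_add]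
  congr 1
  field_simp
  ring

theorem hasTubeBound_of_tsupport_subset (k : ℕ) {v : ℝ → ℂ} (hv : ContDiff ℝ ∞ v)
    (hvc : HasCompactSupport v) (hsupp : tsupport v ⊆ Ioo (-3) (-1)) : HasTubeBound k v := by
  obtain ⟨C, hC, h⟩ := exists_norm_integral_exp_mul_fourier_le k hv hvc hsupp
  refine ⟨C, hC, fun δ ε hδ hδ1 hε m M hm hM p q hp1 hp hq hpq A hA hform L t hL => ?_⟩
  rw [dilatedAverage_eq_integral_exp v m hL]
  have hpt : p ≠ ⊤ := (hp.trans_lt (by simp)).ne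
  have hc : 0 < Real.exp t / L := by positivity
  exact h δ ε hδ hδ1 hε (fun r => m (Real.exp t / L * r)) M (hm.comp (measurable_const_mul _))
    (fun r => hM _) p q hp1 hp hq hpq A hA (hform.dilate hpt hq hpq hc) L hL

theorem fourierInv_comp_mul (v : ℝ → ℂ) {κ : ℝ} (hκ : 0 < κ) (s : ℝ) :
    𝓕⁻ (fun x => v (κ * x)) s = (κ⁻¹ : ℝ) * 𝓕⁻ v (κ⁻¹ * s) := by
  have := fourier_comp_smul v hκ (-s)
  simp only [smul_eq_mul, Module.finrank_self, pow_one] at this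
  rw [Real.fourierInv_eq_fourier_neg, Real.fourierInv_eq_fourier_neg, this, Complex.real_smul,
    mul_neg]

theorem dilatedAverage_comp_mul (v : ℝ → ℂ) (φ : ℝ → ℝ) {κ : ℝ} (hκ : 0 < κ) (L t : ℝ) :
    dilatedAverage (fun x => v (κ * x)) φ (κ * L) t = dilatedAverage v φ L t := by
  unfold dilatedAverage
  have h := Measure.integral_comp_mul_left (fun s => 𝓕⁻ v s * (φ (t - s / L) : ℂ)) κ⁻¹
  rw [inv_inv, abs_of_pos hκ] at h
  calc _ = ∫ s, (κ⁻¹ : ℂ) * (𝓕⁻ v (κ⁻¹ * s) * (φ (t - κ⁻¹ * s / L) : ℂ)) := by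
        congr 1
        ext s
        rw [fourierInv_comp_mul v hκ]
        have : s / (κ * L) = κ⁻¹ * s / L := by field_simp
        rw [this]
        push_cast
        ring
    _ = _ := by
        rw [integral_const_mul, h, Complex.real_smul, inv_mul_cancel_left₀]
        exact_mod_cast hκ.ne'

theorem HasTubeBound.comp_mul {k : ℕ} {v : ℝ → ℂ} {κ : ℝ} (hκ : 0 < κ)
    (h : HasTubeBound k (fun x => v (κ * x))) : HasTubeBound k v := by
  obtain ⟨C, hC, h⟩ := h
  -- Passing from `κ * L` to `L` multiplies the error term by `κ⁻¹` and leaves the main term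
  -- unchanged.
  refine ⟨C * (1 + κ⁻¹), by positivity,
    fun δ ε hδ hδ1 hε m M hm hM p q hp1 hp hq hpq A hA hform L t hL => ?_⟩
  have hM0 : 0 ≤ M := (abs_nonneg _).trans (hM 0)
  have hε0 := hε.1
  have := h δ ε hδ hδ1 hε m M hm hM p q hp1 hp hq hpq A hA hform (κ * L) t (by positivity)
  rw [dilatedAverage_comp_mul v _ hκ] at this
  refine this.trans ?_
  have h1 : 0 ≤ A * ε ^ (1 / p.toReal - 1 / 2) := by positivity
  have h2 : 0 ≤ M / (L * δ ^ 2) := by positivity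
  have h3 : M / (κ * L * δ ^ 2) = κ⁻¹ * (M / (L * δ ^ 2)) := by field_simp
  rw [h3, mul_assoc]
  gcongr
  have h4 : 0 ≤ κ⁻¹ := by positivity
  nlinarith [mul_nonneg h4 h1]

/-- Since `φ` is real, reflecting and conjugating `v` conjugates the average. This transfers bounds
from negative to positive frequencies. -/
theorem dilatedAverage_conj_neg (v : ℝ → ℂ) (φ : ℝ → ℝ) (L t : ℝ) :
    dilatedAverage (fun x => conj (v (-x))) φ L t = conj (dilatedAverage v φ L t) := by
  unfold dilatedAverage
  rw [← integral_conj]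
  congr 1
  ext s
  rw [Real.fourierInv_eq_fourier_neg, fourier_conj_neg, Real.fourierInv_eq_fourier_neg v]
  simp

theorem HasTubeBound.of_conj_neg {k : ℕ} {v : ℝ → ℂ}
    (h : HasTubeBound k (fun x => conj (v (-x)))) : HasTubeBound k v := by
  obtain ⟨C, hC, h⟩ := h
  refine ⟨C, hC, fun δ ε hδ hδ1 hε m M hm hM p q hp1 hp hq hpq A hA hform L t hL => ?_⟩
  have := h δ ε hδ hδ1 hε m M hm hM p q hp1 hp hq hpq A hA hform L t hL
  rwa [dilatedAverage_conj_neg, RCLike.norm_conj] at this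

theorem integrable_fourierInv {v : ℝ → ℂ} (hv : ContDiff ℝ ∞ v) (hvc : HasCompactSupport v) :
    Integrable (𝓕⁻ v) := by
  have := (𝓕⁻ (hvc.toSchwartzMap hv) : 𝓢(ℝ, ℂ)).integrable (μ := volume)
  rw [SchwartzMap.fourierInv_coe] at this
  exact this

theorem integrable_fourierInv_mul {v : ℝ → ℂ} (hv : ContDiff ℝ ∞ v) (hvc : HasCompactSupport v)
    {φ : ℝ → ℝ} (hφ : Measurable φ) {M : ℝ} (hM : ∀ s, |φ s| ≤ M) :
    Integrable (fun s => 𝓕⁻ v s * (φ s : ℂ)) :=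
  (integrable_fourierInv hv hvc).mul_bdd (c := M)
    (Complex.measurable_ofReal.comp hφ).aestronglyMeasurable
    (Filter.Eventually.of_forall fun s => by simpa using hM s)

theorem dilatedAverage_add {v w : ℝ → ℂ} (hv : ContDiff ℝ ∞ v) (hvc : HasCompactSupport v)
    (hw : ContDiff ℝ ∞ w) (hwc : HasCompactSupport w) {φ : ℝ → ℝ} (hφ : Measurable φ) {M : ℝ}
    (hM : ∀ s, |φ s| ≤ M) (L t : ℝ) :
    dilatedAverage (fun x => v x + w x) φ L t =
      dilatedAverage v φ L t + dilatedAverage w φ L t := by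
  unfold dilatedAverage
  have hφ' : Measurable (fun s => φ (t - s / L)) := hφ.comp (by fun_prop)
  rw [← integral_add (integrable_fourierInv_mul hv hvc hφ' fun s => hM _)
    (integrable_fourierInv_mul hw hwc hφ' fun s => hM _)]
  congr 1
  ext s
  rw [← add_mul]
  congr 1
  rw [Real.fourierInv_eq, Real.fourierInv_eq, Real.fourierInv_eq, ← integral_add]
  · simp
  · exact (hv.continuous.integrable_of_hasCompactSupport hvc).mono
      (Continuous.aestronglyMeasurable (by have := hv.continuous; fun_prop))
      (Filter.Eventually.of_forall fun x => by simp [Circle.norm_smul])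
  · exact (hw.continuous.integrable_of_hasCompactSupport hwc).mono
      (Continuous.aestronglyMeasurable (by have := hw.continuous; fun_prop))
      (Filter.Eventually.of_forall fun x => by simp [Circle.norm_smul])

theorem HasTubeBound.add {k : ℕ} {v w : ℝ → ℂ} (hv : ContDiff ℝ ∞ v) (hvc : HasCompactSupport v)
    (hw : ContDiff ℝ ∞ w) (hwc : HasCompactSupport w) (h₁ : HasTubeBound k v)
    (h₂ : HasTubeBound k w) : HasTubeBound k (fun x => v x + w x) := by
  obtain ⟨C₁, hC₁, h₁⟩ := h₁
  obtain ⟨C₂, hC₂, h₂⟩ := h₂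
  refine ⟨C₁ + C₂, by positivity,
    fun δ ε hδ hδ1 hε m M hm hM p q hp1 hp hq hpq A hA hform L t hL => ?_⟩
  rw [dilatedAverage_add hv hvc hw hwc (φ := fun s => m (Real.exp s)) (hm.comp Real.measurable_exp) fun s => hM _, add_mul]
  exact (norm_add_le _ _).trans (add_le_add
    (h₁ δ ε hδ hδ1 hε m M hm hM p q hp1 hp hq hpq A hA hform L t hL)
    (h₂ δ ε hδ hδ1 hε m M hm hM p q hp1 hp hq hpq A hA hform L t hL))

/-- Dilation by `κ` brings the support into the model interval `(-3, -1)`, which is possible for an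
interval whose endpoints have ratio less than `3`. -/
theorem hasTubeBound_of_support_subset_neg (k : ℕ) {v : ℝ → ℂ} (hv : ContDiff ℝ ∞ v)
    {κ a b : ℝ} (hκ : 0 < κ) (ha : κ < a) (hb : b < 3 * κ)
    (hsupp : ∀ x, v x ≠ 0 → x ∈ Icc (-b) (-a)) : HasTubeBound k v := by
  refine HasTubeBound.comp_mul hκ ?_
  have hsub : tsupport (fun x => v (κ * x)) ⊆ Icc (-(b / κ)) (-(a / κ)) := by
    refine closure_minimal (fun x hx => ?_) isClosed_Icc
    obtain ⟨h1, h2⟩ := hsupp _ hx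
    rw [← neg_div, ← neg_div]
    exact ⟨(div_le_iff₀ hκ).2 (by linarith), (le_div_iff₀ hκ).2 (by linarith)⟩
  refine hasTubeBound_of_tsupport_subset k (hv.comp (contDiff_const.mul contDiff_id))
    (IsCompact.of_isClosed_subset isCompact_Icc (isClosed_tsupport _) hsub) (hsub.trans ?_)
  refine fun x hx => ⟨lt_of_lt_of_le ?_ hx.1, lt_of_le_of_lt hx.2 ?_⟩
  · rw [neg_lt_neg_iff, div_lt_iff₀ hκ]; exact hb
  · rw [neg_lt_neg_iff, lt_div_iff₀ hκ]; linarith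

theorem hasTubeBound_of_support_subset_pos (k : ℕ) {v : ℝ → ℂ} (hv : ContDiff ℝ ∞ v)
    {κ a b : ℝ} (hκ : 0 < κ) (ha : κ < a) (hb : b < 3 * κ)
    (hsupp : ∀ x, v x ≠ 0 → x ∈ Icc a b) : HasTubeBound k v := by
  refine HasTubeBound.of_conj_neg (hasTubeBound_of_support_subset_neg k ?_ hκ ha hb fun x hx => ?_)
  · exact Complex.conjCLE.contDiff.comp (hv.comp contDiff_neg)
  · have := hsupp (-x) (fun h => hx (by rw [h, map_zero]))
    exact ⟨by linarith [this.2], by linarith [this.1]⟩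

theorem hasCompactSupport_of_ne_zero_abs_le {v : ℝ → ℂ} {R : ℝ} (h : ∀ x, v x ≠ 0 → |x| ≤ R) :
    HasCompactSupport v := by
  refine HasCompactSupport.intro (isCompact_Icc (a := -R) (b := R)) fun x hx => ?_
  by_contra hne
  exact hx (abs_le.1 (h x hne))

/-- The tube bound for every smooth function supported in `1/2 ≤ |x| ≤ 2`. -/
theorem hasTubeBound_of_dyadic (k : ℕ) {v : ℝ → ℂ} (hv : ContDiff ℝ ∞ v)
    (hsupp : ∀ x, v x ≠ 0 → 1 / 2 ≤ |x| ∧ |x| ≤ 2) : HasTubeBound k v := by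
  -- The interval `[1/2, 2]` has ratio `4`, too large for one dilate of `(1, 3)`. The cutoff `η`
  -- separates `|x| ≥ 1` from `|x| ≤ 1.45` (as `√2 < 1.45`), and `ρ` separates the signs. The values
  -- of `κ` below are chosen with `[1, 2] ⊂ (0.9, 2.7)` and `[0.5, 1.45] ⊂ (0.49, 1.47)`.
  set η : ℝ → ℂ := fun x => ((Real.smoothTransition (x ^ 2 - 1) : ℝ) : ℂ) with hη
  set ρ : ℝ → ℂ := fun x => ((Real.smoothTransition (2 * x) : ℝ) : ℂ) with hρ
  have hηs : ContDiff ℝ ∞ η := Complex.ofRealCLM.contDiff.comp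
    (Real.smoothTransition.contDiff.comp ((contDiff_id.pow 2).sub contDiff_const))
  have hρs : ContDiff ℝ ∞ ρ := Complex.ofRealCLM.contDiff.comp
    (Real.smoothTransition.contDiff.comp (contDiff_const.mul contDiff_id))
  have hη0 : ∀ x, η x ≠ 0 → 1 ≤ |x| := by
    intro x hx
    by_contra hlt
    push Not at hlt
    refine hx ?_
    have : x ^ 2 - 1 ≤ 0 := by rw [← sq_abs]; nlinarith [abs_nonneg x]
    simp [hη, Real.smoothTransition.zero_of_nonpos this]
  have hη1 : ∀ x, 1 - η x ≠ 0 → |x| ≤ 145 / 100 := by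
    intro x hx
    by_contra hlt
    push Not at hlt
    refine hx ?_
    have : 1 ≤ x ^ 2 - 1 := by rw [← sq_abs]; nlinarith [abs_nonneg x]
    simp [hη, Real.smoothTransition.one_of_one_le this]
  have hρ0 : ∀ x, ρ x ≠ 0 → 0 < x := by
    intro x hx
    by_contra hlt
    push Not at hlt
    exact hx (by simp [hρ, Real.smoothTransition.zero_of_nonpos (show 2 * x ≤ 0 by linarith)])
  have hρ1 : ∀ x, 1 / 2 ≤ |x| → 1 - ρ x ≠ 0 → x < 0 := by
    intro x hx hne
    by_contra hlt
    push Not at hlt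
    rw [abs_of_nonneg hlt] at hx
    exact hne (by simp [hρ, Real.smoothTransition.one_of_one_le (show 1 ≤ 2 * x by linarith)])
  have hone : ContDiff ℝ ∞ (fun _ : ℝ => (1 : ℂ)) := contDiff_const
  have s1 := (hv.mul hηs).mul hρs
  have s2 := (hv.mul hηs).mul (hone.sub hρs)
  have s3 := (hv.mul (hone.sub hηs)).mul hρs
  have s4 := (hv.mul (hone.sub hηs)).mul (hone.sub hρs)
  have b1 : HasTubeBound k (fun x => v x * η x * ρ x) := by
    refine hasTubeBound_of_support_subset_pos k s1 (κ := 9 / 10) (a := 1) (b := 2) (by norm_num)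
      (by norm_num) (by norm_num) fun x hx => ?_
    simp only [mul_ne_zero_iff] at hx
    have h0 := hρ0 x hx.2
    have h1 := hη0 x hx.1.2
    have h2 := hsupp x hx.1.1
    rw [abs_of_pos h0] at h1 h2
    exact ⟨h1, h2.2⟩
  have b2 : HasTubeBound k (fun x => v x * η x * (1 - ρ x)) := by
    refine hasTubeBound_of_support_subset_neg k s2 (κ := 9 / 10) (a := 1) (b := 2) (by norm_num)
      (by norm_num) (by norm_num) fun x hx => ?_
    simp only [mul_ne_zero_iff] at hx
    have h2 := hsupp x hx.1.1
    have h0 := hρ1 x h2.1 hx.2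
    have h1 := hη0 x hx.1.2
    rw [abs_of_neg h0] at h1 h2
    exact ⟨by linarith, by linarith⟩
  have b3 : HasTubeBound k (fun x => v x * (1 - η x) * ρ x) := by
    refine hasTubeBound_of_support_subset_pos k s3 (κ := 49 / 100) (a := 1 / 2) (b := 145 / 100)
      (by norm_num) (by norm_num) (by norm_num) fun x hx => ?_
    simp only [mul_ne_zero_iff] at hx
    have h0 := hρ0 x hx.2
    have h1 := hη1 x hx.1.2
    have h2 := hsupp x hx.1.1
    rw [abs_of_pos h0] at h1 h2
    exact ⟨h2.1, h1⟩
  have b4 : HasTubeBound k (fun x => v x * (1 - η x) * (1 - ρ x)) := by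
    refine hasTubeBound_of_support_subset_neg k s4 (κ := 49 / 100) (a := 1 / 2) (b := 145 / 100)
      (by norm_num) (by norm_num) (by norm_num) fun x hx => ?_
    simp only [mul_ne_zero_iff] at hx
    have h2 := hsupp x hx.1.1
    have h0 := hρ1 x h2.1 hx.2
    have h1 := hη1 x hx.1.2
    rw [abs_of_neg h0] at h1 h2
    exact ⟨by linarith, by linarith⟩
  have hvc : HasCompactSupport v := hasCompactSupport_of_ne_zero_abs_le fun x hx => (hsupp x hx).2
  have c1 : HasCompactSupport (fun x => v x * η x * ρ x) := hvc.mul_right.mul_right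
  have c2 : HasCompactSupport (fun x => v x * η x * (1 - ρ x)) := hvc.mul_right.mul_right
  have c3 : HasCompactSupport (fun x => v x * (1 - η x) * ρ x) := hvc.mul_right.mul_right
  have c4 : HasCompactSupport (fun x => v x * (1 - η x) * (1 - ρ x)) := hvc.mul_right.mul_right
  have b12 := HasTubeBound.add s1 c1 s2 c2 b1 b2
  have b34 := HasTubeBound.add s3 c3 s4 c4 b3 b4
  have b := HasTubeBound.add (s1.add s2) (c1.add c2) (s3.add s4) (c3.add c4) b12 b34
  convert! b using 2 with x
  ring

end DilatedAverage

/-! ### Normalising the symbol and all exponents -/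

section Reduction

open Set Filter

/-- The logarithm is differentiable on the exceptional set, which consists of positive numbers, so
it maps that null set to a null set. -/
theorem ae_comp_exp {P : ℝ → Prop} (h : ∀ᵐ r : ℝ, 0 < r → P r) : ∀ᵐ s : ℝ, P (Real.exp s) := by
  rw [ae_iff] at h ⊢
  set N : Set ℝ := {r | ¬ (0 < r → P r)} with hN
  have himg : volume (Real.log '' N) = 0 := by
    refine addHaar_image_eq_zero_of_differentiableOn_of_addHaar_eq_zero volume (fun x hx => ?_) h
    have hx0 : 0 < x := by
      by_contra hn
      exact hx fun h0 => absurd h0 hn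
    exact (Real.differentiableAt_log hx0.ne').differentiableWithinAt
  refine measure_mono_null (fun s hs => ?_) himg
  exact ⟨Real.exp s, fun hc => hs (hc (Real.exp_pos s)), Real.log_exp s⟩

theorem measurable_indicator_Ioi {m : ℝ → ℝ} (hm : IsBoundedMeasurableOnPos m) :
    Measurable ((Ioi (0 : ℝ)).indicator m) := by
  refine measurable_of_restrict_of_restrict_compl (measurableSet_Ioi : MeasurableSet (Ioi (0 : ℝ))) ?_ ?_
  · convert hm.1 using 1
    ext r
    exact indicator_of_mem r.2 m
  · convert measurable_const (a := (0 : ℝ)) using 1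
    ext r
    exact indicator_of_notMem r.2 m

/-- In dimension at least one the origin is a null set, so the values of the symbol off the positive
half-line do not matter. -/
theorem IsRadialMultiplier.congr_pos {d : ℕ} (hd : 1 ≤ d) {p : ℝ≥0∞} [Fact (1 ≤ p)] {m m' : ℝ → ℝ}
    {T : Lp ℂ p (volume : Measure (Euc d)) →L[ℂ] Lp ℂ p (volume : Measure (Euc d))}
    (hT : IsRadialMultiplier m T) (h : ∀ r, 0 < r → m' r = m r) : IsRadialMultiplier m' T := by
  intro f
  have hd' : Nonempty (Fin d) := ⟨⟨0, hd⟩⟩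
  have : 𝓕⁻ (fun ξ : Euc d => (m' ‖ξ‖ : ℂ) * 𝓕 (f : Euc d → ℂ) ξ) =
      𝓕⁻ (fun ξ : Euc d => (m ‖ξ‖ : ℂ) * 𝓕 (f : Euc d → ℂ) ξ) := by
    ext x
    refine Real.fourierInv_congr_ae ?_ x
    have h0 : ∀ᵐ ξ : Euc d, ξ ≠ 0 := by simp [ae_iff]
    filter_upwards [h0] with ξ hξ
    rw [h _ (norm_pos_iff.2 hξ)]
  rw [this]
  exact hT f

theorem HasRadialFormBound.congr_ae {V : Type*} [NormedAddCommGroup V] [InnerProductSpace ℝ V]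
    [FiniteDimensional ℝ V] [MeasurableSpace V] [BorelSpace V] {m m' : ℝ → ℝ} {p q : ℝ≥0∞} {A : ℝ}
    (h : HasRadialFormBound V m p q A) (hae : ∀ᵐ ξ : V, m' ‖ξ‖ = m ‖ξ‖) :
    HasRadialFormBound V m' p q A := by
  intro f g
  have : radialForm m' (f : V → ℂ) g = radialForm m (f : V → ℂ) g := by
    refine integral_congr_ae ?_
    filter_upwards [hae] with ξ hξ
    rw [hξ]
  rw [this]
  exact h f g

/-- A radial multiplier may be modified on a null set so that it is bounded by its norm. -/
theorem exists_bounded_representative (k : ℕ) : ∃ K : ℝ, 0 ≤ K ∧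
    ∀ (p : ℝ≥0∞) [Fact (1 ≤ p)], 1 < p → p < ⊤ → ∀ q : ℝ≥0∞, p.HolderConjugate q →
    ∀ m : ℝ → ℝ, IsBoundedMeasurableOnPos m →
    ∀ T : Lp ℂ p (volume : Measure (Euc (k + 1))) →L[ℂ] Lp ℂ p (volume : Measure (Euc (k + 1))),
      IsRadialMultiplier m T → ∃ m₁ : ℝ → ℝ, Measurable m₁ ∧ (∀ r, |m₁ r| ≤ K * ‖T‖) ∧
        HasRadialFormBound (Euc (k + 1)) m₁ p q ‖T‖ ∧
        ∀ᵐ s : ℝ, m₁ (Real.exp s) = m (Real.exp s) := by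
  obtain ⟨K, hK, hsup⟩ := exists_ae_abs_le_of_hasRadialFormBound (Euc (k + 1))
  refine ⟨K, hK, fun p _ hp1 hpt q hpq m hm T hT => ?_⟩
  obtain ⟨M, hM⟩ := hm.2
  set m₀ := (Ioi (0 : ℝ)).indicator m with hm₀
  have hmeas : Measurable m₀ := measurable_indicator_Ioi hm
  have hM0 : 0 ≤ M := (abs_nonneg _).trans (hM 1 one_pos)
  have hbd : ∀ r, |m₀ r| ≤ M := by
    intro r
    by_cases hr : r ∈ Ioi (0 : ℝ)
    · rw [hm₀, indicator_of_mem hr]; exact hM r hr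
    · rw [hm₀, indicator_of_notMem hr, abs_zero]; exact hM0
  have heq : ∀ r, 0 < r → m₀ r = m r := fun r hr => indicator_of_mem (mem_Ioi.2 hr) m
  have hform : HasRadialFormBound (Euc (k + 1)) m₀ p q ‖T‖ :=
    hasRadialFormBound_of_isRadialMultiplier hmeas hbd (hT.congr_pos (by omega) heq)
  have hq1 : 1 ≤ q := hpq.symm.one_le
  have hqt : q ≠ ⊤ := by
    intro h
    have := hpq.inv_add_inv_eq_one
    rw [h, ENNReal.inv_top, add_zero, ENNReal.inv_eq_one] at this
    exact hp1.ne' this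
  have hae := hsup p q hp1.le hq1 hpt.ne hqt hpq m₀ M ‖T‖ hmeas hbd (norm_nonneg _) hform
  have hKT : 0 ≤ K * ‖T‖ := by positivity
  -- Clamping at `±K‖T‖` gives a bound valid everywhere and changes the symbol only where the almost
  -- everywhere bound fails.
  set m₁ : ℝ → ℝ := fun r => max (-(K * ‖T‖)) (min (m₀ r) (K * ‖T‖)) with hm₁
  have hclamp : ∀ r, |m₀ r| ≤ K * ‖T‖ → m₁ r = m₀ r := by
    intro r hr
    obtain ⟨h1, h2⟩ := abs_le.1 hr
    simp only [hm₁]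
    rw [min_eq_left h2, max_eq_right h1]
  refine ⟨m₁, measurable_const.max (hmeas.min measurable_const), fun r => ?_,
    hform.congr_ae (hae.mono fun ξ hξ => hclamp _ hξ), ?_⟩
  · rw [abs_le]
    exact ⟨le_max_left _ _, max_le (by linarith) (min_le_right _ _)⟩
  · refine (ae_comp_exp (ae_of_ae_norm (V := Euc (k + 1)) (P := fun r => |m₀ r| ≤ K * ‖T‖) hae)).mono
      fun s hs => ?_
    rw [hclamp _ hs, heq _ (Real.exp_pos s)]

theorem exists_holderConjugate {p : ℝ≥0∞} (hp : 1 < p) (hpt : p < ⊤) :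
    ∃ q : ℝ≥0∞, 1 < q ∧ q < ⊤ ∧ p.HolderConjugate q ∧ 1 / p.toReal + 1 / q.toReal = 1 := by
  have hpq : p.HolderConjugate p.conjExponent := .conjExponent hp.le
  set q := p.conjExponent
  have hsum := hpq.inv_add_inv_eq_one
  have hqt : q ≠ ⊤ := by
    intro h
    rw [h, ENNReal.inv_top, add_zero, ENNReal.inv_eq_one] at hsum
    exact hp.ne' hsum
  have hq1 : q ≠ 1 := by
    intro h
    have := hpq.symm.inv_add_inv_eq_one
    rw [h, inv_one] at this
    have h2 : p⁻¹ = 0 := by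
      have := ENNReal.add_right_inj (a := (1 : ℝ≥0∞)) (b := p⁻¹) (c := 0) (by simp)
      exact this.1 (by rw [add_zero]; assumption)
    exact hpt.ne (ENNReal.inv_eq_zero.1 h2)
  refine ⟨q, lt_of_le_of_ne hpq.symm.one_le hq1.symm, lt_top_iff_ne_top.2 hqt, hpq, ?_⟩
  have h2 : (p⁻¹ + q⁻¹).toReal = 1 := by rw [hsum]; simp
  rw [ENNReal.toReal_add (by simpa using hpq.ne_zero) (by simpa using hpq.symm.ne_zero),
    ENNReal.toReal_inv, ENNReal.toReal_inv] at h2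
  simpa using h2

theorem dilatedAverage_congr_ae (v : ℝ → ℂ) {φ ψ : ℝ → ℝ} (h : φ =ᵐ[volume] ψ) {L : ℝ} (hL : 0 < L)
    (t : ℝ) : dilatedAverage v φ L t = dilatedAverage v ψ L t := by
  refine integral_congr_ae ?_
  have h1 : Measure.QuasiMeasurePreserving (fun s : ℝ => t - s) :=
    (volume.measurePreserving_sub_left t).quasiMeasurePreserving
  have h2 : Measure.QuasiMeasurePreserving (fun s : ℝ => s / L) := by
    refine ⟨by fun_prop, ?_⟩
    simp_rw [div_eq_inv_mul]
    rw [Real.map_volume_mul_left (inv_pos.2 hL).ne']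
    exact Measure.smul_absolutelyContinuous
  filter_upwards [(h1.comp h2).ae h] with s hs
  simp only [Function.comp_apply] at hs
  rw [hs]

/-- The bound for the averages of the symbol of a radial multiplier. -/
theorem HasTubeBound.exists_norm_le {k : ℕ} {v : ℝ → ℂ} (hv : HasTubeBound k v) :
    ∃ C : ℝ, 0 ≤ C ∧ ∀ (p : ℝ≥0∞) [Fact (1 ≤ p)], 1 < p → p < ⊤ →
    ∀ m : ℝ → ℝ, IsBoundedMeasurableOnPos m →
    ∀ T : Lp ℂ p (volume : Measure (Euc (k + 1))) →L[ℂ] Lp ℂ p (volume : Measure (Euc (k + 1))),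
      IsRadialMultiplier m T →
    ∀ (δ ε : ℝ), 0 < δ → δ < 1 → IsTubeCompression (k + 1) δ ε → ∀ L t : ℝ, 0 < L →
      ‖dilatedAverage v (fun s => m (Real.exp s)) L t‖ ≤
        C * ‖T‖ * (ε ^ |1 / p.toReal - 1 / 2| + 1 / (L * δ ^ 2)) := by
  obtain ⟨C, hC, h⟩ := hv
  obtain ⟨K, hK, hrep⟩ := exists_bounded_representative k
  refine ⟨C * (1 + K), by positivity,
    fun p _ hp1 hpt m hm T hT δ ε hδ hδ1 hε L t hL => ?_⟩
  obtain ⟨q, hq1, hqt, hpq, hsum⟩ := exists_holderConjugate hp1 hpt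
  obtain ⟨m₁, hm₁, hb, hform, hae⟩ := hrep p hp1 hpt q hpq m hm T hT
  have hε0 := hε.1
  have hkey : ‖dilatedAverage v (fun s => m₁ (Real.exp s)) L t‖ ≤
      C * (‖T‖ * ε ^ |1 / p.toReal - 1 / 2| + K * ‖T‖ / (L * δ ^ 2)) := by
    rcases le_total p 2 with h2 | h2
    · have := h δ ε hδ hδ1 hε m₁ (K * ‖T‖) hm₁ hb p q hp1.le h2 hqt.ne hpq ‖T‖ (norm_nonneg _)
        hform L t hL
      have hp2 : p.toReal ≤ 2 := by simpa using ENNReal.toReal_mono (by simp) h2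
      have hp0 : 0 < p.toReal := ENNReal.toReal_pos (by positivity) hpt.ne
      rwa [abs_of_nonneg (sub_nonneg.2 (one_div_le_one_div_of_le hp0 hp2))]
    · have hp2 : 2 ≤ p.toReal := by simpa using ENNReal.toReal_mono hpt.ne h2
      have hp0 : 0 < p.toReal := by linarith
      have hinv : 1 / p.toReal ≤ 1 / 2 := one_div_le_one_div_of_le two_pos hp2
      have hq2 : q ≤ 2 := by
        have hq0 : 0 < q.toReal := ENNReal.toReal_pos (by positivity) hqt.ne
        have : 1 / 2 ≤ 1 / q.toReal := by linarith
        have := (one_div_le_one_div two_pos hq0).1 this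
        rw [← ENNReal.toReal_le_toReal hqt.ne (by simp)]
        simpa using this
      -- For `p ≥ 2` the bound is used with `p` and `q` exchanged, because `1/q - 1/2 = |1/p -
      -- 1/2|`.
      have := h δ ε hδ hδ1 hε m₁ (K * ‖T‖) hm₁ hb q p hq1.le hq2 hpt.ne hpq.symm ‖T‖
        (norm_nonneg _) hform.symm L t hL
      rw [abs_of_nonpos (by linarith)]
      have e : -(1 / p.toReal - 1 / 2) = 1 / q.toReal - 1 / 2 := by linarith
      rwa [e]
  rw [← dilatedAverage_congr_ae v hae hL]
  refine hkey.trans ?_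
  have h1 : 0 ≤ ε ^ |1 / p.toReal - 1 / 2| := by positivity
  have h2 : 0 ≤ 1 / (L * δ ^ 2) := by positivity
  calc _ = C * ‖T‖ * (ε ^ |1 / p.toReal - 1 / 2| + K * (1 / (L * δ ^ 2))) := by ring
    _ ≤ C * ‖T‖ * ((1 + K) * ε ^ |1 / p.toReal - 1 / 2| + (1 + K) * (1 / (L * δ ^ 2))) := by
        gcongr
        · nlinarith
        · linarith
    _ = _ := by ring

end Reduction

/-! ### Littlewood-Paley blocks and the bound in every dimension -/

section Blocks

open Set Filter Topology

theorem norm_dilatedAverage_le {v : ℝ → ℂ} (hv : Integrable (𝓕⁻ v)) {φ : ℝ → ℝ} {M : ℝ}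
    (hM : ∀ s, |φ s| ≤ M) (L t : ℝ) : ‖dilatedAverage v φ L t‖ ≤ M * ∫ s, ‖𝓕⁻ v s‖ := by
  rw [← integral_const_mul]
  refine norm_integral_le_of_norm_le (hv.norm.const_mul M) (ae_of_all _ fun s => ?_)
  rw [norm_mul, mul_comm, Complex.norm_real]
  exact mul_le_mul_of_nonneg_right (hM _) (norm_nonneg _)

namespace LittlewoodPaley

variable (P : LittlewoodPaley)

theorem block_eq_dilatedAverage_one (n : ℕ) (φ : ℝ → ℝ) (t : ℝ) :
    P.block n φ t = dilatedAverage (fun x => (P.wn n x : ℂ)) φ 1 t := by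
  simp [block, convolution_def, dilatedAverage, W]

theorem block_eq_dilatedAverage {n : ℕ} (hn : 1 ≤ n) (φ : ℝ → ℝ) (t : ℝ) :
    P.block n φ t = dilatedAverage (fun x => (P.w |x| : ℂ)) φ (2 ^ n) t := by
  have hκ : (0 : ℝ) < (2 ^ n)⁻¹ := by positivity
  rw [block_eq_dilatedAverage_one, ← dilatedAverage_comp_mul _ φ hκ (2 ^ n),
    inv_mul_cancel₀ (by positivity)]
  congr 1
  ext x
  rw [wn, if_neg (by omega), abs_mul, abs_of_pos hκ, div_eq_inv_mul]

theorem w_eq_zero {x : ℝ} (hx : x ∉ Icc (1 / 2 : ℝ) 2) : P.w x = 0 := by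
  by_contra h
  exact hx (P.support (subset_tsupport _ h))

theorem w₀_eq_zero {x : ℝ} (hx : x ∉ Icc (-2 : ℝ) 2) : P.w₀ x = 0 := by
  by_contra h
  exact hx (P.support₀ (subset_tsupport _ h))

/-- This form shows that `x ↦ w(|x|)` is smooth even though the absolute value is not. -/
theorem w_abs_eq (x : ℝ) : P.w |x| = P.w x + P.w (-x) := by
  rcases le_total 0 x with h | h
  · rw [abs_of_nonneg h, P.w_eq_zero (x := -x) (fun hx => by linarith [hx.1]), add_zero]
  · rw [abs_of_nonpos h, P.w_eq_zero (x := x) (fun hx => by linarith [hx.1]), zero_add]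

theorem contDiff_w_abs : ContDiff ℝ ∞ (fun x => (P.w |x| : ℂ)) := by
  simp_rw [P.w_abs_eq]
  exact Complex.ofRealCLM.contDiff.comp (P.smooth.add (P.smooth.comp contDiff_neg))

theorem abs_mem_of_w_abs_ne_zero {x : ℝ} (hx : P.w |x| ≠ 0) : 1 / 2 ≤ |x| ∧ |x| ≤ 2 := by
  by_contra h
  exact hx (P.w_eq_zero h)

theorem hasTubeBound_w_abs (k : ℕ) : HasTubeBound k (fun x => (P.w |x| : ℂ)) :=
  hasTubeBound_of_dyadic k P.contDiff_w_abs fun _ hx =>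
    P.abs_mem_of_w_abs_ne_zero (by exact_mod_cast hx)

theorem contDiff_w₀ : ContDiff ℝ ∞ (fun x => (P.w₀ x : ℂ)) :=
  Complex.ofRealCLM.contDiff.comp P.smooth₀

theorem hasCompactSupport_w₀ : HasCompactSupport (fun x => (P.w₀ x : ℂ)) :=
  hasCompactSupport_of_ne_zero_abs_le (R := 2) fun x hx => by
    by_contra h
    exact hx (by rw [P.w₀_eq_zero fun hx' => h (abs_le.2 hx')]; simp)

theorem block_zero_eq (φ : ℝ → ℝ) (t : ℝ) :
    P.block 0 φ t = dilatedAverage (fun x => (P.w₀ x : ℂ)) φ 1 t := by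
  simp [block_eq_dilatedAverage_one, wn]

/-- The bound without decay, from the supremum of the symbol alone. It serves multipliers whose
support contains the frequency `0`, to which the tube bound does not apply. -/
theorem exists_norm_dilatedAverage_le (k : ℕ) {v : ℝ → ℂ} (hv : Integrable (𝓕⁻ v)) :
    ∃ C : ℝ, 0 ≤ C ∧ ∀ (p : ℝ≥0∞) [Fact (1 ≤ p)], 1 < p → p < ⊤ →
    ∀ m : ℝ → ℝ, IsBoundedMeasurableOnPos m →
    ∀ T : Lp ℂ p (volume : Measure (Euc (k + 1))) →L[ℂ] Lp ℂ p (volume : Measure (Euc (k + 1))),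
      IsRadialMultiplier m T → ∀ L t : ℝ, 0 < L →
      ‖dilatedAverage v (fun s => m (Real.exp s)) L t‖ ≤ C * ‖T‖ := by
  obtain ⟨K, hK, hrep⟩ := exists_bounded_representative k
  refine ⟨K * ∫ s, ‖𝓕⁻ v s‖, by positivity, fun p _ hp1 hpt m hm T hT L t hL => ?_⟩
  obtain ⟨q, -, -, hpq, -⟩ := exists_holderConjugate hp1 hpt
  obtain ⟨m₁, -, hb, -, hae⟩ := hrep p hp1 hpt q hpq m hm T hT
  rw [← dilatedAverage_congr_ae v hae hL]
  exact (norm_dilatedAverage_le hv (fun s => hb _) L t).trans_eq (by ring)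

end LittlewoodPaley

theorem exists_isTubeCompression (k : ℕ) (δ : ℝ) : ∃ ε, IsTubeCompression (k + 1) δ ε := by
  refine ⟨1, one_pos, 1, one_pos,
    fun _ => ⟨0, EuclideanSpace.single 0 1, by simp⟩, fun i j h => ?_, ?_⟩
  · exact absurd (Subsingleton.elim i j) h
  · simp only [Fin.sum_univ_one, iUnion_const]
    exact div_self_le_one _

/-- A bound that holds for every ratio realised by tubes holds for their infimum. -/
theorem le_tubeCompression_rpow {k : ℕ} {δ a B C E : ℝ} (ha : 0 ≤ a)
    (h : ∀ ε, IsTubeCompression (k + 1) δ ε → B ≤ C * (ε ^ a + E)) :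
    B ≤ C * (tubeCompression (k + 1) δ ^ a + E) := by
  obtain ⟨u, -, hu, hmem⟩ := exists_seq_tendsto_sInf
    (S := {ε | IsTubeCompression (k + 1) δ ε}) (exists_isTubeCompression k δ)
    ⟨0, fun ε hε => hε.1.le⟩
  rw [tubeCompression_eq]
  refine ge_of_tendsto' (((((Real.continuous_rpow_const ha).tendsto _).comp hu).add_const
    E).const_mul C) fun n => h _ (hmem n)

theorem norm_block_le (P : LittlewoodPaley) (d : ℕ) (hd : 1 ≤ d) : ∃ C : ℝ, 0 < C ∧
    ∀ (p : ℝ≥0∞) [Fact (1 ≤ p)], 1 < p → p < ⊤ →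
    ∀ m : ℝ → ℝ, IsBoundedMeasurableOnPos m →
    ∀ T : Lp ℂ p (volume : Measure (Euc d)) →L[ℂ] Lp ℂ p (volume : Measure (Euc d)),
      IsRadialMultiplier m T →
    ∀ (n : ℕ) (t : ℝ),
      ‖P.block n (fun s => m (Real.exp s)) t‖ ≤
        C * ‖T‖ * ⨅ δ : Set.Ioo (0 : ℝ) 1,
          (tubeCompression d (δ : ℝ) ^ |1 / p.toReal - 1 / 2| +
            1 / ((2 : ℝ) ^ n * (δ : ℝ) ^ 2)) := by
  obtain ⟨k, rfl⟩ : ∃ k, d = k + 1 := ⟨d - 1, by omega⟩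
  obtain ⟨C₁, hC₁, h₁⟩ := (P.hasTubeBound_w_abs k).exists_norm_le
  obtain ⟨C₀, hC₀, h₀⟩ := LittlewoodPaley.exists_norm_dilatedAverage_le k
    (integrable_fourierInv P.contDiff_w₀ P.hasCompactSupport_w₀)
  refine ⟨C₀ + C₁ + 1, by positivity, fun p _ hp1 hpt m hm T hT n t => ?_⟩
  rw [Real.mul_iInf_of_nonneg (by positivity)]
  have : Nonempty (Ioo (0 : ℝ) 1) := ⟨⟨1 / 2, by norm_num, by norm_num⟩⟩
  refine le_ciInf fun ⟨δ, hδ, hδ1⟩ => le_tubeCompression_rpow (abs_nonneg _) fun ε hε => ?_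
  have hε0 := hε.1
  have hT0 := norm_nonneg T
  rcases Nat.eq_zero_or_pos n with rfl | hn
  · rw [P.block_zero_eq]
    refine (h₀ p hp1 hpt m hm T hT 1 t one_pos).trans ?_
    -- For `n = 0` and `δ < 1` the error term alone is at least `1`, so the bound without decay
    -- suffices.
    have h1 : 1 ≤ 1 / ((2 : ℝ) ^ 0 * δ ^ 2) := by
      rw [pow_zero, one_mul, le_div_iff₀ (by positivity)]
      nlinarith
    have h2 : 0 ≤ ε ^ |1 / p.toReal - 1 / 2| := by positivity
    calc C₀ * ‖T‖ ≤ (C₀ + C₁ + 1) * ‖T‖ * 1 := by nlinarith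
      _ ≤ _ := by
        gcongr
        linarith
  · rw [P.block_eq_dilatedAverage hn]
    refine (h₁ p hp1 hpt m hm T hT δ ε hδ hδ1 hε _ t (by positivity)).trans ?_
    gcongr
    linarith

end Blocks

/-! ### The dyadic Kakeya configuration of lines -/

section Kakeya

open Set

/-- By Fubini, the vertical sections are intervals of length `β - α` whatever the curve `c` is. -/
theorem volume_strip_le {c : ℝ → ℝ} (hc : Continuous c) {p q : ℝ} (hpq : p ≤ q) (α β : ℝ) :
    volume {x : Euc 2 | x 0 ∈ Icc p q ∧ x 1 - c (x 0) ∈ Icc α β} ≤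
      ENNReal.ofReal ((q - p) * (β - α)) := by
  set s : Set (ℝ × ℝ) := {z | z.1 ∈ Icc p q ∧ z.2 - c z.1 ∈ Icc α β} with hs
  have hsm : MeasurableSet s := by
    refine IsClosed.measurableSet ?_
    exact (isClosed_Icc.preimage continuous_fst).inter
      (isClosed_Icc.preimage (continuous_snd.sub (hc.comp continuous_fst)))
  have hmp := (volume_preserving_finTwoArrow ℝ).comp
    (EuclideanSpace.volume_preserving_symm_measurableEquiv_toLp (Fin 2))
  have hpre : {x : Euc 2 | x 0 ∈ Icc p q ∧ x 1 - c (x 0) ∈ Icc α β} =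
      (MeasurableEquiv.finTwoArrow ∘ (MeasurableEquiv.toLp 2 (Fin 2 → ℝ)).symm) ⁻¹' s := by
    ext x
    rfl
  rw [hpre, hmp.measure_preimage hsm.nullMeasurableSet, Measure.volume_eq_prod,
    Measure.prod_apply hsm]
  have hsec : ∀ x, volume (Prod.mk x ⁻¹' s) ≤
      (Icc p q).indicator (fun _ => ENNReal.ofReal (β - α)) x := by
    intro x
    by_cases hx : x ∈ Icc p q
    · rw [indicator_of_mem hx]
      have : Prod.mk x ⁻¹' s = Icc (α + c x) (β + c x) := by
        ext y
        change (x ∈ Icc p q ∧ y - c x ∈ Icc α β) ↔ y ∈ Icc (α + c x) (β + c x)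
        rw [and_iff_right hx, mem_Icc, mem_Icc]
        constructor <;> rintro ⟨h1, h2⟩ <;> constructor <;> linarith
      rw [this, Real.volume_Icc]
      exact le_of_eq (by congr 1; ring)
    · have : Prod.mk x ⁻¹' s = ∅ := eq_empty_of_forall_notMem fun y hy => hx hy.1
      rw [this]
      simp
  refine (lintegral_mono hsec).trans ?_
  rw [lintegral_indicator_const measurableSet_Icc, Real.volume_Icc, mul_comm,
    ← ENNReal.ofReal_mul (by linarith)]

/-- The tube in the plane along the line `y = a * x + b`, starting at `x = 0`. -/
def graphTube (a b : ℝ) : Tube 2 where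
  base := !₂[0, b]
  dir := (√(1 + a ^ 2))⁻¹ • !₂[1, a]
  norm_dir := by
    have h : 0 < √(1 + a ^ 2) := by positivity
    rw [norm_smul, norm_inv, Real.norm_of_nonneg h.le, EuclideanSpace.norm_eq]
    simp only [Fin.sum_univ_two]
    simp [h.ne']

/-- In graph coordinates the tube costs at most a factor `1 + a ≤ 2` in vertical width, and
arclength `s` becomes abscissa `s / r` with `r = √(1 + a²) ≤ 10/7`, up to `δ`. -/
theorem graphTube_slab {a b δ s₁ s₂ : ℝ} (ha : 0 ≤ a) (ha1 : a ≤ 1) {x : Euc 2}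
    (hx : x ∈ (graphTube a b).slab δ s₁ s₂) :
    |x 1 - (a * x 0 + b)| < 2 * δ ∧
      ∃ r s : ℝ, 1 ≤ r ∧ 7 * r ≤ 10 ∧ s ∈ Icc s₁ s₂ ∧ |x 0 - s / r| < δ := by
  obtain ⟨hs, hn⟩ := hx
  set s : ℝ := inner ℝ (x - (graphTube a b).base) (graphTube a b).dir
  set r : ℝ := √(1 + a ^ 2) with hr
  set y : Euc 2 := x - (graphTube a b).base - s • (graphTube a b).dir with hy
  have hr1 : 1 ≤ r := Real.one_le_sqrt.2 (by nlinarith)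
  have hr2 : 7 * r ≤ 10 := by
    have : r ≤ 10 / 7 := by
      rw [hr, Real.sqrt_le_left (by norm_num)]
      nlinarith
    linarith
  have hy0 : y 0 = x 0 - s / r := by
    simp [hy, graphTube, hr, div_eq_mul_inv]
  have hy1 : y 1 = x 1 - b - s / r * a := by
    simp [hy, graphTube, hr, div_eq_mul_inv, mul_assoc]
  have h0 : |y 0| < δ := (PiLp.norm_apply_le y 0).trans_lt hn
  have h1 : |y 1| < δ := (PiLp.norm_apply_le y 1).trans_lt hn
  refine ⟨?_, r, s, hr1, hr2, hs, hy0 ▸ h0⟩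
  have e : x 1 - (a * x 0 + b) = y 1 - a * y 0 := by rw [hy0, hy1]; ring
  rw [e]
  have h2 : |a * y 0| ≤ |y 0| := by
    rw [abs_mul, abs_of_nonneg ha]
    exact mul_le_of_le_one_left (abs_nonneg _) ha1
  linarith [abs_sub (y 1) (a * y 0)]

theorem sum_Ico_half_pow {a N : ℕ} (h : a ≤ N) :
    ∑ j ∈ Finset.Ico a N, (1 / 2 : ℝ) ^ (j + 1) = (1 / 2) ^ a - (1 / 2) ^ N := by
  induction N, h using Nat.le_induction with
  | base => simp
  | succ n hn ih =>
    rw [Finset.sum_Ico_succ_top hn, ih]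
    ring

theorem sum_Ico_half_pow_mul {k N : ℕ} (h : k + 1 ≤ N) :
    ∑ j ∈ Finset.Ico (k + 1) N, (1 / 2 : ℝ) ^ (j + 1) * ((j : ℝ) - k) =
      (1 / 2) ^ k - ((N : ℝ) - k + 1) * (1 / 2) ^ N := by
  induction N, h using Nat.le_induction with
  | base =>
    push_cast
    rw [Finset.Ico_self, Finset.sum_empty]
    ring
  | succ n hn ih =>
    rw [Finset.sum_Ico_succ_top hn, ih]
    push_cast
    ring

/-- Dyadic sums with decreasing weights are separated. -/
theorem dyadic_sum_separated {N : ℕ} {c : ℕ → ℝ} (hc : Antitone c) (hc0 : ∀ j < N, 0 ≤ c j)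
    {S S' : Finset ℕ} (hS : S ⊆ Finset.range N) (hS' : S' ⊆ Finset.range N) (hne : S ≠ S') :
    (1 / 2) ^ N * c N ≤
      |∑ i ∈ S, (1 / 2 : ℝ) ^ (i + 1) * c i - ∑ i ∈ S', (1 / 2 : ℝ) ^ (i + 1) * c i| := by
  have hD : (symmDiff S S').Nonempty := by
    rwa [Finset.nonempty_iff_ne_empty, ne_eq, ← Finset.bot_eq_empty, symmDiff_eq_bot]
  -- The first index at which the two sets differ decides: earlier terms agree, and later ones
  -- cannot compensate because the weights decrease.
  obtain ⟨i, hiD, hleast⟩ : ∃ i ∈ symmDiff S S', ∀ j ∈ symmDiff S S', i ≤ j :=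
    ⟨_, Finset.min'_mem _ hD, fun j hj => Finset.min'_le _ j hj⟩
  have hmin : ∀ j < i, (j ∈ S ↔ j ∈ S') := by
    intro j hj
    by_contra h
    have : j ∈ symmDiff S S' := by
      rw [Finset.mem_symmDiff]
      tauto
    exact absurd (hleast j this) (not_le.2 hj)
  clear hleast hD
  wlog hiS : i ∈ S generalizing S S'
  · rw [abs_sub_comm]
    rw [symmDiff_comm] at hiD
    refine this hS' hS hne.symm hiD (fun j hj => (hmin j hj).symm) ?_
    rw [Finset.mem_symmDiff] at hiD
    tauto
  have hiS' : i ∉ S' := by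
    rw [Finset.mem_symmDiff] at hiD
    tauto
  have hiN : i < N := Finset.mem_range.1 (hS hiS)
  set g : ℕ → ℝ := fun j => (1 / 2 : ℝ) ^ (j + 1) * c j with hg
  have hg0 : ∀ j < N, 0 ≤ g j := fun j hj => mul_nonneg (by positivity) (hc0 j hj)
  have hpre : S.filter (· < i) = S'.filter (· < i) := by
    ext j
    simp only [Finset.mem_filter]
    constructor <;> rintro ⟨h1, h2⟩ <;> have := hmin j h2 <;> tauto
  have h1 : g i ≤ ∑ j ∈ S.filter (¬ · < i), g j :=
    Finset.single_le_sum (f := g)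
      (fun j hj => hg0 j (Finset.mem_range.1 (hS (Finset.mem_filter.1 hj).1)))
      (Finset.mem_filter.2 ⟨hiS, lt_irrefl i⟩)
  have h2 : ∑ j ∈ S'.filter (¬ · < i), g j ≤ ∑ j ∈ Finset.Ico (i + 1) N, g j := by
    refine Finset.sum_le_sum_of_subset_of_nonneg (fun j hj => ?_)
      fun j hj _ => hg0 j (Finset.mem_Ico.1 hj).2
    obtain ⟨hj1, hj2⟩ := Finset.mem_filter.1 hj
    have : j ≠ i := fun h => hiS' (h ▸ hj1)
    exact Finset.mem_Ico.2 ⟨by omega, Finset.mem_range.1 (hS' hj1)⟩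
  -- All later terms together miss the leading term `(1/2)^(i+1) * c i` by at least `(1/2)^N * c i`,
  -- which is the separation.
  have h3 : ∑ j ∈ Finset.Ico (i + 1) N, g j ≤ ((1 / 2) ^ (i + 1) - (1 / 2) ^ N) * c i := by
    rw [← sum_Ico_half_pow (by omega : i + 1 ≤ N), Finset.sum_mul]
    refine Finset.sum_le_sum fun j hj => ?_
    have := hc (by have := (Finset.mem_Ico.1 hj).1; omega : i ≤ j)
    simp only [hg]
    gcongr
  rw [← Finset.sum_filter_add_sum_filter_not S (· < i), hpre,
    ← Finset.sum_filter_add_sum_filter_not S' (· < i)]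
  refine le_trans ?_ (le_abs_self _)
  have h4 : (1 / 2 : ℝ) ^ N * c N ≤ (1 / 2) ^ N * c i := by
    have := hc hiN.le
    gcongr
  have h5 : g i = (1 / 2) ^ (i + 1) * c i := rfl
  linarith

/-- The slope of the `S`-th line of the dyadic Kakeya configuration. -/
def kakeyaSlope (S : Finset ℕ) : ℝ := ∑ i ∈ S, (1 / 2 : ℝ) ^ (i + 1)

/-- The height at `0` of the `S`-th line of the dyadic Kakeya configuration with `N` steps. -/
def kakeyaIntercept (N : ℕ) (S : Finset ℕ) : ℝ :=
  ∑ i ∈ S, (1 / 2 : ℝ) ^ (i + 1) * (-((i : ℝ) / N))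

/-- The `S`-th line of the dyadic Kakeya configuration with `N` steps. -/
def kakeyaLine (N : ℕ) (S : Finset ℕ) (x : ℝ) : ℝ :=
  ∑ i ∈ S, (1 / 2 : ℝ) ^ (i + 1) * (x - (i : ℝ) / N)

theorem kakeyaLine_eq (N : ℕ) (S : Finset ℕ) (x : ℝ) :
    kakeyaLine N S x = kakeyaSlope S * x + kakeyaIntercept N S := by
  rw [kakeyaLine, kakeyaSlope, kakeyaIntercept, Finset.sum_mul, ← Finset.sum_add_distrib]
  exact Finset.sum_congr rfl fun i _ => by ring

theorem continuous_kakeyaLine (N : ℕ) (S : Finset ℕ) : Continuous (kakeyaLine N S) := by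
  simp_rw [funext (kakeyaLine_eq N S)]
  fun_prop

theorem kakeyaSlope_nonneg (S : Finset ℕ) : 0 ≤ kakeyaSlope S :=
  Finset.sum_nonneg fun i _ => by positivity

theorem kakeyaSlope_le_one {N : ℕ} {S : Finset ℕ} (hS : S ⊆ Finset.range N) :
    kakeyaSlope S ≤ 1 := by
  have h1 : kakeyaSlope S ≤ ∑ i ∈ Finset.range N, (1 / 2 : ℝ) ^ (i + 1) :=
    Finset.sum_le_sum_of_subset_of_nonneg hS fun i _ _ => by positivity
  rw [Finset.range_eq_Ico, sum_Ico_half_pow (Nat.zero_le N)] at h1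
  have : (0 : ℝ) < (1 / 2) ^ N := by positivity
  linarith [pow_zero (1 / 2 : ℝ)]

theorem abs_kakeyaLine_le {N : ℕ} {S : Finset ℕ} (hS : S ⊆ Finset.range N) {x : ℝ}
    (hx : x ∈ Icc (-1 : ℝ) 2) : |kakeyaLine N S x| ≤ 2 := by
  have h : |kakeyaLine N S x| ≤ kakeyaSlope S * 2 := by
    rw [kakeyaLine, kakeyaSlope, Finset.sum_mul]
    refine (Finset.abs_sum_le_sum_abs _ _).trans (Finset.sum_le_sum fun i hi => ?_)
    rw [abs_mul, abs_of_nonneg (by positivity : (0 : ℝ) ≤ (1 / 2) ^ (i + 1))]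
    have hiN : i < N := Finset.mem_range.1 (hS hi)
    have h0 : (0 : ℝ) ≤ i / N := by positivity
    have h1 : (i : ℝ) / N ≤ 1 := div_le_one_of_le₀ (by exact_mod_cast hiN.le) (by positivity)
    gcongr
    rw [abs_le]
    constructor <;> linarith [hx.1, hx.2]
  linarith [kakeyaSlope_le_one hS]

/-- For `x ≥ 1` the weights `x - i/N` are nonnegative and decreasing in `i`, and the weight at `i =
N` is `x - 1`. -/
theorem kakeyaLine_separated {N : ℕ} (hN : 1 ≤ N) {S S' : Finset ℕ} (hS : S ⊆ Finset.range N)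
    (hS' : S' ⊆ Finset.range N) (hne : S ≠ S') {x : ℝ} (hx : 1 ≤ x) :
    (1 / 2) ^ N * (x - 1) ≤ |kakeyaLine N S x - kakeyaLine N S' x| := by
  have hN0 : (0 : ℝ) < N := by exact_mod_cast hN
  have h := dyadic_sum_separated (N := N) (c := fun i => x - (i : ℝ) / N)
    (fun i j hij => by
      have : (i : ℝ) ≤ j := by exact_mod_cast hij
      simp only
      gcongr)
    (fun j hj => by
      have : (j : ℝ) / N ≤ 1 := div_le_one_of_le₀ (by exact_mod_cast hj.le) (by positivity)
      linarith) hS hS' hne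
  simp only [div_self hN0.ne'] at h
  exact h

/-- Between `k / N` and `(k + 1) / N` a line is close to the one with the first `k + 1` digits. -/
theorem kakeyaLine_sub_prefix {N k : ℕ} (hk : k < N) {S : Finset ℕ} (hS : S ⊆ Finset.range N)
    {x : ℝ} (hx : x ∈ Icc ((k : ℝ) / N) ((k + 1 : ℝ) / N)) :
    kakeyaLine N S x - kakeyaLine N (S.filter (· < k + 1)) x ∈ Icc (-((1 / 2) ^ k / N : ℝ)) 0 := by
  have hN0 : (0 : ℝ) < N := by exact_mod_cast (Nat.zero_le k).trans_lt hk
  rw [kakeyaLine, kakeyaLine, ← Finset.sum_filter_add_sum_filter_not S (· < k + 1),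
    add_sub_cancel_left]
  constructor
  · have h1 : ∑ j ∈ S.filter (¬ · < k + 1), (1 / 2 : ℝ) ^ (j + 1) * (((j : ℝ) - k) / N) ≤
        ∑ j ∈ Finset.Ico (k + 1) N, (1 / 2 : ℝ) ^ (j + 1) * (((j : ℝ) - k) / N) := by
      refine Finset.sum_le_sum_of_subset_of_nonneg (fun j hj => ?_) fun j hj _ => ?_
      · obtain ⟨hj1, hj2⟩ := Finset.mem_filter.1 hj
        exact Finset.mem_Ico.2 ⟨by omega, Finset.mem_range.1 (hS hj1)⟩
      · have : (k : ℝ) ≤ j := by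
          have := (Finset.mem_Ico.1 hj).1
          exact_mod_cast (by omega : k ≤ j)
        have := sub_nonneg.2 this
        positivity
    have h2 : ∑ j ∈ Finset.Ico (k + 1) N, (1 / 2 : ℝ) ^ (j + 1) * (((j : ℝ) - k) / N) ≤
        (1 / 2) ^ k / N := by
      simp_rw [← mul_div_assoc]
      rw [← Finset.sum_div, sum_Ico_half_pow_mul hk]
      have : (k : ℝ) ≤ N := by exact_mod_cast hk.le
      have : 0 ≤ ((N : ℝ) - k + 1) * (1 / 2) ^ N := mul_nonneg (by linarith) (by positivity)
      gcongr
      linarith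
    have h3 : -∑ j ∈ S.filter (¬ · < k + 1), (1 / 2 : ℝ) ^ (j + 1) * (((j : ℝ) - k) / N) ≤
        ∑ j ∈ S.filter (¬ · < k + 1), (1 / 2 : ℝ) ^ (j + 1) * (x - (j : ℝ) / N) := by
      rw [← Finset.sum_neg_distrib]
      refine Finset.sum_le_sum fun j _ => ?_
      rw [← mul_neg, sub_div]
      gcongr
      linarith [hx.1]
    linarith
  · refine Finset.sum_nonpos fun j hj => mul_nonpos_of_nonneg_of_nonpos (by positivity) ?_
    have : ((k + 1 : ℝ)) / N ≤ j / N := by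
      have := (Finset.mem_filter.1 hj).2
      gcongr
      exact_mod_cast (by omega : k + 1 ≤ j)
    linarith [hx.2]

end Kakeya

/-! ### Compression of planar tubes -/

section KakeyaCompression

open Set

/-- The `S`-th tube of the dyadic Kakeya configuration with `N` steps. -/
def kakeyaTube (N : ℕ) (S : Finset ℕ) : Tube 2 :=
  graphTube (kakeyaSlope S) (kakeyaIntercept N S)

theorem mem_kakeyaTube_slab {N : ℕ} {S : Finset ℕ} (hS : S ⊆ Finset.range N) {δ s₁ s₂ : ℝ}
    {x : Euc 2} (hx : x ∈ (kakeyaTube N S).slab δ s₁ s₂) :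
    |x 1 - kakeyaLine N S (x 0)| < 2 * δ ∧
      ∃ r s : ℝ, 1 ≤ r ∧ 7 * r ≤ 10 ∧ s ∈ Icc s₁ s₂ ∧ |x 0 - s / r| < δ := by
  rw [kakeyaLine_eq]
  exact graphTube_slab (kakeyaSlope_nonneg S) (kakeyaSlope_le_one hS) hx

theorem half_pow_le_one (N : ℕ) : (1 / 2 : ℝ) ^ N ≤ 1 :=
  pow_le_one₀ (by norm_num) (by norm_num)

theorem kakeyaTube_disjoint_reach {N : ℕ} (hN : 1 ≤ N) {S S' : Finset ℕ}
    (hS : S ⊆ Finset.range N) (hS' : S' ⊆ Finset.range N) (hne : S ≠ S') :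
    Disjoint ((kakeyaTube N S).reach ((1 / 2) ^ N / 16))
      ((kakeyaTube N S').reach ((1 / 2) ^ N / 16)) := by
  rw [disjoint_left]
  intro x hx hx'
  obtain ⟨h1, r, s, hr1, hr2, hs, hd⟩ := mem_kakeyaTube_slab hS hx
  obtain ⟨h1', -⟩ := mem_kakeyaTube_slab hS' hx'
  have hδ : (0 : ℝ) < (1 / 2) ^ N := by positivity
  have hδ1 := half_pow_le_one N
  -- A reach starts at arclength `2`, hence at abscissa at least `7/5 - 1/16 ≥ 5/4`. There distinct
  -- lines are at least `(1/2)^N / 4 = 4δ` apart vertically, while each tube stays within `2δ` of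
  -- its line.
  have hsr : 7 / 5 ≤ s / r := by
    rw [le_div_iff₀ (by linarith)]
    linarith [hs.1]
  have hx0 : 5 / 4 ≤ x 0 := by linarith [(abs_lt.1 hd).1]
  have hsep := kakeyaLine_separated hN hS hS' hne (by linarith : 1 ≤ x 0)
  have habs : |kakeyaLine N S (x 0) - kakeyaLine N S' (x 0)| < 4 * ((1 / 2) ^ N / 16) := by
    rw [abs_lt] at h1 h1' ⊢
    constructor <;> linarith [h1.1, h1.2, h1'.1, h1'.2]
  nlinarith

/-- Over the column `[k/N, (k+1)/N]` only the first `k + 1` digits of the line matter, up to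
`2^(-k)/N`, so `2^(k+1)` strips cover all the tubes. The two end columns of width `δ` catch the
parts of the tubes that leave `0 ≤ x ≤ 1`. -/
theorem kakeyaTube_body_subset {N : ℕ} (hN : 1 ≤ N) {δ : ℝ} (hδ1 : δ ≤ 1 / 2)
    {S : Finset ℕ} (hS : S ⊆ Finset.range N) :
    (kakeyaTube N S).body δ ⊆
      (⋃ k ∈ Finset.range N, ⋃ Q ∈ (Finset.range (k + 1)).powerset,
        {x : Euc 2 | x 0 ∈ Icc ((k : ℝ) / N) ((k + 1 : ℝ) / N) ∧
          x 1 - kakeyaLine N Q (x 0) ∈ Icc (-((1 / 2) ^ k / N + 2 * δ) : ℝ) (2 * δ)}) ∪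
      ({x : Euc 2 | x 0 ∈ Icc (-δ) 0 ∧ x 1 - 0 ∈ Icc (-3 : ℝ) 3} ∪
        {x : Euc 2 | x 0 ∈ Icc 1 (1 + δ) ∧ x 1 - 0 ∈ Icc (-3 : ℝ) 3}) := by
  intro x hx
  obtain ⟨h1, r, s, hr1, hr2, hs, hd⟩ := mem_kakeyaTube_slab hS hx
  have hN0 : (0 : ℝ) < N := by exact_mod_cast hN
  rw [abs_lt] at h1 hd
  have hs0 : 0 ≤ s / r := div_nonneg hs.1 (by linarith)
  have hs1 : s / r ≤ 1 := div_le_one_of_le₀ (by linarith [hs.2]) (by linarith)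
  have hcoarse : x 1 - 0 ∈ Icc (-3 : ℝ) 3 := by
    have := abs_le.1 (abs_kakeyaLine_le hS (x := x 0) ⟨by linarith, by linarith⟩)
    constructor <;> linarith
  by_cases hx0 : x 0 < 0
  · exact Or.inr (Or.inl ⟨⟨by linarith, hx0.le⟩, hcoarse⟩)
  by_cases hx1 : 1 ≤ x 0
  · exact Or.inr (Or.inr ⟨⟨hx1, by linarith⟩, hcoarse⟩)
  push Not at hx0 hx1
  left
  set k := ⌊N * x 0⌋₊ with hk
  have hk1 : (k : ℝ) ≤ N * x 0 := Nat.floor_le (by positivity)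
  have hk2 : N * x 0 < k + 1 := Nat.lt_floor_add_one _
  have hkN : k < N := by
    have : (k : ℝ) < N := by nlinarith
    exact_mod_cast this
  have hmem : x 0 ∈ Icc ((k : ℝ) / N) ((k + 1 : ℝ) / N) := by
    rw [mem_Icc, div_le_iff₀ hN0, le_div_iff₀ hN0]
    constructor <;> linarith
  have hpre := kakeyaLine_sub_prefix hkN hS hmem
  simp only [mem_iUnion]
  refine ⟨k, Finset.mem_range.2 hkN, S.filter (· < k + 1), ?_, hmem, ?_, ?_⟩
  · rw [Finset.mem_powerset]
    intro j hj
    exact Finset.mem_range.2 (Finset.mem_filter.1 hj).2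
  · linarith [hpre.1]
  · linarith [hpre.2]

/-- Each column has area at most `(1/N)(2/N + 4δ 2^(k+1))`. Summing over the columns with `δ =
2^(-N)/16` gives `2/N + 1/(2N)`, and the end columns add `12 δ ≤ 3/(4N)`. -/
theorem volume_iUnion_kakeyaTube_le {N : ℕ} (hN : 1 ≤ N) {ι : Type*} (S : ι → Finset ℕ)
    (hS : ∀ i, S i ⊆ Finset.range N) :
    volume (⋃ i, (kakeyaTube N (S i)).body ((1 / 2) ^ N / 16)) ≤ ENNReal.ofReal (4 / N) := by
  set δ : ℝ := (1 / 2) ^ N / 16 with hδ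
  have hδ0 : 0 < δ := by positivity
  have hδ1 : δ ≤ 1 / 2 := by
    have := half_pow_le_one N
    rw [hδ]; linarith
  have hN0 : (0 : ℝ) < N := by exact_mod_cast hN
  refine (measure_mono (iUnion_subset fun i => kakeyaTube_body_subset hN hδ1 (hS i))).trans ?_
  have hcell : ∀ k : ℕ, volume (⋃ Q ∈ (Finset.range (k + 1)).powerset,
        {x : Euc 2 | x 0 ∈ Icc ((k : ℝ) / N) ((k + 1 : ℝ) / N) ∧
          x 1 - kakeyaLine N Q (x 0) ∈ Icc (-((1 / 2) ^ k / N + 2 * δ) : ℝ) (2 * δ)}) ≤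
      ENNReal.ofReal (1 / N * (2 / N + 4 * δ * 2 ^ (k + 1))) := by
    intro k
    refine (measure_biUnion_finset_le _ _).trans ?_
    refine (Finset.sum_le_sum fun Q _ => volume_strip_le (continuous_kakeyaLine N Q)
      (by gcongr; linarith) _ _).trans ?_
    rw [Finset.sum_const, Finset.card_powerset, Finset.card_range, nsmul_eq_mul,
      ← ENNReal.ofReal_natCast, ← ENNReal.ofReal_mul (by positivity)]
    refine ENNReal.ofReal_le_ofReal (le_of_eq ?_)
    have : (2 : ℝ) ^ k * (1 / 2) ^ k = 1 := by rw [← mul_pow]; norm_num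
    push_cast
    field_simp
    linear_combination (2 : ℝ) * this
  have hcells : volume (⋃ k ∈ Finset.range N, ⋃ Q ∈ (Finset.range (k + 1)).powerset,
        {x : Euc 2 | x 0 ∈ Icc ((k : ℝ) / N) ((k + 1 : ℝ) / N) ∧
          x 1 - kakeyaLine N Q (x 0) ∈ Icc (-((1 / 2) ^ k / N + 2 * δ) : ℝ) (2 * δ)}) ≤
      ENNReal.ofReal (2 / N + 8 * δ * 2 ^ N / N) := by
    refine (measure_biUnion_finset_le _ _).trans
      ((Finset.sum_le_sum fun k _ => hcell k).trans ?_)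
    rw [← ENNReal.ofReal_sum_of_nonneg fun k _ => by positivity]
    refine ENNReal.ofReal_le_ofReal ?_
    have hg : ∑ k ∈ Finset.range N, (2 : ℝ) ^ k ≤ 2 ^ N := by
      rw [geom_sum_eq (by norm_num)]
      linarith
    rw [← Finset.mul_sum, Finset.sum_add_distrib, Finset.sum_const, Finset.card_range,
      nsmul_eq_mul, mul_div_cancel₀ _ hN0.ne', ← Finset.mul_sum]
    simp_rw [pow_succ]
    rw [← Finset.sum_mul]
    calc 1 / (N : ℝ) * (2 + 4 * δ * ((∑ k ∈ Finset.range N, (2 : ℝ) ^ k) * 2))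
        ≤ 1 / (N : ℝ) * (2 + 4 * δ * (2 ^ N * 2)) := by gcongr
      _ = _ := by ring
  have hend : ∀ p : ℝ, volume {x : Euc 2 | x 0 ∈ Icc p (p + δ) ∧ x 1 - 0 ∈ Icc (-3 : ℝ) 3} ≤
      ENNReal.ofReal (6 * δ) := by
    intro p
    refine (volume_strip_le (c := fun _ => 0) continuous_const (by linarith) _ _).trans
      (ENNReal.ofReal_le_ofReal (by linarith))
  have h0 := hend (-δ)
  rw [neg_add_cancel] at h0
  refine (measure_union_le _ _).trans ((add_le_add hcells ((measure_union_le _ _).trans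
    (add_le_add h0 (hend 1)))).trans ?_)
  rw [← ENNReal.ofReal_add (by positivity) (by positivity),
    ← ENNReal.ofReal_add (by positivity) (by positivity)]
  refine ENNReal.ofReal_le_ofReal ?_
  have h2 : (2 : ℝ) ^ N * (1 / 2) ^ N = 1 := by rw [← mul_pow]; norm_num
  have h3 : 8 * δ * 2 ^ N / N = 1 / 2 / N := by
    rw [hδ]
    congr 1
    linear_combination (1 / 2 : ℝ) * h2
  have h4 : δ ≤ 1 / 16 / N := by
    rw [hδ, le_div_iff₀ hN0]
    have : (N : ℝ) ≤ 2 ^ N := by exact_mod_cast Nat.lt_two_pow_self.le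
    nlinarith [(by positivity : (0 : ℝ) < (1 / 2) ^ N)]
  rw [h3]
  calc 2 / (N : ℝ) + 1 / 2 / N + (6 * δ + 6 * δ)
      ≤ 2 / (N : ℝ) + 1 / 2 / N + (6 * (1 / 16 / N) + 6 * (1 / 16 / N)) := by gcongr
    _ ≤ 4 / N := by
        field_simp
        norm_num

/-- Tubes in the plane of width `2 ^ (-N) / 16` can be compressed by a factor of order `N`. -/
theorem exists_isTubeCompression_two : ∃ C : ℝ, 0 < C ∧ ∀ N : ℕ, 1 ≤ N →
    IsTubeCompression 2 ((1 / 2) ^ N / 16) (C / N) := by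
  set v : ℝ := tubeVolume 1 1 with hv
  have hv0 : 0 < v := tubeVolume_pos 1 one_pos
  -- The `2^N` tubes have total area `v / 16`, whatever `N` is, against at most `4 / N` for their
  -- union.
  refine ⟨64 / v, by positivity, fun N hN => ?_⟩
  have hN0 : (0 : ℝ) < N := by exact_mod_cast hN
  have hδ0 : (0 : ℝ) < (1 / 2) ^ N / 16 := by positivity
  have hcard : (Finset.range N).powerset.card = 2 ^ N := by simp
  let e := (Finset.equivFinOfCardEq hcard).symm
  have he : ∀ j, (e j : Finset ℕ) ⊆ Finset.range N := fun j => Finset.mem_powerset.1 (e j).2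
  refine ⟨by positivity, 2 ^ N, by positivity, fun j => kakeyaTube N (e j), fun i j hij => ?_, ?_⟩
  · exact kakeyaTube_disjoint_reach hN (he i) (he j)
      fun h => hij (e.injective (Subtype.ext h))
  · have hsum : ∑ j, volume.real ((kakeyaTube N (e j)).body ((1 / 2) ^ N / 16)) = v / 16 := by
      have h1 : ∀ j, volume.real ((kakeyaTube N (e j)).body ((1 / 2) ^ N / 16)) =
          (1 / 2) ^ N / 16 * v := by
        intro j
        rw [measureReal_def, Tube.volume_body (k := 1) _ hδ0,
          ENNReal.toReal_ofReal (tubeVolume_pos 1 hδ0).le, hv, tubeVolume, tubeVolume]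
        ring
      simp_rw [h1]
      rw [Finset.sum_const, Finset.card_univ, Fintype.card_fin, nsmul_eq_mul]
      have h2 : (2 : ℝ) ^ N * (1 / 2) ^ N = 1 := by rw [← mul_pow]; norm_num
      push_cast
      linear_combination v / 16 * h2
    rw [hsum]
    have hU := ENNReal.toReal_le_of_le_ofReal (by positivity)
      (volume_iUnion_kakeyaTube_le hN (fun j => (e j : Finset ℕ)) he)
    rw [div_le_iff₀ (by positivity)]
    refine hU.trans (le_of_eq ?_)
    field_simp
    norm_num

end KakeyaCompression

/-! ### Decay of the blocks in the plane -/

section Planar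

open Set Filter

theorem abs_inv_sub_half_le {p : ℝ≥0∞} (hp : 1 < p) (hpt : p < ⊤) :
    |1 / p.toReal - 1 / 2| ≤ 1 / 2 := by
  have h1 : 1 < p.toReal := by
    rwa [← ENNReal.toReal_one, ENNReal.toReal_lt_toReal (by simp) hpt.ne]
  have h2 : 0 < 1 / p.toReal := by positivity
  have h3 : 1 / p.toReal < 1 := by rw [div_lt_one (by linarith)]; exact h1
  rw [abs_le]
  constructor <;> linarith

/-- With `N = n/4 + 1` and `δ = 2^(-N)/16` this says `2^n δ² ≥ n / 4096`. -/
theorem nat_mul_four_pow_le (n : ℕ) : n * 4 ^ (n / 4 + 1) ≤ 16 * 2 ^ n := by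
  have h1 : n / 4 < 4 ^ (n / 4) := Nat.lt_pow_self (by norm_num)
  have h2 : n ≤ 4 * 4 ^ (n / 4) := by omega
  have h3 : (4 : ℕ) ^ (n / 4) * 4 ^ (n / 4) ≤ 2 ^ n := by
    rw [← pow_add, show (4 : ℕ) = 2 ^ 2 by norm_num, ← pow_mul]
    exact Nat.pow_le_pow_right (by norm_num) (by omega)
  calc n * 4 ^ (n / 4 + 1) ≤ 4 * 4 ^ (n / 4) * 4 ^ (n / 4 + 1) := Nat.mul_le_mul_right _ h2
    _ = 16 * (4 ^ (n / 4) * 4 ^ (n / 4)) := by ring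
    _ ≤ _ := Nat.mul_le_mul_left _ h3

/-- In the plane the dyadic averages decay like a power of the number of the scale. -/
theorem HasTubeBound.exists_norm_le_planar {v : ℝ → ℂ} (hv : HasTubeBound 1 v) :
    ∃ C : ℝ, 0 ≤ C ∧ ∀ (p : ℝ≥0∞) [Fact (1 ≤ p)], 1 < p → p < ⊤ →
    ∀ m : ℝ → ℝ, IsBoundedMeasurableOnPos m →
    ∀ T : Lp ℂ p (volume : Measure (Euc 2)) →L[ℂ] Lp ℂ p (volume : Measure (Euc 2)),
      IsRadialMultiplier m T → ∀ n : ℕ, 1 ≤ n → ∀ t : ℝ,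
      ‖dilatedAverage v (fun s => m (Real.exp s)) (2 ^ n) t‖ ≤
        C * ‖T‖ * (n : ℝ) ^ (-|1 / p.toReal - 1 / 2|) := by
  obtain ⟨C₀, hC₀, hK⟩ := exists_isTubeCompression_two
  obtain ⟨C₁, hC₁, h⟩ := hv.exists_norm_le
  refine ⟨C₁ * (4 * (C₀ + 1) + 4096), by positivity,
    fun p _ hp1 hpt m hm T hT n hn t => ?_⟩
  set a := |1 / p.toReal - 1 / 2| with ha
  have ha0 : 0 ≤ a := abs_nonneg _
  have ha1 : a ≤ 1 := (abs_inv_sub_half_le hp1 hpt).trans (by norm_num)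
  -- Small enough for `1 / (2^n δ²)` to be at most of order `1/n`, yet comparable with `n`, so that
  -- the ratio `C₀ / N` is of order `1/n`.
  set N := n / 4 + 1 with hN
  have hN1 : 1 ≤ N := by omega
  have hn0 : (0 : ℝ) < n := by exact_mod_cast hn
  have hn1 : (1 : ℝ) ≤ n := by exact_mod_cast hn
  have hN0 : (0 : ℝ) < N := by exact_mod_cast hN1
  have hpow1 := half_pow_le_one N
  refine (h p hp1 hpt m hm T hT _ _ (by positivity) (by linarith) (hK N hN1) _ t
    (by positivity)).trans ?_
  have hfirst : (C₀ / N) ^ a ≤ 4 * (C₀ + 1) * (n : ℝ) ^ (-a) := by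
    have hle : C₀ / N ≤ 4 * (C₀ + 1) / n := by
      rw [div_le_div_iff₀ hN0 hn0]
      have : (n : ℝ) ≤ 4 * N := by exact_mod_cast (by omega : n ≤ 4 * N)
      nlinarith
    -- A base at least `1` and `a ≤ 1` give a constant independent of `p`.
    have hbase : 1 ≤ 4 * (C₀ + 1) := by linarith
    calc (C₀ / N) ^ a ≤ (4 * (C₀ + 1) / n) ^ a := by gcongr
      _ = (4 * (C₀ + 1)) ^ a * (n : ℝ) ^ (-a) := by
          rw [Real.div_rpow (by positivity) hn0.le, Real.rpow_neg hn0.le, div_eq_mul_inv]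
      _ ≤ (4 * (C₀ + 1)) ^ (1 : ℝ) * (n : ℝ) ^ (-a) := by gcongr
      _ = _ := by rw [Real.rpow_one]
  have hsecond : 1 / ((2 : ℝ) ^ n * ((1 / 2) ^ N / 16) ^ 2) ≤ 4096 * (n : ℝ) ^ (-a) := by
    have h1 : (n : ℝ) * 4 ^ N ≤ 16 * 2 ^ n := by exact_mod_cast nat_mul_four_pow_le n
    have h4 : ((1 / 2 : ℝ) ^ N / 16) ^ 2 * (256 * 4 ^ N) = 1 := by
      have : ((1 / 2 : ℝ) ^ N) ^ 2 * 4 ^ N = 1 := by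
        rw [← pow_mul, mul_comm N 2, pow_mul, ← mul_pow]
        norm_num
      linear_combination this
    have h2 : 1 / ((2 : ℝ) ^ n * ((1 / 2) ^ N / 16) ^ 2) ≤ 4096 * (1 / n) := by
      rw [mul_one_div, div_le_div_iff₀ (by positivity) hn0]
      set x := ((1 / 2 : ℝ) ^ N / 16) ^ 2 with hx
      have hx0 : 0 < x := by positivity
      calc 1 * (n : ℝ) = x * 256 * (n * 4 ^ N) := by linear_combination -(n : ℝ) * h4
        _ ≤ x * 256 * (16 * 2 ^ n) := by gcongr
        _ = _ := by ring
    refine h2.trans ?_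
    gcongr
    rw [one_div, ← Real.rpow_neg_one]
    exact Real.rpow_le_rpow_of_exponent_le hn1 (by linarith)
  have hT0 := norm_nonneg T
  calc C₁ * ‖T‖ * ((C₀ / N) ^ a + 1 / ((2 : ℝ) ^ n * ((1 / 2) ^ N / 16) ^ 2))
      ≤ C₁ * ‖T‖ * (4 * (C₀ + 1) * (n : ℝ) ^ (-a) + 4096 * (n : ℝ) ^ (-a)) := by gcongr
    _ = _ := by ring

/-- Two geometric series, one descending from `N` and one ascending from `N + 1`. The shift by one
allows for a centre between the two integers. -/
theorem sum_range_pow_dist_le {ρ : ℝ} (h0 : 0 ≤ ρ) (h1 : ρ < 1) (N K : ℕ) :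
    ∑ n ∈ Finset.range K, (if n ≤ N then ρ ^ (N - n) else ρ ^ (n - (N + 1))) ≤
      2 * (1 - ρ)⁻¹ := by
  have hgeom : ∀ M : ℕ, ∑ n ∈ Finset.range M, ρ ^ n ≤ (1 - ρ)⁻¹ := fun M => by
    rw [← tsum_geometric_of_lt_one h0 h1]
    exact (summable_geometric_of_lt_one h0 h1).sum_le_tsum _ fun _ _ => by positivity
  have hsub : Finset.range K ⊆ Finset.range (N + 1 + K) := Finset.range_mono (by omega)
  refine (Finset.sum_le_sum_of_subset_of_nonneg hsub fun n _ _ => by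
    split_ifs <;> positivity).trans ?_
  rw [Finset.sum_range_add]
  have e1 : ∑ n ∈ Finset.range (N + 1), (if n ≤ N then ρ ^ (N - n) else ρ ^ (n - (N + 1))) =
      ∑ n ∈ Finset.range (N + 1), ρ ^ n := by
    rw [← Finset.sum_range_reflect]
    refine Finset.sum_congr rfl fun n hn => ?_
    have := Finset.mem_range.1 hn
    rw [if_pos (by omega)]
    congr 1
    omega
  have e2 : ∑ n ∈ Finset.range K, (if N + 1 + n ≤ N then ρ ^ (N - (N + 1 + n))
      else ρ ^ (N + 1 + n - (N + 1))) = ∑ n ∈ Finset.range K, ρ ^ n := by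
    refine Finset.sum_congr rfl fun n _ => ?_
    rw [if_neg (by omega), Nat.add_sub_cancel_left]
  rw [e1, e2]
  linarith [hgeom (N + 1), hgeom K]

/-- A polynomially decaying sequence, averaged with exponential weights around `x / log 2`. -/
theorem exists_sum_rpow_mul_exp_le : ∃ C : ℝ, 0 < C ∧ ∀ a : ℝ, 0 ≤ a → a ≤ 1 → ∀ x : ℝ, 0 < x →
    ∀ K : ℕ, ∑ n ∈ Finset.range K,
      (max (n : ℝ) 1) ^ (-a) * Real.exp (-|n * Real.log 2 - x|) ≤ C * x ^ (-a) := by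
  have hlog : 0 < Real.log 2 := Real.log_pos (by norm_num)
  have hlog1 : Real.log 2 ≤ 1 := by
    have := Real.log_le_sub_one_of_pos (two_pos : (0 : ℝ) < 2)
    linarith
  set ρ := Real.exp (-(Real.log 2 / 2)) with hρ
  have hρ0 : 0 < ρ := Real.exp_pos _
  have hρ1 : ρ < 1 := by
    rw [hρ, Real.exp_lt_one_iff]
    linarith
  have hinv : 0 < (1 - ρ)⁻¹ := inv_pos.2 (by linarith)
  refine ⟨4 * (1 - ρ)⁻¹, by positivity, fun a ha0 ha1 x hx K => ?_⟩
  set N := ⌊x / Real.log 2⌋₊ with hN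
  have hN1 : (N : ℝ) * Real.log 2 ≤ x := by
    rw [← le_div_iff₀ hlog]
    exact Nat.floor_le (by positivity)
  have hN2 : x < (N + 1) * Real.log 2 := by
    rw [← div_lt_iff₀ hlog]
    exact Nat.lt_floor_add_one _
  have hterm : ∀ n : ℕ, (max (n : ℝ) 1) ^ (-a) * Real.exp (-|n * Real.log 2 - x|) ≤
      2 * x ^ (-a) * (if n ≤ N then ρ ^ (N - n) else ρ ^ (n - (N + 1))) := by
    intro n
    set r := |n * Real.log 2 - x| with hr
    have hr0 : 0 ≤ r := abs_nonneg _
    set b := max (n : ℝ) 1 with hb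
    have hb1 : 1 ≤ b := le_max_right _ _
    have hb0 : 0 < b := by linarith
    -- Replacing `max n 1` by `x` loses only a factor `1 + r`, with `r` the distance in the
    -- exponent; half of the exponential absorbs it.
    have hxb : x ≤ (1 + r) * b := by
      have hxr : x - n * Real.log 2 ≤ r := by rw [hr, abs_sub_comm]; exact le_abs_self _
      have : (n : ℝ) * Real.log 2 ≤ b := by
        have : (n : ℝ) ≤ b := le_max_left _ _
        have hn0 : (0 : ℝ) ≤ n := Nat.cast_nonneg n
        nlinarith
      nlinarith
    have hpow : b ^ (-a) ≤ (1 + r) * x ^ (-a) := by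
      rw [Real.rpow_neg hb0.le, Real.rpow_neg hx.le, ← div_eq_mul_inv,
        inv_le_iff_one_le_mul₀ (by positivity), div_mul_eq_mul_div, le_div_iff₀ (by positivity),
        one_mul]
      calc x ^ a ≤ ((1 + r) * b) ^ a := by gcongr
        _ = (1 + r) ^ a * b ^ a := Real.mul_rpow (by positivity) hb0.le
        _ ≤ (1 + r) ^ (1 : ℝ) * b ^ a := by gcongr; linarith
        _ = _ := by rw [Real.rpow_one]
    have hexp : (1 + r) * Real.exp (-r) ≤ 2 * Real.exp (-(r / 2)) := by
      have h1 : 1 + r ≤ 2 * Real.exp (r / 2) := by linarith [Real.add_one_le_exp (r / 2)]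
      calc (1 + r) * Real.exp (-r) ≤ 2 * Real.exp (r / 2) * Real.exp (-r) := by gcongr
        _ = _ := by rw [mul_assoc, ← Real.exp_add]; congr 2; ring
    have hdist : Real.exp (-(r / 2)) ≤ if n ≤ N then ρ ^ (N - n) else ρ ^ (n - (N + 1)) := by
      split_ifs with hn
      · rw [hρ, ← Real.exp_nat_mul, Real.exp_le_exp, Nat.cast_sub hn]
        have : x - n * Real.log 2 ≤ r := by rw [hr, abs_sub_comm]; exact le_abs_self _
        nlinarith
      · rw [hρ, ← Real.exp_nat_mul, Real.exp_le_exp, Nat.cast_sub (by omega)]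
        have : n * Real.log 2 - x ≤ r := le_abs_self _
        push_cast
        nlinarith
    have hx0 : 0 < x ^ (-a) := by positivity
    calc b ^ (-a) * Real.exp (-r) ≤ (1 + r) * x ^ (-a) * Real.exp (-r) := by gcongr
      _ = x ^ (-a) * ((1 + r) * Real.exp (-r)) := by ring
      _ ≤ x ^ (-a) * (2 * (if n ≤ N then ρ ^ (N - n) else ρ ^ (n - (N + 1)))) :=
          mul_le_mul_of_nonneg_left (by linarith) hx0.le
      _ = _ := by ring
  refine (Finset.sum_le_sum fun n _ => hterm n).trans ?_
  rw [← Finset.mul_sum]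
  calc 2 * x ^ (-a) * _ ≤ 2 * x ^ (-a) * (2 * (1 - ρ)⁻¹) := by
        gcongr
        exact sum_range_pow_dist_le hρ0.le hρ1 N K
    _ = _ := by ring

end Planar

/-! ### Second differences of a primitive at low and high frequencies -/

section SecondDifference

open Set Filter Topology Complex

theorem intervalIntegrable_of_abs_le {φ : ℝ → ℝ} (hφ : Measurable φ) {M : ℝ}
    (hM : ∀ s, |φ s| ≤ M) (a b : ℝ) : IntervalIntegrable φ volume a b := by
  refine (intervalIntegrable_const (c := M)).mono_fun hφ.aestronglyMeasurable
    (ae_of_all _ fun s => ?_)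
  exact (hM s).trans (le_abs_self M)

theorem contDiff_id_mul {v : ℝ → ℂ} (hv : ContDiff ℝ ∞ v) :
    ContDiff ℝ ∞ (fun x : ℝ => 2 * (Real.pi : ℂ) * I * x * v x) :=
  ((contDiff_const.mul ofRealCLM.contDiff).mul hv)

theorem hasCompactSupport_id_mul {v : ℝ → ℂ} (hvc : HasCompactSupport v) :
    HasCompactSupport (fun x : ℝ => 2 * (Real.pi : ℂ) * I * x * v x) :=
  HasCompactSupport.mul_left hvc

/-- Differentiating the kernel multiplies its Fourier transform by `2πix`, so derivatives of
averages are again averages of the same type. -/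
theorem hasDerivAt_fourierInv {v : ℝ → ℂ} (hv : ContDiff ℝ ∞ v) (hvc : HasCompactSupport v)
    (s : ℝ) : HasDerivAt (𝓕⁻ v) (𝓕⁻ (fun x : ℝ => 2 * (Real.pi : ℂ) * I * x * v x) s) s := by
  have h1 : Integrable v := hv.continuous.integrable_of_hasCompactSupport hvc
  have h2 : Integrable (fun x : ℝ => x • v x) := by
    refine Continuous.integrable_of_hasCompactSupport (continuous_id.smul hv.continuous) ?_
    exact hvc.mono fun x hx h0 => hx (by simp [h0])
  have h := (Real.hasDerivAt_fourier h1 h2 (-s)).scomp s (hasDerivAt_neg s)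
  have e : (𝓕 v) ∘ Neg.neg = 𝓕⁻ v := by
    ext x
    rw [Function.comp_apply, Real.fourierInv_eq_fourier_neg]
  rw [e] at h
  have e' : 𝓕⁻ (fun x : ℝ => 2 * (Real.pi : ℂ) * I * x * v x) s =
      (-1 : ℝ) • 𝓕 (fun x : ℝ => (-2 * (Real.pi : ℂ) * I * x) • v x) (-s) := by
    rw [Real.fourierInv_eq_fourier_neg, Real.fourier_eq, Real.fourier_eq, ← integral_smul]
    congr 1
    ext x
    simp only [Circle.smul_def, smul_eq_mul, neg_smul, one_smul]
    ring
  rw [e']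
  exact h

theorem dilatedAverage_eq_integral_sub {v : ℝ → ℂ} (φ : ℝ → ℝ) (t : ℝ) :
    dilatedAverage v φ 1 t = ∫ r, 𝓕⁻ v (t - r) * (φ r : ℂ) := by
  rw [dilatedAverage, ← integral_sub_left_eq_self _ _ t]
  simp

/-- The derivative of an average is an average. -/
theorem dilatedAverage_one_sub {v : ℝ → ℂ} (hv : ContDiff ℝ ∞ v) (hvc : HasCompactSupport v)
    {φ : ℝ → ℝ} (hφ : Measurable φ) {M : ℝ} (hM : ∀ s, |φ s| ≤ M) (a b : ℝ) :
    dilatedAverage v φ 1 b - dilatedAverage v φ 1 a =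
      ∫ u in a..b, dilatedAverage (fun x : ℝ => 2 * (Real.pi : ℂ) * I * x * v x) φ 1 u := by
  set v' : ℝ → ℂ := fun x : ℝ => 2 * (Real.pi : ℂ) * I * x * v x with hv'
  have hint' : Integrable (𝓕⁻ v') :=
    integrable_fourierInv (contDiff_id_mul hv) (hasCompactSupport_id_mul hvc)
  have hint : Integrable (𝓕⁻ v) := integrable_fourierInv hv hvc
  have hcont' : Continuous (𝓕⁻ v') := by
    refine continuous_iff_continuousAt.2 fun s => ?_
    exact (hasDerivAt_fourierInv (contDiff_id_mul hv) (hasCompactSupport_id_mul hvc)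
      s).continuousAt
  have hbdd : ∀ t, Integrable (fun r => 𝓕⁻ v (t - r) * (φ r : ℂ)) := fun t =>
    (hint.comp_sub_left t).mul_bdd (c := M)
      (Complex.measurable_ofReal.comp hφ).aestronglyMeasurable
      (ae_of_all _ fun s => by simpa using hM s)
  have hbdd' : ∀ t, Integrable (fun r => 𝓕⁻ v' (t - r) * (φ r : ℂ)) := fun t =>
    (hint'.comp_sub_left t).mul_bdd (c := M)
      (Complex.measurable_ofReal.comp hφ).aestronglyMeasurable
      (ae_of_all _ fun s => by simpa using hM s)
  simp_rw [dilatedAverage_eq_integral_sub]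
  have hprod : Integrable (Function.uncurry fun u r => 𝓕⁻ v' (u - r) * (φ r : ℂ))
      ((volume.restrict (uIoc a b)).prod volume) := by
    have hmeas : AEStronglyMeasurable (Function.uncurry fun u r => 𝓕⁻ v' (u - r) * (φ r : ℂ))
        ((volume.restrict (uIoc a b)).prod volume) := by
      refine Measurable.aestronglyMeasurable ?_
      exact (hcont'.measurable.comp (measurable_fst.sub measurable_snd)).mul
        (Complex.measurable_ofReal.comp (hφ.comp measurable_snd))
    refine (integrable_prod_iff hmeas).2 ⟨ae_of_all _ fun u => hbdd' u, ?_⟩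
    have : IsFiniteMeasure (volume.restrict (uIoc a b)) := by
      rw [uIoc]; infer_instance
    refine Integrable.mono' (integrable_const (M * ∫ r, ‖𝓕⁻ v' r‖))
      hmeas.norm.integral_prod_right' (ae_of_all _ fun u => ?_)
    rw [Real.norm_of_nonneg (integral_nonneg fun _ => norm_nonneg _),
      ← integral_sub_left_eq_self (fun r => ‖𝓕⁻ v' r‖) _ u, ← integral_const_mul]
    refine integral_mono (hbdd' u).norm ((hint'.comp_sub_left u).norm.const_mul M) fun r => ?_
    simp only [Function.uncurry_apply_pair, norm_mul, norm_real]
    rw [mul_comm]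
    exact mul_le_mul_of_nonneg_right (hM r) (norm_nonneg _)
  rw [intervalIntegral_integral_swap hprod, ← integral_sub (hbdd b) (hbdd a)]
  congr 1
  ext r
  rw [intervalIntegral.integral_mul_const, ← sub_mul]
  congr 1
  rw [intervalIntegral.integral_comp_sub_right (fun u => 𝓕⁻ v' u)]
  exact (intervalIntegral.integral_eq_sub_of_hasDerivAt
    (fun s _ => hasDerivAt_fourierInv hv hvc s) (hcont'.intervalIntegrable _ _)).symm

theorem dilatedAverage_eq_comp_div (v : ℝ → ℂ) (φ : ℝ → ℝ) {L : ℝ} (hL : 0 < L) (t : ℝ) :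
    dilatedAverage v φ L t = dilatedAverage v (fun s => φ (s / L)) 1 (L * t) := by
  unfold dilatedAverage
  congr 1
  ext s
  rw [div_one]
  change _ = 𝓕⁻ v s * (φ ((L * t - s) / L) : ℂ)
  rw [sub_div, mul_div_cancel_left₀ _ hL.ne']

theorem dilatedAverage_sub {v : ℝ → ℂ} (hv : ContDiff ℝ ∞ v) (hvc : HasCompactSupport v)
    {φ : ℝ → ℝ} (hφ : Measurable φ) {M : ℝ} (hM : ∀ s, |φ s| ≤ M) {L : ℝ} (hL : 0 < L) (a b : ℝ) :
    dilatedAverage v φ L b - dilatedAverage v φ L a =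
      L * ∫ u in a..b, dilatedAverage (fun x : ℝ => 2 * (Real.pi : ℂ) * I * x * v x) φ L u := by
  have hφL : Measurable (fun s => φ (s / L)) := hφ.comp (by fun_prop)
  simp_rw [dilatedAverage_eq_comp_div _ φ hL]
  rw [dilatedAverage_one_sub hv hvc hφL (fun s => hM _),
    ← intervalIntegral.smul_integral_comp_mul_left, real_smul]

theorem norm_dilatedAverage_sub_le {v : ℝ → ℂ} (hv : ContDiff ℝ ∞ v) (hvc : HasCompactSupport v)
    {φ : ℝ → ℝ} (hφ : Measurable φ) {M : ℝ} (hM : ∀ s, |φ s| ≤ M) {L : ℝ} (hL : 0 < L) {X : ℝ}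
    (hX : ∀ u, ‖dilatedAverage (fun x : ℝ => 2 * (Real.pi : ℂ) * I * x * v x) φ L u‖ ≤ X)
    (a b : ℝ) :
    ‖dilatedAverage v φ L b - dilatedAverage v φ L a‖ ≤ L * X * |b - a| := by
  rw [dilatedAverage_sub hv hvc hφ hM hL, norm_mul, norm_real, Real.norm_of_nonneg hL.le,
    mul_assoc L X]
  exact mul_le_mul_of_nonneg_left
    (intervalIntegral.norm_integral_le_of_norm_le_const fun u _ => hX u) hL.le

theorem continuous_dilatedAverage {v : ℝ → ℂ} (hv : ContDiff ℝ ∞ v) (hvc : HasCompactSupport v)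
    {φ : ℝ → ℝ} (hφ : Measurable φ) {M : ℝ} (hM : ∀ s, |φ s| ≤ M) {L : ℝ} (hL : 0 < L) :
    Continuous (dilatedAverage v φ L) := by
  have hX := norm_dilatedAverage_le (integrable_fourierInv (contDiff_id_mul hv)
    (hasCompactSupport_id_mul hvc)) hM L
  have h := norm_dilatedAverage_sub_le hv hvc hφ hM hL hX
  set X := M * ∫ s, ‖𝓕⁻ (fun x : ℝ => 2 * (Real.pi : ℂ) * I * x * v x) s‖
  have hX0 : 0 ≤ X := (norm_nonneg _).trans (hX 0)
  refine (LipschitzWith.of_dist_le_mul (K := (L * X).toNNReal) fun b a => ?_).continuous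
  rw [Real.coe_toNNReal _ (by positivity), dist_eq_norm, Real.dist_eq]
  exact h a b

/-- The second difference of a primitive of `φ`. -/
def secondDifference (φ : ℝ → ℝ) (h t : ℝ) : ℝ :=
  (∫ s in (0 : ℝ)..(t + h), φ s) + (∫ s in (0 : ℝ)..(t - h), φ s) - 2 * ∫ s in (0 : ℝ)..t, φ s

theorem secondDifference_eq {φ : ℝ → ℝ} (hφ : Measurable φ) {M : ℝ} (hM : ∀ s, |φ s| ≤ M)
    (h t : ℝ) : secondDifference φ h t =
      (∫ s in t..(t + h), φ s) - ∫ s in (t - h)..t, φ s := by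
  have hi := intervalIntegrable_of_abs_le hφ hM
  rw [secondDifference, ← intervalIntegral.integral_interval_sub_left (hi 0 (t + h)) (hi 0 t),
    ← intervalIntegral.integral_interval_sub_left (hi 0 t) (hi 0 (t - h))]
  ring

theorem continuous_secondDifference {φ : ℝ → ℝ} (hφ : Measurable φ) {M : ℝ}
    (hM : ∀ s, |φ s| ≤ M) (h : ℝ) : Continuous (secondDifference φ h) := by
  have hF : Continuous fun t => ∫ s in (0 : ℝ)..t, φ s :=
    intervalIntegral.continuous_primitive (intervalIntegrable_of_abs_le hφ hM) 0
  exact ((hF.comp (continuous_add_const h)).add (hF.comp (continuous_id.sub continuous_const))).sub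
    (continuous_const.mul hF)

theorem abs_secondDifference_le {φ : ℝ → ℝ} (hφ : Measurable φ) {M : ℝ}
    (hM : ∀ s, |φ s| ≤ M) (h t : ℝ) : |secondDifference φ h t| ≤ 2 * M * |h| := by
  rw [secondDifference_eq hφ hM]
  have h1 := intervalIntegral.norm_integral_le_of_norm_le_const (a := t) (b := t + h)
    (f := φ) (C := M) fun x _ => hM x
  have h2 := intervalIntegral.norm_integral_le_of_norm_le_const (a := t - h) (b := t)
    (f := φ) (C := M) fun x _ => hM x
  rw [add_sub_cancel_left, Real.norm_eq_abs] at h1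
  rw [sub_sub_cancel, Real.norm_eq_abs] at h2
  refine (abs_sub _ _).trans ?_
  linarith

/-- Averaging commutes with integration over a moving interval. -/
theorem integral_fourierInv_mul_intervalIntegral {v : ℝ → ℂ} (hint : Integrable (𝓕⁻ v))
    {φ : ℝ → ℝ} (hφ : Measurable φ) {M : ℝ} (hM : ∀ s, |φ s| ≤ M) (L a b : ℝ) :
    (Integrable fun s => 𝓕⁻ v s * ((∫ u in a..b, φ (u - s / L) : ℝ) : ℂ)) ∧
    ∫ s, 𝓕⁻ v s * ((∫ u in a..b, φ (u - s / L) : ℝ) : ℂ) =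
      ∫ u in a..b, dilatedAverage v φ L u := by
  have hfin : IsFiniteMeasure (volume.restrict (uIoc a b)) := by
    rw [uIoc]; infer_instance
  have hmeas : Measurable (fun z : ℝ × ℝ => (φ (z.1 - z.2 / L) : ℂ)) :=
    Complex.measurable_ofReal.comp (hφ.comp (by fun_prop))
  have hprod : Integrable (Function.uncurry fun u s => 𝓕⁻ v s * (φ (u - s / L) : ℂ))
      ((volume.restrict (uIoc a b)).prod volume) := by
    have h1 : Integrable (fun z : ℝ × ℝ => (1 : ℂ) * 𝓕⁻ v z.2)
        ((volume.restrict (uIoc a b)).prod volume) := (integrable_const (1 : ℂ)).mul_prod hint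
    simp only [one_mul] at h1
    exact h1.mul_bdd (c := M) hmeas.aestronglyMeasurable
      (ae_of_all _ fun z => by simpa using hM _)
  have hinner : ∀ s, 𝓕⁻ v s * ((∫ u in a..b, φ (u - s / L) : ℝ) : ℂ) =
      ∫ u in a..b, 𝓕⁻ v s * (φ (u - s / L) : ℂ) := fun s => by
    rw [intervalIntegral.integral_const_mul, intervalIntegral.integral_ofReal]
  constructor
  · refine hint.mul_bdd (c := M * |b - a|) ?_ (ae_of_all _ fun s => ?_)
    · refine (Complex.measurable_ofReal.comp ?_).aestronglyMeasurable
      simp_rw [intervalIntegral.intervalIntegral_eq_integral_uIoc]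
      have : StronglyMeasurable (Function.uncurry fun s u : ℝ => φ (u - s / L)) :=
        (hφ.comp (by fun_prop)).stronglyMeasurable
      exact (this.integral_prod_right (ν := volume.restrict (uIoc a b))).measurable.const_smul
        (if a ≤ b then (1 : ℝ) else -1)
    · rw [norm_real]
      exact intervalIntegral.norm_integral_le_of_norm_le_const fun u _ => hM _
  · simp_rw [hinner]
    rw [← intervalIntegral_integral_swap hprod]
    rfl

theorem dilatedAverage_secondDifference {v : ℝ → ℂ} (hint : Integrable (𝓕⁻ v))
    {φ : ℝ → ℝ} (hφ : Measurable φ) {M : ℝ} (hM : ∀ s, |φ s| ≤ M) (h L t : ℝ) :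
    dilatedAverage v (secondDifference φ h) L t =
      (∫ u in t..(t + h), dilatedAverage v φ L u) - ∫ u in (t - h)..t, dilatedAverage v φ L u := by
  have h1 := integral_fourierInv_mul_intervalIntegral hint hφ hM L t (t + h)
  have h2 := integral_fourierInv_mul_intervalIntegral hint hφ hM L (t - h) t
  rw [← h1.2, ← h2.2, ← integral_sub h1.1 h2.1, dilatedAverage]
  congr 1
  ext s
  rw [secondDifference_eq hφ hM, ofReal_sub, mul_sub,
    intervalIntegral.integral_comp_sub_right, intervalIntegral.integral_comp_sub_right,
    add_sub_right_comm, sub_right_comm]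

/-- The bound for low frequencies. -/
theorem norm_dilatedAverage_secondDifference_le_low {v : ℝ → ℂ} (hv : ContDiff ℝ ∞ v)
    (hvc : HasCompactSupport v) {φ : ℝ → ℝ} (hφ : Measurable φ) {M : ℝ} (hM : ∀ s, |φ s| ≤ M)
    {L : ℝ} (hL : 0 < L) {X : ℝ}
    (hX : ∀ u, ‖dilatedAverage (fun x : ℝ => 2 * (Real.pi : ℂ) * I * x * v x) φ L u‖ ≤ X)
    {h : ℝ} (hh : 0 ≤ h) (t : ℝ) :
    ‖dilatedAverage v (secondDifference φ h) L t‖ ≤ L * X * h * h := by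
  have hc := continuous_dilatedAverage hv hvc hφ hM hL
  rw [dilatedAverage_secondDifference (integrable_fourierInv hv hvc) hφ hM]
  -- Shifting the second interval onto the first gives an integral over length `h` of increments
  -- over distance `h`, each at most `L X h`.
  have e : ∫ u in (t - h)..t, dilatedAverage v φ L u =
      ∫ u in t..(t + h), dilatedAverage v φ L (u - h) := by
    rw [intervalIntegral.integral_comp_sub_right, add_sub_cancel_right]
  have hc' : Continuous fun u => dilatedAverage v φ L (u - h) :=
    hc.comp (continuous_id.sub continuous_const)
  rw [e, ← intervalIntegral.integral_sub (hc.intervalIntegrable _ _)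
    (hc'.intervalIntegrable _ _)]
  refine (intervalIntegral.norm_integral_le_of_norm_le_const (C := L * X * h)
    fun u _ => ?_).trans_eq ?_
  · have := norm_dilatedAverage_sub_le hv hvc hφ hM hL hX (u - h) u
    rwa [sub_sub_cancel, abs_of_nonneg hh] at this
  · rw [add_sub_cancel_left, abs_of_nonneg hh]

/-- The bound for high frequencies. -/
theorem norm_dilatedAverage_secondDifference_le_high {u : ℝ → ℂ} (hu : ContDiff ℝ ∞ u)
    (huc : HasCompactSupport u) {φ : ℝ → ℝ} (hφ : Measurable φ) {M : ℝ} (hM : ∀ s, |φ s| ≤ M)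
    {L : ℝ} (hL : 0 < L) {Y : ℝ} (hY : ∀ t, ‖dilatedAverage u φ L t‖ ≤ Y) (h t : ℝ) :
    ‖dilatedAverage (fun x : ℝ => 2 * (Real.pi : ℂ) * I * x * u x) (secondDifference φ h) L t‖ ≤
      4 * Y / L := by
  rw [dilatedAverage_secondDifference (integrable_fourierInv (contDiff_id_mul hu)
    (hasCompactSupport_id_mul huc)) hφ hM, le_div_iff₀ hL, mul_comm]
  -- Here the averages are derivatives, so their integrals are increments of the averages with
  -- multiplier `u`, divided by `L`.
  have e1 := dilatedAverage_sub hu huc hφ hM hL t (t + h)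
  have e2 := dilatedAverage_sub hu huc hφ hM hL (t - h) t
  calc _ = ‖(dilatedAverage u φ L (t + h) - dilatedAverage u φ L t) -
        (dilatedAverage u φ L t - dilatedAverage u φ L (t - h))‖ := by
        rw [e1, e2, ← mul_sub, norm_mul, norm_real, Real.norm_of_nonneg hL.le]
    _ ≤ (Y + Y) + (Y + Y) := (norm_sub_le _ _).trans (add_le_add
        ((norm_sub_le _ _).trans (add_le_add (hY _) (hY _)))
        ((norm_sub_le _ _).trans (add_le_add (hY _) (hY _))))
    _ = _ := by ring

/-- Averages over small scales recover a bounded continuous function. -/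
theorem tendsto_dilatedAverage {v : ℝ → ℂ} (hv : ContDiff ℝ ∞ v) (hvc : HasCompactSupport v)
    {ψ : ℝ → ℝ} (hψ : Continuous ψ) {M : ℝ} (hM : ∀ s, |ψ s| ≤ M) (t : ℝ) :
    Tendsto (fun K : ℕ => dilatedAverage v ψ (2 ^ K) t) atTop (𝓝 (v 0 * ψ t)) := by
  have hint := integrable_fourierInv hv hvc
  -- Fourier inversion at the origin: the total mass of the kernel is `v 0`.
  have hv0 : v 0 = ∫ s, 𝓕⁻ v s := by
    have hF : Integrable (𝓕 v) := by
      have := hint.comp_neg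
      refine this.congr (ae_of_all _ fun s => ?_)
      simp only
      rw [Real.fourierInv_eq_fourier_neg, neg_neg]
    have := congr_fun (hv.continuous.fourier_fourierInv_eq
      (hv.continuous.integrable_of_hasCompactSupport hvc) hF) 0
    rw [← this, Real.fourier_eq]
    simp
  rw [hv0, ← integral_mul_const]
  refine tendsto_integral_of_dominated_convergence (fun s => ‖𝓕⁻ v s‖ * M) (fun K => ?_)
    (hint.norm.mul_const M) (fun K => ae_of_all _ fun s => ?_) (ae_of_all _ fun s => ?_)
  · refine hint.aestronglyMeasurable.mul (Continuous.aestronglyMeasurable ?_)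
    fun_prop
  · rw [norm_mul, norm_real]
    exact mul_le_mul_of_nonneg_left (hM _) (norm_nonneg _)
  · refine Tendsto.const_mul _ ((continuous_ofReal.tendsto _).comp ((hψ.tendsto' _ _ rfl).comp ?_))
    have h2 : Tendsto (fun K : ℕ => s / (2 : ℝ) ^ K) atTop (𝓝 0) :=
      (tendsto_pow_atTop_atTop_of_one_lt one_lt_two).const_div_atTop s
    simpa using h2.const_sub t

end SecondDifference

/-! ### Summing the blocks: smoothness of the primitive -/

section Zygmund

open Set Filter Topology Complex

namespace LittlewoodPaley

variable (P : LittlewoodPaley)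

theorem w₀_zero : P.w₀ 0 = 1 := by
  have h := P.partition 0
  have h0 : P.w 0 = 0 := P.w_eq_zero (by norm_num)
  simp only [abs_zero, zero_div, h0] at h
  linarith [h.unique hasSum_zero]

/-- The partition at `x / 2` is the partition at `x` with its index shifted, so the two series
differ by one term. Iterated, this identifies partial sums of blocks with dilates of `w₀`. -/
theorem w₀_half_mul (x : ℝ) : P.w₀ (1 / 2 * x) = P.w₀ x + P.w |1 / 2 * x| := by
  have h1 := (hasSum_nat_add_iff' 1).2 (P.partition x)
  have h2 := P.partition (1 / 2 * x)
  have e : (fun n : ℕ => P.w (|1 / 2 * x| / 2 ^ (n + 1))) =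
      fun n : ℕ => P.w (|x| / 2 ^ (n + 1 + 1)) := by
    ext n
    rw [abs_mul, abs_of_pos (by norm_num : (0 : ℝ) < 1 / 2), pow_succ _ (n + 1)]
    congr 1
    field_simp
  rw [e] at h2
  have h3 := h2.unique h1
  simp only [Finset.sum_range_one, zero_add, pow_one] at h3
  have e2 : |1 / 2 * x| = |x| / 2 := by
    rw [abs_mul, abs_of_pos (by norm_num : (0 : ℝ) < 1 / 2)]
    ring
  rw [e2]
  linarith

theorem hasCompactSupport_w_abs : HasCompactSupport (fun x => (P.w |x| : ℂ)) :=
  hasCompactSupport_of_ne_zero_abs_le (R := 2) fun _ hx =>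
    (P.abs_mem_of_w_abs_ne_zero (by exact_mod_cast hx)).2

theorem dilatedAverage_w₀_two_mul {ψ : ℝ → ℝ} (hψ : Measurable ψ) {M : ℝ} (hM : ∀ s, |ψ s| ≤ M)
    (L t : ℝ) : dilatedAverage (fun x => (P.w₀ x : ℂ)) ψ (2 * L) t =
      dilatedAverage (fun x => (P.w₀ x : ℂ)) ψ L t +
        dilatedAverage (fun x => (P.w |x| : ℂ)) ψ (2 * L) t := by
  have hhalf : (0 : ℝ) < 1 / 2 := by norm_num
  have e : 1 / 2 * (2 * L) = L := by ring
  have hw : ContDiff ℝ ∞ (fun x : ℝ => (P.w |1 / 2 * x| : ℂ)) :=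
    P.contDiff_w_abs.comp (contDiff_const.mul contDiff_id)
  have hwc : HasCompactSupport (fun x : ℝ => (P.w |1 / 2 * x| : ℂ)) :=
    hasCompactSupport_of_ne_zero_abs_le (R := 4) fun x hx => by
      have := (P.abs_mem_of_w_abs_ne_zero (x := 1 / 2 * x) (by exact_mod_cast hx)).2
      rw [abs_mul, abs_of_pos hhalf] at this
      linarith
  rw [← dilatedAverage_comp_mul (fun x => (P.w₀ x : ℂ)) ψ hhalf (2 * L),
    ← dilatedAverage_comp_mul (fun x => (P.w |x| : ℂ)) ψ hhalf (2 * L), e,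
    ← dilatedAverage_add P.contDiff_w₀ P.hasCompactSupport_w₀ hw hwc hψ hM]
  congr 1
  ext x
  rw [P.w₀_half_mul]
  push_cast
  rfl

theorem dilatedAverage_w₀_eq_sum {ψ : ℝ → ℝ} (hψ : Measurable ψ) {M : ℝ} (hM : ∀ s, |ψ s| ≤ M)
    (K : ℕ) (t : ℝ) : dilatedAverage (fun x => (P.w₀ x : ℂ)) ψ (2 ^ K) t =
      ∑ n ∈ Finset.range (K + 1), P.block n ψ t := by
  induction K with
  | zero => simp [P.block_zero_eq]
  | succ K ih =>
    rw [Finset.sum_range_succ, ← ih, pow_succ', P.dilatedAverage_w₀_two_mul hψ hM,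
      P.block_eq_dilatedAverage (by omega), pow_succ']

/-- The function whose averages are primitives of the Littlewood-Paley blocks. -/
def primitiveBump (x : ℝ) : ℂ := (P.w |x| : ℂ) * (2 * (Real.pi : ℂ) * I * x)⁻¹

theorem id_mul_primitiveBump :
    (fun x : ℝ => 2 * (Real.pi : ℂ) * I * x * P.primitiveBump x) = fun x => (P.w |x| : ℂ) := by
  ext x
  by_cases hx : x = 0
  · rw [hx, abs_zero, P.w_eq_zero (by norm_num)]
    simp
  · have : (x : ℂ) ≠ 0 := by exact_mod_cast hx
    have : 2 * (Real.pi : ℂ) * I * x ≠ 0 := by simp [Real.pi_ne_zero, hx]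
    rw [primitiveBump, mul_comm, inv_mul_cancel_right₀ this]

theorem primitiveBump_ne_zero {x : ℝ} (hx : P.primitiveBump x ≠ 0) : 1 / 2 ≤ |x| ∧ |x| ≤ 2 :=
  P.abs_mem_of_w_abs_ne_zero fun h => hx (by rw [primitiveBump, h]; simp)

theorem contDiff_primitiveBump : ContDiff ℝ ∞ P.primitiveBump := by
  refine contDiff_iff_contDiffAt.2 fun x => ?_
  by_cases hx : x = 0
  · refine (contDiffAt_const (c := (0 : ℂ))).congr_of_eventuallyEq ?_
    filter_upwards [Metric.ball_mem_nhds x (by norm_num : (0 : ℝ) < 1 / 2)] with y hy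
    rw [hx, mem_ball_zero_iff, Real.norm_eq_abs] at hy
    by_contra h
    linarith [(P.primitiveBump_ne_zero h).1]
  · refine P.contDiff_w_abs.contDiffAt.mul (ContDiffAt.inv
      (contDiff_const.mul ofRealCLM.contDiff).contDiffAt ?_)
    simp [Real.pi_ne_zero, hx]

end LittlewoodPaley

theorem secondDifference_congr_ae {φ ψ : ℝ → ℝ} (h : φ =ᵐ[volume] ψ) :
    secondDifference φ = secondDifference ψ := by
  have e : ∀ a b : ℝ, ∫ s in a..b, φ s = ∫ s in a..b, ψ s := fun a b =>
    intervalIntegral.integral_congr_ae (h.mono fun x hx _ => hx)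
  ext r t
  simp only [secondDifference, e]

/-- Partial sums of the blocks are averages at scale `2^(-K)` with kernel of mass `w₀ 0 = 1`. They
converge at every point because the second difference is continuous. -/
theorem abs_secondDifference_le_of_forall_block (P : LittlewoodPaley) {φ : ℝ → ℝ}
    (hφ : Measurable φ) {M : ℝ} (hM : ∀ s, |φ s| ≤ M) {h t B : ℝ}
    (hB : ∀ K : ℕ, ∑ n ∈ Finset.range K, ‖P.block n (secondDifference φ h) t‖ ≤ B) :
    |secondDifference φ h t| ≤ B := by
  have hc := continuous_secondDifference hφ hM h
  have hb := abs_secondDifference_le hφ hM h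
  have hlim := (tendsto_dilatedAverage P.contDiff_w₀ P.hasCompactSupport_w₀ hc hb t).norm
  rw [P.w₀_zero, ofReal_one, one_mul, norm_real, Real.norm_eq_abs] at hlim
  refine le_of_tendsto' hlim fun K => ?_
  rw [P.dilatedAverage_w₀_eq_sum hc.measurable hb]
  exact (norm_sum_le _ _).trans (hB _)

theorem norm_block_planar_le (P : LittlewoodPaley) : ∃ C : ℝ, 0 ≤ C ∧
    ∀ (p : ℝ≥0∞) [Fact (1 ≤ p)], 1 < p → p < ⊤ →
    ∀ m : ℝ → ℝ, IsBoundedMeasurableOnPos m →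
    ∀ T : Lp ℂ p (volume : Measure (Euc 2)) →L[ℂ] Lp ℂ p (volume : Measure (Euc 2)),
      IsRadialMultiplier m T →
    ∀ n : ℕ, 1 ≤ n → ∀ t : ℝ,
      ‖P.block n (fun s => m (Real.exp s)) t‖ ≤
        C * ‖T‖ * (n : ℝ) ^ (-|1 / p.toReal - 1 / 2|) := by
  obtain ⟨C, hC, h⟩ := (P.hasTubeBound_w_abs 1).exists_norm_le_planar
  refine ⟨C, hC, fun p _ hp1 hpt m hm T hT n hn t => ?_⟩
  rw [P.block_eq_dilatedAverage hn]
  exact h p hp1 hpt m hm T hT n hn t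

/-- The low frequency bound carries the factor `2^n h` and the high frequency bound its inverse; the
smaller of the two is the exponential in the statement. -/
theorem norm_block_secondDifference_le (P : LittlewoodPaley) {φ : ℝ → ℝ} (hφ : Measurable φ)
    {M : ℝ} (hM : ∀ s, |φ s| ≤ M) {n : ℕ} (hn : 1 ≤ n) {X Y h : ℝ} (hh : 0 < h)
    (hX : ∀ u, ‖dilatedAverage (fun x : ℝ => 2 * (Real.pi : ℂ) * I * x * (P.w |x| : ℂ)) φ (2 ^ n) u‖
      ≤ X)
    (hY : ∀ u, ‖dilatedAverage P.primitiveBump φ (2 ^ n) u‖ ≤ Y) (t : ℝ) :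
    ‖P.block n (secondDifference φ h) t‖ ≤
      (X + 4 * Y) * h * Real.exp (-|n * Real.log 2 + Real.log h|) := by
  have hX0 : 0 ≤ X := (norm_nonneg _).trans (hX 0)
  have hY0 : 0 ≤ Y := (norm_nonneg _).trans (hY 0)
  have hL : (0 : ℝ) < 2 ^ n := by positivity
  have hLh : (2 : ℝ) ^ n * h = Real.exp (n * Real.log 2 + Real.log h) := by
    rw [Real.exp_add, Real.exp_log hh, mul_comm (n : ℝ), Real.exp_mul, Real.exp_log two_pos,
      Real.rpow_natCast]
  rw [P.block_eq_dilatedAverage hn]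
  rcases le_total (n * Real.log 2 + Real.log h) 0 with hle | hle
  · rw [abs_of_nonpos hle, neg_neg, ← hLh]
    refine (norm_dilatedAverage_secondDifference_le_low P.contDiff_w_abs
      P.hasCompactSupport_w_abs hφ hM hL hX hh.le t).trans ?_
    calc 2 ^ n * X * h * h = X * h * (2 ^ n * h) := by ring
      _ ≤ _ := by
        gcongr
        linarith
  · rw [abs_of_nonneg hle, Real.exp_neg, ← hLh, ← P.id_mul_primitiveBump]
    refine (norm_dilatedAverage_secondDifference_le_high P.contDiff_primitiveBump
      (hasCompactSupport_of_ne_zero_abs_le fun x hx => (P.primitiveBump_ne_zero hx).2) hφ hM hL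
      hY h t).trans ?_
    calc 4 * Y / 2 ^ n = 4 * Y * h * (2 ^ n * h)⁻¹ := by field_simp
      _ ≤ _ := by
        gcongr
        linarith

theorem norm_block_zero_secondDifference_le (P : LittlewoodPaley) {φ : ℝ → ℝ} (hφ : Measurable φ)
    {M : ℝ} (hM : ∀ s, |φ s| ≤ M) {X h : ℝ} (hh : 0 < h)
    (hX : ∀ u, ‖dilatedAverage (fun x : ℝ => 2 * (Real.pi : ℂ) * I * x * (P.w₀ x : ℂ)) φ 1 u‖ ≤ X)
    (t : ℝ) : ‖P.block 0 (secondDifference φ h) t‖ ≤ X * h * h := by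
  rw [P.block_zero_eq]
  exact (norm_dilatedAverage_secondDifference_le_low P.contDiff_w₀ P.hasCompactSupport_w₀ hφ
    hM one_pos hX hh.le t).trans_eq (by ring)

/-- Decay of the Littlewood-Paley blocks gives a modulus of smoothness of the primitive. -/
theorem exists_abs_secondDifference_div_le (P : LittlewoodPaley) : ∃ C : ℝ, 0 < C ∧
    ∀ φ : ℝ → ℝ, Measurable φ → ∀ M : ℝ, (∀ s, |φ s| ≤ M) →
    ∀ a A : ℝ, 0 ≤ a → a ≤ 1 → 0 ≤ A →
    (∀ u, ‖dilatedAverage (fun x : ℝ => 2 * (Real.pi : ℂ) * I * x * (P.w₀ x : ℂ)) φ 1 u‖ ≤ A) →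
    (∀ n : ℕ, 1 ≤ n → ∀ u,
      ‖dilatedAverage (fun x : ℝ => 2 * (Real.pi : ℂ) * I * x * (P.w |x| : ℂ)) φ (2 ^ n) u‖ ≤
        A * (n : ℝ) ^ (-a)) →
    (∀ n : ℕ, 1 ≤ n → ∀ u, ‖dilatedAverage P.primitiveBump φ (2 ^ n) u‖ ≤ A * (n : ℝ) ^ (-a)) →
    ∀ h : ℝ, 0 < h → h < 1 → ∀ t : ℝ,
      |secondDifference φ h t| / h ≤ C * A * |Real.log h| ^ (-a) := by
  obtain ⟨C, hC, hsum⟩ := exists_sum_rpow_mul_exp_le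
  refine ⟨5 * C, by positivity,
    fun φ hφ M hM a A ha0 ha1 hA h₀ h₁ h₂ h hh hh1 t => ?_⟩
  have hlog := Real.log_neg hh hh1
  have hterm : ∀ n : ℕ, ‖P.block n (secondDifference φ h) t‖ ≤
      5 * A * h * ((max (n : ℝ) 1) ^ (-a) * Real.exp (-|n * Real.log 2 - -Real.log h|)) := by
    intro n
    rcases Nat.eq_zero_or_pos n with rfl | hn
    -- For `n = 0` the weight is `1` and the exponential is `h` itself, matching the bound `A h²`
    -- for the block.
    · rw [Nat.cast_zero, max_eq_right zero_le_one, Real.one_rpow, one_mul, zero_mul, zero_sub,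
        neg_neg, abs_of_neg hlog, neg_neg, Real.exp_log hh]
      refine (norm_block_zero_secondDifference_le P hφ hM hh h₀ t).trans ?_
      gcongr
      linarith
    · rw [max_eq_left (by exact_mod_cast hn), sub_neg_eq_add]
      refine (norm_block_secondDifference_le P hφ hM hn hh (h₁ n hn) (h₂ n hn) t).trans_eq ?_
      ring
  rw [div_le_iff₀ hh, abs_of_neg hlog]
  refine abs_secondDifference_le_of_forall_block P hφ hM fun N => ?_
  refine (Finset.sum_le_sum fun n _ => hterm n).trans ?_
  rw [← Finset.mul_sum]
  calc 5 * A * h * _ ≤ 5 * A * h * (C * (-Real.log h) ^ (-a)) := by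
        gcongr
        exact hsum a ha0 ha1 _ (neg_pos.2 hlog) N
    _ = _ := by ring

/-- The modulus of smoothness of a primitive of the symbol of a radial multiplier of the plane. -/
theorem secondDifference_planar_le (P : LittlewoodPaley) : ∃ C : ℝ, 0 ≤ C ∧
    ∀ (p : ℝ≥0∞) [Fact (1 ≤ p)], 1 < p → p < ⊤ →
    ∀ m : ℝ → ℝ, IsBoundedMeasurableOnPos m →
    ∀ T : Lp ℂ p (volume : Measure (Euc 2)) →L[ℂ] Lp ℂ p (volume : Measure (Euc 2)),
      IsRadialMultiplier m T →
    ∀ h : ℝ, 0 < h → h < 1 → ∀ t : ℝ,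
      |secondDifference (fun s => m (Real.exp s)) h t| / h ≤
        C * ‖T‖ * |Real.log h| ^ (-|1 / p.toReal - 1 / 2|) := by
  -- Three multipliers occur: `2πix w₀`, used only at scale one and so without decay, and `2πix
  -- w(|x|)` and `w(|x|) / (2πix)`, both supported in the dyadic shell.
  obtain ⟨C₀, hC₀, h₀⟩ := LittlewoodPaley.exists_norm_dilatedAverage_le 1
    (integrable_fourierInv (contDiff_id_mul P.contDiff_w₀)
      (hasCompactSupport_id_mul P.hasCompactSupport_w₀))
  obtain ⟨C₁, hC₁, h₁⟩ := (hasTubeBound_of_dyadic 1 (contDiff_id_mul P.contDiff_w_abs)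
    fun x hx => P.abs_mem_of_w_abs_ne_zero fun h => hx (by simp [h])).exists_norm_le_planar
  obtain ⟨C₂, hC₂, h₂⟩ := (hasTubeBound_of_dyadic 1 P.contDiff_primitiveBump
    fun x hx => P.primitiveBump_ne_zero hx).exists_norm_le_planar
  obtain ⟨K, hK, hrep⟩ := exists_bounded_representative 1
  obtain ⟨C₃, hC₃, hdiff⟩ := exists_abs_secondDifference_div_le P
  refine ⟨C₃ * (C₀ + C₁ + C₂), by positivity, fun p _ hp1 hpt m hm T hT h hh hh1 t => ?_⟩
  obtain ⟨q, -, -, hpq, -⟩ := exists_holderConjugate hp1 hpt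
  obtain ⟨m₁, hm₁, hb, -, hae⟩ := hrep p hp1 hpt q hpq m hm T hT
  rw [← secondDifference_congr_ae hae, mul_assoc C₃]
  have hT0 : 0 ≤ ‖T‖ := norm_nonneg T
  have ha1 := abs_inv_sub_half_le hp1 hpt
  refine hdiff (fun s => m₁ (Real.exp s)) (hm₁.comp Real.measurable_exp) (K * ‖T‖) (fun s => hb _) _ _ (abs_nonneg _)
    (by linarith) (by positivity) (fun u => ?_) (fun n hn u => ?_) (fun n hn u => ?_) h hh hh1 t
  · rw [dilatedAverage_congr_ae _ hae one_pos]
    refine (h₀ p hp1 hpt m hm T hT 1 u one_pos).trans ?_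
    gcongr
    linarith
  · rw [dilatedAverage_congr_ae _ hae (L := 2 ^ n) (by positivity)]
    refine (h₁ p hp1 hpt m hm T hT n hn u).trans ?_
    gcongr
    linarith
  · rw [dilatedAverage_congr_ae _ hae (L := 2 ^ n) (by positivity)]
    refine (h₂ p hp1 hpt m hm T hT n hn u).trans ?_
    gcongr
    linarith

end Zygmund

end

theorem theorem1p4 (P : LittlewoodPaley) :
    (∀ d : ℕ, 1 ≤ d → ∃ C : ℝ, 0 < C ∧
      ∀ (p : ℝ≥0∞) [Fact (1 ≤ p)], 1 < p → p < ⊤ →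
      ∀ m : ℝ → ℝ, IsBoundedMeasurableOnPos m →
      ∀ T : Lp ℂ p (volume : Measure (Euc d)) →L[ℂ] Lp ℂ p (volume : Measure (Euc d)),
        IsRadialMultiplier m T →
      ∀ (n : ℕ) (t : ℝ),
        ‖P.block n (fun s => m (Real.exp s)) t‖ ≤
          C * ‖T‖ * ⨅ δ : Set.Ioo (0 : ℝ) 1,
            (tubeCompression d (δ : ℝ) ^ |1 / p.toReal - 1 / 2| +
              1 / ((2 : ℝ) ^ n * (δ : ℝ) ^ 2))) ∧
    (∃ C : ℝ, 0 < C ∧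
      ∀ (p : ℝ≥0∞) [Fact (1 ≤ p)], 1 < p → p < ⊤ →
      ∀ m : ℝ → ℝ, IsBoundedMeasurableOnPos m →
      ∀ T : Lp ℂ p (volume : Measure (Euc 2)) →L[ℂ] Lp ℂ p (volume : Measure (Euc 2)),
        IsRadialMultiplier m T →
      (∀ n : ℕ, 1 ≤ n → ∀ t : ℝ,
        ‖P.block n (fun s => m (Real.exp s)) t‖ ≤
          C * ‖T‖ * (n : ℝ) ^ (-|1 / p.toReal - 1 / 2|)) ∧
      (∀ h : ℝ, 0 < h → h < 1 → ∀ t : ℝ,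
        |(∫ s in (0 : ℝ)..(t + h), m (Real.exp s)) + (∫ s in (0 : ℝ)..(t - h), m (Real.exp s))
            - 2 * ∫ s in (0 : ℝ)..t, m (Real.exp s)| / h ≤
          C * ‖T‖ * |Real.log h| ^ (-|1 / p.toReal - 1 / 2|))) := by
  obtain ⟨C₁, hC₁, h₁⟩ := norm_block_planar_le P
  obtain ⟨C₂, hC₂, h₂⟩ := secondDifference_planar_le P
  refine ⟨fun d hd => norm_block_le P d hd, C₁ + C₂ + 1, by positivity,
    fun p _ hp1 hpt m hm T hT => ⟨fun n hn t => ?_, fun h hh hh1 t => ?_⟩⟩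
  · refine (h₁ p hp1 hpt m hm T hT n hn t).trans ?_
    gcongr
    linarith
  · refine (h₂ p hp1 hpt m hm T hT h hh hh1 t).trans ?_
    gcongr
    linarith
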